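/- **Conventions.** Let $d\in\mathbb N$. All Hilbert spaces are complex, and $T:H\to K$ denotes a bounded operator. For a contraction $T:H\to K$ put $D_T=(I-T^*T)^{1/2}$, $D_{*,T}=(I-TT^*)^{1/2}$, $\mathcal D_T=\overline{\operatorname{ran}}\,D_T\subseteq H$, $\mathcal D_{*,T}=\overline{\operatorname{ran}}\,D_{*,T}\subseteq K$. A tuple $S=(S_1,\dots,S_d)$ of operators on $H$ is identified with the row operator $H^d\to H$, $(h_i)\mapsto\sum_i S_ih_i$, where $H^d=H\oplus\dots\oplus H$; it is a row contraction if $\sum_i S_iS_i^*\le I$, and then $D_S$ acts on $H^d$ and $D_{*,S}$ on $H$. For a word $\alpha=\alpha_1\cdots\alpha_n$ in $1,\dots,d$ put $S_\alpha=S_{\alpha_1}\cdots S_{\alpha_n}$ ($S_\emptyset=I$). Let $\Gamma$ be the full Fock space over $\mathbb C^d$, with orthonormal basis $(e_\alpha)$, vacuum vector $e_0=e_\emptyset$, left creation operators $L_ie_\alpha=e_i\otimes e_\alpha$ and right creation operators $R_ie_\alpha=e_\alpha\otimes e_i$. Write $T_\Gamma=I_\Gamma\otimes T$, and let $\underline R:\Gamma\otimes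 H^d\to\Gamma\otimes H$ be the row $(R_1\otimes I_H,\dots,R_d\otimes I_H)$. *Liftings.* A lifting of $C$ (on $H_C$) by $A$ (on $H_A$) is a tuple $E_i=\begin{bmatrix}C_i&0\\B_i&A_i\end{bmatrix}$ on $H_E=H_C\oplus H_A$. It is contractive if $E$ is a row contraction; then there is a unique contraction $\gamma:\mathcal D_{*,A}\to\mathcal D_C$ with $B^*=D_C\gamma D_{*,A}$. It is minimal if $H_E=\overline{\operatorname{span}}\{E_\alpha h:h\in H_C,\ \alpha \text{ a word}\}$. For a contractive lifting there are unique unitaries $\sigma_E:\mathcal D_E\to\mathcal D_{*,\gamma}\oplus\mathcal D_A$ and $\sigma'_E:\mathcal D_{*,E}\to\mathcal D_{*,C}\oplus\mathcal D_\gamma$ with $$\sigma_ED_E=\begin{bmatrix}D_{*,\gamma}D_C&0\\-A^*\gamma^*D_C&D_A\end{bmatrix}\ \text{ on } H_C^d\oplus H_A^d,\qquad \sigma'_ED_{*,E}=\begin{bmatrix}D_{*,C}&-C\gamma D_{*,A}\\0&D_\gamma D_{*,A}\end{bmatrix}\ \text{ on } H_C\oplus H_A .$$ *Characteristic functions.*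 The minimal isometric dilation $V^S$ of a row contraction $S$ on $H$ acts on $\hat H_S=H\oplus(\Gamma\otimes\mathcal D_S)$ by $V^S_j(h\oplus x)=S_jh\oplus\big(e_0\otimes D_S(0,\dots,h,\dots,0)+(L_j\otimes I)x\big)$, with $h$ in the $j$-th place. For a contractive lifting $E$ of $C$ there is a unitary $W:\hat H_E\to\hat H_C\oplus\mathcal K$ with $W|_{H_C}=I_{H_C}$ and $WV^E_i=(V^C_i\oplus Y_i)W$ for all $i$, where $\mathcal K$ is the orthogonal complement of $W^{-1}\hat H_C$ in $\hat H_E$ and $Y_i=V^E_i|_{\mathcal K}$. The characteristic function of the lifting is $M_{C,E}=P_{\Gamma\otimes\mathcal D_C}W|_{\Gamma\otimes\mathcal D_E}:\Gamma\otimes\mathcal D_E\to\Gamma\otimes\mathcal D_C$; it does not depend on the choice of $W$. The characteristic function $M_A:\Gamma\otimes\mathcal D_A\to\Gamma\otimes\mathcal D_{*,A}$ of a row contraction $A$ is the strong limit, as $r\uparrow1$, of $M_A(rR)=-A_\Gamma+D_{*,A_\Gamma}(I-r\underline RA_\Gamma^*)^{-1}r\underline RD_{A_\Gamma}$ restricted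 to $\Gamma\otimes\mathcal D_A$. **Theorem.** Let $C$ be a row contraction on $H_C$, let $E_i=\begin{bmatrix}C_i&0\\B_i&A_i\end{bmatrix}$ on $H_E=H_C\oplus H_A$ be a minimal contractive lifting of $C$ by $A$, and let $E'_i=\begin{bmatrix}E_i&0\\B'_i&A'_i\end{bmatrix}$ on $H_{E'}=H_E\oplus H_{A'}$ be a minimal contractive lifting of $E$ by $A'$. Write $B'_i=[(B'_1)_i,(B'_2)_i]$ on $H_C\oplus H_A$ and put $$\hat A_i=\begin{bmatrix}A_i&0\\(B'_2)_i&A'_i\end{bmatrix},\qquad \hat B_i=\begin{bmatrix}B_i\\(B'_1)_i\end{bmatrix}.$$ Then, under $(H_C\oplus H_A)\oplus H_{A'}=H_C\oplus(H_A\oplus H_{A'})$, $E'_i=\begin{bmatrix}C_i&0\\\hat B_i&\hat A_i\end{bmatrix}$ is a contractive lifting of $C$ by $\hat A$, and $\hat A$ is a contractive lifting of $A$ by $A'$. There are unique contractions $\hat\gamma:\mathcal D_{*,\hat A}\to\mathcal D_C$ and $\delta:\mathcal D_{*,A'}\to\mathcal D_A$ with $\hat B^*=D_C\hat\gamma D_{*,\hat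 A}$ and $B_2'^*=D_A\delta D_{*,A'}$; the characteristic functions $M_{C,E'}$, $M_A$, $M_{A'}$ exist and are unique, and so are the unitaries $\sigma_{\hat A},\sigma'_{\hat A}$ (for the lifting $\hat A$ of $A$, with $\delta$) and $\sigma_{E'}$ (for the lifting $E'$ of $C$, with $\hat\gamma$). As operators from $\Gamma\otimes H_{E'}^d$ to $\Gamma\otimes\mathcal D_C$, $$\begin{aligned}M_{C,E'}(I_\Gamma\otimes D_{E'})={}&\begin{bmatrix}D_{*,\hat\gamma_\Gamma}&\hat\gamma_\Gamma\end{bmatrix}\begin{bmatrix}I_{\Gamma\otimes\mathcal D_C}&0\\0&I_\Gamma\otimes(\sigma'_{\hat A})^{-1}\end{bmatrix}\begin{bmatrix}I_{\Gamma\otimes\mathcal D_C}&0&0\\0&M_A&0\\0&0&I_{\Gamma\otimes\mathcal D_{*,A'}}\end{bmatrix}\left(I_\Gamma\otimes\begin{bmatrix}I_{\mathcal D_C}&0&0\\0&D_{*,\delta}&\delta\\0&-\delta^*&D_\delta\end{bmatrix}\right)\\&\begin{bmatrix}I_{\Gamma\otimes\mathcal D_C}&0&0\\0&I_{\Gamma\otimes\mathcal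 D_A}&0\\0&0&M_{A'}\end{bmatrix}\begin{bmatrix}I_{\Gamma\otimes\mathcal D_C}&0\\0&I_\Gamma\otimes\sigma_{\hat A}\end{bmatrix}(I_\Gamma\otimes\sigma_{E'}D_{E'}).\end{aligned}$$ Here $\mathcal D_{*,\hat\gamma}\subseteq\mathcal D_C$ and $\mathcal D_{*,\delta}\subseteq\mathcal D_A$ are regarded as subspaces, and the product of the factors to the right of $(\sigma'_{\hat A})^{-1}$ takes its values in $\Gamma\otimes(\mathcal D_C\oplus\mathcal D_{*,A}\oplus\mathcal D_\delta)$, so that $I_\Gamma\otimes(\sigma'_{\hat A})^{-1}$ can be applied. -/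

import Mathlib

open Filter Topology
open scoped InnerProduct

noncomputable section

/-! ## Hilbert space direct sums and block operators -/

/-- The Hilbert space direct sum `H ⊕ K`. -/
def HilbSum (H K : Type*) : Type _ := WithLp 2 (H × K)

namespace HilbSum

variable (H K : Type*) [NormedAddCommGroup H] [InnerProductSpace ℂ H]
  [NormedAddCommGroup K] [InnerProductSpace ℂ K]

instance : NormedAddCommGroup (HilbSum H K) :=
  inferInstanceAs (NormedAddCommGroup (WithLp 2 (H × K)))

instance : InnerProductSpace ℂ (HilbSum H K) :=
  inferInstanceAs (InnerProductSpace ℂ (WithLp 2 (H × K)))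

instance [CompleteSpace H] [CompleteSpace K] : CompleteSpace (HilbSum H K) :=
  inferInstanceAs (CompleteSpace (WithLp 2 (H × K)))

/-- The projection onto the first summand. -/
def fstL : HilbSum H K →L[ℂ] H := WithLp.fstL 2 ℂ H K

/-- The projection onto the second summand. -/
def sndL : HilbSum H K →L[ℂ] K := WithLp.sndL 2 ℂ H K

variable {H K}

/-- The first component of a vector. -/
def fst (x : HilbSum H K) : H := fstL H K x

/-- The second component of a vector. -/
def snd (x : HilbSum H K) : K := sndL H K x

/-- The vector `a ⊕ b`. -/
def mk (a : H) (b : K) : HilbSum H K := WithLp.toLp 2 (a, b)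

/-- The identification `(H ⊕ K) ⊕ L = H ⊕ (K ⊕ L)`. -/
def assoc {L : Type*} [NormedAddCommGroup L] [InnerProductSpace ℂ L]
    (x : HilbSum (HilbSum H K) L) : HilbSum H (HilbSum K L) :=
  mk x.fst.fst (mk x.fst.snd x.snd)

end HilbSum

/-- The Hilbert space direct sum `H ⊕ ⋯ ⊕ H` of `d` copies of `H`. -/
abbrev HilbPow (d : ℕ) (H : Type*) := PiLp 2 (fun _ : Fin d => H)

section Block

variable {X Y Z X' Y' : Type*}
  [NormedAddCommGroup X] [InnerProductSpace ℂ X] [NormedAddCommGroup Y] [InnerProductSpace ℂ Y]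
  [NormedAddCommGroup Z] [InnerProductSpace ℂ Z]
  [NormedAddCommGroup X'] [InnerProductSpace ℂ X'] [NormedAddCommGroup Y'] [InnerProductSpace ℂ Y']

/-- The row `[a, b] : X ⊕ Y → Z`. -/
def rowBlock (a : X →L[ℂ] Z) (b : Y →L[ℂ] Z) : HilbSum X Y →L[ℂ] Z :=
  a ∘L HilbSum.fstL X Y + b ∘L HilbSum.sndL X Y

/-- The column `[a; b] : Z → X ⊕ Y`. -/
def colBlock (a : Z →L[ℂ] X) (b : Z →L[ℂ] Y) : Z →L[ℂ] HilbSum X Y :=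
  (WithLp.prodContinuousLinearEquiv 2 ℂ X Y).symm.toContinuousLinearMap ∘L a.prod b

/-- The operator matrix `[[a, b], [c, e]] : X ⊕ Y → X' ⊕ Y'`. -/
def blockOp (a : X →L[ℂ] X') (b : Y →L[ℂ] X') (c : X →L[ℂ] Y') (e : Y →L[ℂ] Y') :
    HilbSum X Y →L[ℂ] HilbSum X' Y' :=
  colBlock (rowBlock a b) (rowBlock c e)

/-- The diagonal operator `diag(a, e) : X ⊕ Y → X' ⊕ Y'`. -/
def diagOp (a : X →L[ℂ] X') (e : Y →L[ℂ] Y') : HilbSum X Y →L[ℂ] HilbSum X' Y' :=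
  blockOp a 0 0 e

/-- The embedding of the first summand. -/
def inlOp (X Y : Type*) [NormedAddCommGroup X] [InnerProductSpace ℂ X] [NormedAddCommGroup Y]
    [InnerProductSpace ℂ Y] : X →L[ℂ] HilbSum X Y :=
  colBlock (ContinuousLinearMap.id ℂ X) 0

/-- The embedding of the second summand. -/
def inrOp (X Y : Type*) [NormedAddCommGroup X] [InnerProductSpace ℂ X] [NormedAddCommGroup Y]
    [InnerProductSpace ℂ Y] : Y →L[ℂ] HilbSum X Y :=
  colBlock 0 (ContinuousLinearMap.id ℂ Y)

end Block

/-! ## Defect operators and Julia–Halmos matrices -/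

section Defect

variable {H K : Type*} [NormedAddCommGroup H] [InnerProductSpace ℂ H] [CompleteSpace H]
  [NormedAddCommGroup K] [InnerProductSpace ℂ K] [CompleteSpace K]

/-- The defect operator `D_T = (I - T* T)^{1/2}` of a contraction `T`.
The operator `D_{*,T} = (I - T T*)^{1/2}` is `defect (T†)`. -/
def defect (T : H →L[ℂ] K) : H →L[ℂ] H := CFC.sqrt (1 - T† ∘L T)

/-- The defect space of `T`, the closure of the range of `D_T`. -/
def defectSpace (T : H →L[ℂ] K) : Submodule ℂ H :=
  (LinearMap.range (defect T : H →ₗ[ℂ] H)).topologicalClosure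

instance (T : H →L[ℂ] K) : CompleteSpace (defectSpace T) :=
  (Submodule.isClosed_topologicalClosure _).completeSpace_coe

/-- The defect operator, as an operator into the defect space. -/
def toDefect (T : H →L[ℂ] K) : H →L[ℂ] defectSpace T :=
  (defect T).codRestrict (defectSpace T) fun x =>
    Submodule.le_topologicalClosure _ (LinearMap.mem_range_self _ x)

/-- The Julia–Halmos matrix `[[D_{*,T}, T], [-T*, D_T]]` of `T : H → K`, on `K ⊕ H`. -/
def julia (T : H →L[ℂ] K) : HilbSum K H →L[ℂ] HilbSum K H :=
  blockOp (defect (T†)) T (-(T†)) (defect T)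

end Defect

/-! ## Row contractions and liftings -/

section Rows

variable {d : ℕ} {H K : Type*} [NormedAddCommGroup H] [InnerProductSpace ℂ H] [CompleteSpace H]
  [NormedAddCommGroup K] [InnerProductSpace ℂ K] [CompleteSpace K]

/-- The row operator `(x_1, …, x_d) ↦ S_1 x_1 + ⋯ + S_d x_d`. -/
def rowOp (S : Fin d → H →L[ℂ] K) : HilbPow d H →L[ℂ] K :=
  ∑ i, S i ∘L PiLp.proj 2 (fun _ : Fin d => H) i

/-- `S` is a row contraction: `∑ S_i S_i* ≤ I`. -/
def IsRowContraction (S : Fin d → H →L[ℂ] H) : Prop :=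
  ∑ i, S i ∘L (S i)† ≤ 1

/-- The defect space `𝓓_S ⊆ H ⊕ ⋯ ⊕ H` of a row `S`. -/
abbrev rowDefect (S : Fin d → H →L[ℂ] H) : Submodule ℂ (HilbPow d H) :=
  defectSpace (rowOp S)

/-- The defect space `𝓓_{*,S} ⊆ H` of a row `S`. -/
abbrev rowCodefect (S : Fin d → H →L[ℂ] H) : Submodule ℂ H :=
  defectSpace ((rowOp S)†)

/-- `S_α = S_{α_1} ⋯ S_{α_n}` for a word `α = α_1 ⋯ α_n`; the empty word gives the identity. -/
def wordOp (S : Fin d → H →L[ℂ] H) (α : List (Fin d)) : H →L[ℂ] H :=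
  (α.map S).prod

/-- The lifting of `C` by `A` with off-diagonal part `B`: the operators
`[[C_i, 0], [B_i, A_i]]` on `H ⊕ K`. -/
def liftRow (C : Fin d → H →L[ℂ] H) (B : Fin d → H →L[ℂ] K) (A : Fin d → K →L[ℂ] K) :
    Fin d → HilbSum H K →L[ℂ] HilbSum H K :=
  fun i => blockOp (C i) 0 (B i) (A i)

/-- A lifting `E` on `H ⊕ K` of a row on `H` is a minimal contractive lifting: it is a row
contraction and `H ⊕ K` is the closed linear span of the vectors `E_α (h ⊕ 0)`. -/
def IsMinimalContractive (E : Fin d → HilbSum H K →L[ℂ] HilbSum H K) : Prop :=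
  IsRowContraction E ∧
    (Submodule.span ℂ {x | ∃ (α : List (Fin d)) (h : H),
      x = wordOp E α (inlOp H K h)}).topologicalClosure = ⊤

/-- The first components `(h_1, …, h_d)` of a vector of `(H ⊕ K)^d = H^d ⊕ K^d`. -/
def powFst (x : HilbPow d (HilbSum H K)) : HilbPow d H := WithLp.toLp 2 fun i => (x i).fst

/-- The second components `(k_1, …, k_d)` of a vector of `(H ⊕ K)^d = H^d ⊕ K^d`. -/
def powSnd (x : HilbPow d (HilbSum H K)) : HilbPow d K := WithLp.toLp 2 fun i => (x i).snd

/-- `γ : 𝓓_{*,A} → 𝓓_C` is the contraction belonging to the contractive lifting of `C` by `A`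
with off-diagonal part `B`: `B* = D_C γ D_{*,A}`. -/
def IsLiftingContraction (C : Fin d → H →L[ℂ] H) (B : Fin d → H →L[ℂ] K)
    (A : Fin d → K →L[ℂ] K) (γ : rowCodefect A →L[ℂ] rowDefect C) : Prop :=
  ‖γ‖ ≤ 1 ∧
    (rowOp B)† = defect (rowOp C) ∘L (rowDefect C).subtypeL ∘L γ ∘L toDefect ((rowOp A)†)

/-- The unitary `σ_E : 𝓓_E → 𝓓_{*,γ} ⊕ 𝓓_A` of a contractive lifting `E` of `C` by `A` with
contraction `γ`, determined by
`σ_E D_E = [[D_{*,γ} D_C, 0], [-A* γ* D_C, D_A]]` on `H^d ⊕ K^d`. -/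
def IsSigma (C : Fin d → H →L[ℂ] H) (A : Fin d → K →L[ℂ] K)
    (E : Fin d → HilbSum H K →L[ℂ] HilbSum H K) (γ : rowCodefect A →L[ℂ] rowDefect C)
    (σ : rowDefect E ≃ₗᵢ[ℂ] HilbSum (defectSpace (γ†)) (rowDefect A)) : Prop :=
  ∀ x : HilbPow d (HilbSum H K),
    ((σ (toDefect (rowOp E) x)).fst : rowDefect C)
        = defect (γ†) (toDefect (rowOp C) (powFst x)) ∧
    ((σ (toDefect (rowOp E) x)).snd : HilbPow d K)
        = -(((rowOp A)†) (((γ†) (toDefect (rowOp C) (powFst x)) : rowCodefect A) : K))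
          + defect (rowOp A) (powSnd x)

/-- The unitary `σ'_E : 𝓓_{*,E} → 𝓓_{*,C} ⊕ 𝓓_γ` of a contractive lifting `E` of `C` by `A` with
contraction `γ`, determined by
`σ'_E D_{*,E} = [[D_{*,C}, -C γ D_{*,A}], [0, D_γ D_{*,A}]]` on `H ⊕ K`. -/
def IsSigma' (C : Fin d → H →L[ℂ] H) (A : Fin d → K →L[ℂ] K)
    (E : Fin d → HilbSum H K →L[ℂ] HilbSum H K) (γ : rowCodefect A →L[ℂ] rowDefect C)
    (σ' : rowCodefect E ≃ₗᵢ[ℂ] HilbSum (rowCodefect C) (defectSpace γ)) : Prop :=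
  ∀ x : HilbSum H K,
    ((σ' (toDefect ((rowOp E)†) x)).fst : H)
        = defect ((rowOp C)†) x.fst
          - rowOp C ((γ (toDefect ((rowOp A)†) x.snd) : rowDefect C) : HilbPow d H) ∧
    ((σ' (toDefect ((rowOp E)†) x)).snd : rowCodefect A)
        = defect γ (toDefect ((rowOp A)†) x.snd)

end Rows

/-! ## The Fock space -/

/-- `Γ(ℂ^d) ⊗ H`. The full Fock space `Γ(ℂ^d)` has the orthonormal basis `e_α`, `α` a word in
`1, …, d`, so `Γ(ℂ^d) ⊗ H` is the space of square-summable `H`-valued families on the words, and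
`e_α ⊗ h` is the family supported at `α` with value `h`. -/
def Fock (d : ℕ) (H : Type*) [NormedAddCommGroup H] : Type _ :=
  lp (fun _ : List (Fin d) => H) 2

instance (d : ℕ) (H : Type*) [NormedAddCommGroup H] : NormedAddCommGroup (Fock d H) :=
  inferInstanceAs (NormedAddCommGroup (lp (fun _ : List (Fin d) => H) 2))

instance (d : ℕ) (H : Type*) [NormedAddCommGroup H] [InnerProductSpace ℂ H] :
    InnerProductSpace ℂ (Fock d H) :=
  inferInstanceAs (InnerProductSpace ℂ (lp (fun _ : List (Fin d) => H) 2))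

instance (d : ℕ) (H : Type*) [NormedAddCommGroup H] [CompleteSpace H] :
    CompleteSpace (Fock d H) :=
  inferInstanceAs (CompleteSpace (lp (fun _ : List (Fin d) => H) 2))

section FockSpace

variable {d : ℕ} {H K X Y X' Y' : Type*}
  [NormedAddCommGroup H] [InnerProductSpace ℂ H] [NormedAddCommGroup K] [InnerProductSpace ℂ K]
  [NormedAddCommGroup X] [InnerProductSpace ℂ X] [NormedAddCommGroup Y] [InnerProductSpace ℂ Y]
  [NormedAddCommGroup X'] [InnerProductSpace ℂ X'] [NormedAddCommGroup Y'] [InnerProductSpace ℂ Y']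

/-- `I_Γ ⊗ T`. -/
def amp (T : H →L[ℂ] K) : Fock d H →L[ℂ] Fock d K :=
  lp.mapCLM 2 (fun _ : List (Fin d) => T) (norm_nonneg T) (fun _ => le_rfl)

/-- `h ↦ e_0 ⊗ h`, where `e_0` is the vacuum vector. -/
def vacuum : H →L[ℂ] Fock d H :=
  lp.singleContinuousLinearMap ℂ (fun _ : List (Fin d) => H) 2 []

lemma hasSum_extend_word {d : ℕ} {H : Type*} [NormedAddCommGroup H]
    {f : List (Fin d) → List (Fin d)} (hf : f.Injective) (x : lp (fun _ : List (Fin d) => H) 2) :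
    HasSum (fun β => ‖Function.extend f (x : List (Fin d) → H) 0 β‖ ^ (2 : ENNReal).toReal)
      (‖x‖ ^ (2 : ENNReal).toReal) := by
  have h := lp.hasSum_norm (p := 2) (by norm_num) x
  rw [← hf.hasSum_iff]
  · simpa [Function.comp_def, hf.extend_apply] using h
  · intro β hβ
    rw [Function.extend_apply' _ _ _ (by simpa using hβ)]
    simp

/-- For an injective map `f` of words, the isometry of `ℓ²` `e_α ⊗ h ↦ e_{f(α)} ⊗ h`. -/
def pushWordAux (f : List (Fin d) → List (Fin d)) (hf : f.Injective) :
    lp (fun _ : List (Fin d) => H) 2 →ₗᵢ[ℂ] lp (fun _ : List (Fin d) => H) 2 where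
  toFun x := ⟨Function.extend f (x : List (Fin d) → H) 0,
    memℓp_gen (hasSum_extend_word hf x).summable⟩
  map_add' x y := by
    ext β
    change Function.extend f (⇑x + ⇑y) 0 β = Function.extend f (⇑x) 0 β + Function.extend f (⇑y) 0 β
    by_cases hβ : ∃ α, f α = β
    · obtain ⟨α, rfl⟩ := hβ
      simp [hf.extend_apply]
    · simp [Function.extend_apply' _ _ _ hβ]
  map_smul' c x := by
    ext β
    change Function.extend f (c • ⇑x) 0 β = c • Function.extend f (⇑x) 0 β
    by_cases hβ : ∃ α, f α = β
    · obtain ⟨α, rfl⟩ := hβ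
      simp [hf.extend_apply]
    · simp [Function.extend_apply' _ _ _ hβ]
  norm_map' x := by
    have h := (hasSum_extend_word hf x).tsum_eq
    rw [lp.norm_eq_tsum_rpow (p := 2) (by norm_num)]
    refine (congrArg (· ^ (1 / (2 : ENNReal).toReal)) h).trans ?_
    rw [← Real.rpow_mul (norm_nonneg x)]
    simp

/-- For an injective map `f` of words, the isometry `e_α ⊗ h ↦ e_{f(α)} ⊗ h` of `Γ ⊗ H`. -/
def pushWord (f : List (Fin d) → List (Fin d)) (hf : f.Injective) :
    Fock d H →ₗᵢ[ℂ] Fock d H :=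
  pushWordAux f hf

/-- The left creation operator `L_j ⊗ I : e_α ⊗ h ↦ e_j ⊗ e_α ⊗ h`. -/
def leftCreation (j : Fin d) : Fock d H →ₗᵢ[ℂ] Fock d H :=
  pushWord (fun α => j :: α) (List.cons_injective)

/-- The right creation operator `R_j ⊗ I : e_α ⊗ h ↦ e_α ⊗ e_j ⊗ h`. -/
def rightCreation (j : Fin d) : Fock d H →ₗᵢ[ℂ] Fock d H :=
  pushWord (fun α => α ++ [j]) (List.append_left_injective [j])

/-- The row `(R_1 ⊗ I, …, R_d ⊗ I) : Γ ⊗ H^d → Γ ⊗ H`. -/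
def rightRow : Fock d (HilbPow d H) →L[ℂ] Fock d H :=
  ∑ j, (rightCreation j).toContinuousLinearMap ∘L amp (PiLp.proj 2 (fun _ : Fin d => H) j)

/-- The operator `diag(S, T)` on `Γ ⊗ (X ⊕ Y)`, under the identification `Γ ⊗ (X ⊕ Y) = (Γ ⊗ X) ⊕ (Γ ⊗ Y)`. -/
def fockDiag (S : Fock d X →L[ℂ] Fock d X') (T : Fock d Y →L[ℂ] Fock d Y') :
    Fock d (HilbSum X Y) →L[ℂ] Fock d (HilbSum X' Y') :=
  amp (inlOp X' Y') ∘L S ∘L amp (HilbSum.fstL X Y)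
    + amp (inrOp X' Y') ∘L T ∘L amp (HilbSum.sndL X Y)

end FockSpace

/-! ## Characteristic functions -/

section CharacteristicFunctions

variable {d : ℕ} {H K : Type*} [NormedAddCommGroup H] [InnerProductSpace ℂ H] [CompleteSpace H]
  [NormedAddCommGroup K] [InnerProductSpace ℂ K] [CompleteSpace K]

/-- The operators `M_A(rR) = -A_Γ + D_{*,A_Γ} (I - r R A_Γ*)⁻¹ r R D_{A_Γ}`, here on all of
`Γ ⊗ H^d`. For a row contraction `A` and `0 ≤ r < 1` the inverse is a genuine one. -/
def charApprox (A : Fin d → H →L[ℂ] H) (r : ℝ) : Fock d (HilbPow d H) →L[ℂ] Fock d H :=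
  -amp (rowOp A)
    + amp (defect ((rowOp A)†))
      ∘L Ring.inverse (1 - (r : ℂ) • (rightRow ∘L amp ((rowOp A)†)))
      ∘L ((r : ℂ) • rightRow) ∘L amp (defect (rowOp A))

/-- `M : Γ ⊗ 𝓓_A → Γ ⊗ 𝓓_{*,A}` is the characteristic function `M_A` of the row contraction `A`:
the strong limit of `M_A(rR)` as `r` increases to `1`. -/
def IsRowCharFun (A : Fin d → H →L[ℂ] H)
    (M : Fock d (rowDefect A) →L[ℂ] Fock d (rowCodefect A)) : Prop :=
  ∀ x : Fock d (rowDefect A),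
    Tendsto (fun r : ℝ => charApprox A r (amp (rowDefect A).subtypeL x)) (𝓝[<] 1)
      (𝓝 (amp (rowCodefect A).subtypeL (M x)))

/-- The space `H ⊕ (Γ ⊗ 𝓓_S)` of the minimal isometric dilation of a row contraction `S`. -/
abbrev DilSpace (S : Fin d → H →L[ℂ] H) : Type _ := HilbSum H (Fock d (rowDefect S))

/-- The minimal isometric dilation of `S`:
`V_j (h ⊕ x) = S_j h ⊕ (e_0 ⊗ (D_S)_j h + (L_j ⊗ I) x)`, where
`(D_S)_j h = D_S (0, …, h, …, 0)` with `h` in the `j`-th place. -/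
def dilation (S : Fin d → H →L[ℂ] H) (j : Fin d) : DilSpace S →L[ℂ] DilSpace S :=
  blockOp (S j) 0
    (vacuum ∘L toDefect (rowOp S) ∘L
      (PiLp.continuousLinearEquiv 2 ℂ (fun _ : Fin d => H)).symm.toContinuousLinearMap ∘L
        ContinuousLinearMap.single ℂ (fun _ : Fin d => H) j)
    (leftCreation j).toContinuousLinearMap

/-- Data of the definition of the characteristic function of a contractive lifting `E`, on
`H ⊕ K`, of a row contraction `C` on `H`: the dilation space of `C` sits in the dilation space of
`E` by means of `W⁻¹`, `L` is the orthogonal complement of its image, `Y` is the restriction to `L`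
of the dilation of `E`, and the unitary `W` from the dilation space of `E` onto
(the dilation space of `C`) `⊕ L` is the identity on `H` and intertwines the dilation of `E`
with the direct sum of the dilation of `C` and `Y`. -/
structure IsLiftingUnitary (C : Fin d → H →L[ℂ] H) (E : Fin d → HilbSum H K →L[ℂ] HilbSum H K)
    (L : Submodule ℂ (DilSpace E)) (Y : Fin d → L →L[ℂ] L)
    (W : DilSpace E ≃ₗᵢ[ℂ] HilbSum (DilSpace C) L) : Prop where
  mem_iff : ∀ x : DilSpace E, x ∈ L ↔ ∀ y : DilSpace C, inner ℂ (W.symm (inlOp _ _ y)) x = 0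
  coe_restrict : ∀ (i : Fin d) (x : L), (Y i x : DilSpace E) = dilation E i x
  map_base : ∀ h : H, W (inlOp _ _ (inlOp H K h)) = inlOp _ _ (inlOp _ _ h)
  intertwines : ∀ (i : Fin d) (x : DilSpace E),
    W (dilation E i x) = diagOp (dilation C i) (Y i) (W x)

/-- `M : Γ ⊗ 𝓓_E → Γ ⊗ 𝓓_C` is the characteristic function `M_{C,E}` of the contractive lifting
`E` of `C`: the compression `P_{Γ ⊗ 𝓓_C} W |_{Γ ⊗ 𝓓_E}`. -/
def IsLiftingCharFun (C : Fin d → H →L[ℂ] H) (E : Fin d → HilbSum H K →L[ℂ] HilbSum H K)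
    (M : Fock d (rowDefect E) →L[ℂ] Fock d (rowDefect C)) : Prop :=
  ∃ (L : Submodule ℂ (DilSpace E)) (Y : Fin d → L →L[ℂ] L)
    (W : DilSpace E ≃ₗᵢ[ℂ] HilbSum (DilSpace C) L),
    IsLiftingUnitary C E L Y W ∧
      ∀ x : Fock d (rowDefect E), M x = (W (inrOp _ _ x)).fst.snd

end CharacteristicFunctions

/-! ## Two-step liftings -/

section TwoStep

variable {d : ℕ} {HC HA HA' : Type*}
  [NormedAddCommGroup HC] [InnerProductSpace ℂ HC]
  [NormedAddCommGroup HA] [InnerProductSpace ℂ HA]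
  [NormedAddCommGroup HA'] [InnerProductSpace ℂ HA']

/-- `(B'_1)_i`, where `B'_i = [(B'_1)_i, (B'_2)_i]` on `H_C ⊕ H_A`. -/
def fstPart (B' : Fin d → HilbSum HC HA →L[ℂ] HA') : Fin d → HC →L[ℂ] HA' :=
  fun i => B' i ∘L inlOp HC HA

/-- `(B'_2)_i`, where `B'_i = [(B'_1)_i, (B'_2)_i]` on `H_C ⊕ H_A`. -/
def sndPart (B' : Fin d → HilbSum HC HA →L[ℂ] HA') : Fin d → HA →L[ℂ] HA' :=
  fun i => B' i ∘L inrOp HC HA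

/-- `B̂_i = [B_i; (B'_1)_i] : H_C → H_A ⊕ H_{A'}`. -/
def hatB (B : Fin d → HC →L[ℂ] HA) (B' : Fin d → HilbSum HC HA →L[ℂ] HA') :
    Fin d → HC →L[ℂ] HilbSum HA HA' :=
  fun i => colBlock (B i) (fstPart B' i)

end TwoStep

end

/-!
The characteristic function `M_A` of a row contraction `A` is the transfer operator of a linear
system indexed by words. With input `x ∈ Γ ⊗ 𝓓_A` and initial state `h` its states and outputs are

  `f(∅) = h`, `f(α i) = (A* f(α) + D_A x(α))_i`, `y(α) = D_{*,A} f(α) - A x(α)`,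

and `M_A x = y` for `h = 0`. One step of the system is the Julia–Halmos operator of `A`, which
preserves norms, so the outputs have at most the energy of the initial state and of the input.
The operators `M_A(rR)` belong to the same system damped by `r` in every step; they are contractions
and converge to `M_A` on the vectors `e_β ⊗ h`, hence strongly (`isRowCharFun_iff`).

For a contractive lifting `E` of `C` by `A`, with contraction `γ`, the characteristic function is
`M_{C,E} = [D_{*,γ}, γ M_A] σ_E` (`isLiftingCharFun_iff`). Indeed, let `N` be the operator
`(h_C ⊕ h_A) ⊕ x ↦ h_C ⊕ [D_{*,γ}, γ M_A] σ_E x` between the dilation spaces, where `h_A` is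
the initial state of the system of `A`. It is a contraction by the energy balance, and intertwines
the minimal isometric dilations of `E` and `C`, since one step of the system inverts the step which
defines `σ_E` (`dilationProj_dilation`). A contraction which intertwines isometries and is the
identity on the generating space `H_C` is a coisometry whose adjoint intertwines as well
(`adjoint_intertwining`), so `N*` is the embedding `W⁻¹` of the dilation space of `C`, and `N` is
the compression of `W`.

The system of `E` itself is a cascade: in its states the component in `H_A` follows the system of
`A`, whose output, after `[D_{*,γ}, γ]`, is the input `M_{C,E} x` of the system of `C`, which the
component in `H_C` follows (`state_liftRow`). Comparing outputs gives

  `σ'_E M_E = diag(M_C, I) J_γ diag(I, M_A) σ_E`,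

where `J_γ` is the Julia–Halmos operator of `γ` (`sigma'_rowCharFun`, `amp_sigma'_comp_rowCharFun`).

A two-step lifting is, by associativity, a lifting `E'` of `C` by `Â`, so that
`M_{C,E'} = [D_{*,γ̂}, γ̂ M_Â] σ_{E'}`, and `Â` is a lifting of `A` by `A'`, so that `M_Â` is given
by the cascade formula with `δ`. The factorization is the composition of the two formulas.
-/

noncomputable section

/-! ### Vectors of a Hilbert space direct sum -/

namespace HilbSum

variable {H K : Type*} [NormedAddCommGroup H] [InnerProductSpace ℂ H]
  [NormedAddCommGroup K] [InnerProductSpace ℂ K]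

@[simp] lemma fstL_apply (x : HilbSum H K) : fstL H K x = x.fst := rfl

@[simp] lemma sndL_apply (x : HilbSum H K) : sndL H K x = x.snd := rfl

@[simp] lemma fst_mk (a : H) (b : K) : (mk a b).fst = a := rfl

@[simp] lemma snd_mk (a : H) (b : K) : (mk a b).snd = b := rfl

@[simp] lemma mk_fst_snd (x : HilbSum H K) : mk x.fst x.snd = x := rfl

@[ext] lemma ext {x y : HilbSum H K} (h₁ : x.fst = y.fst) (h₂ : x.snd = y.snd) : x = y := by
  rw [← mk_fst_snd x, ← mk_fst_snd y, h₁, h₂]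

@[simp] lemma fst_add (x y : HilbSum H K) : (x + y).fst = x.fst + y.fst := rfl

@[simp] lemma snd_add (x y : HilbSum H K) : (x + y).snd = x.snd + y.snd := rfl

@[simp] lemma fst_sub (x y : HilbSum H K) : (x - y).fst = x.fst - y.fst := rfl

@[simp] lemma snd_sub (x y : HilbSum H K) : (x - y).snd = x.snd - y.snd := rfl

@[simp] lemma fst_smul (c : ℂ) (x : HilbSum H K) : (c • x).fst = c • x.fst := rfl

@[simp] lemma snd_smul (c : ℂ) (x : HilbSum H K) : (c • x).snd = c • x.snd := rfl

@[simp] lemma fst_zero : (0 : HilbSum H K).fst = 0 := rfl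

@[simp] lemma snd_zero : (0 : HilbSum H K).snd = 0 := rfl

lemma norm_sq (x : HilbSum H K) : ‖x‖ ^ 2 = ‖x.fst‖ ^ 2 + ‖x.snd‖ ^ 2 :=
  WithLp.prod_norm_sq_eq_of_L2 x

lemma inner_def (x y : HilbSum H K) :
    inner ℂ x y = inner ℂ x.fst y.fst + inner ℂ x.snd y.snd :=
  WithLp.prod_inner_apply x y

end HilbSum

section Block

variable {X Y Z X' Y' : Type*}
  [NormedAddCommGroup X] [InnerProductSpace ℂ X] [NormedAddCommGroup Y] [InnerProductSpace ℂ Y]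
  [NormedAddCommGroup Z] [InnerProductSpace ℂ Z]
  [NormedAddCommGroup X'] [InnerProductSpace ℂ X'] [NormedAddCommGroup Y'] [InnerProductSpace ℂ Y']

@[simp] lemma rowBlock_apply (a : X →L[ℂ] Z) (b : Y →L[ℂ] Z) (x : HilbSum X Y) :
    rowBlock a b x = a x.fst + b x.snd := rfl

@[simp] lemma fst_colBlock (a : Z →L[ℂ] X) (b : Z →L[ℂ] Y) (z : Z) :
    (colBlock a b z).fst = a z := rfl

@[simp] lemma snd_colBlock (a : Z →L[ℂ] X) (b : Z →L[ℂ] Y) (z : Z) :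
    (colBlock a b z).snd = b z := rfl

@[simp] lemma fst_blockOp (a : X →L[ℂ] X') (b : Y →L[ℂ] X') (c : X →L[ℂ] Y') (e : Y →L[ℂ] Y')
    (x : HilbSum X Y) : (blockOp a b c e x).fst = a x.fst + b x.snd := rfl

@[simp] lemma snd_blockOp (a : X →L[ℂ] X') (b : Y →L[ℂ] X') (c : X →L[ℂ] Y') (e : Y →L[ℂ] Y')
    (x : HilbSum X Y) : (blockOp a b c e x).snd = c x.fst + e x.snd := rfl

@[simp] lemma fst_diagOp (a : X →L[ℂ] X') (e : Y →L[ℂ] Y') (x : HilbSum X Y) :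
    (diagOp a e x).fst = a x.fst := by simp [diagOp]

@[simp] lemma snd_diagOp (a : X →L[ℂ] X') (e : Y →L[ℂ] Y') (x : HilbSum X Y) :
    (diagOp a e x).snd = e x.snd := by simp [diagOp]

@[simp] lemma fst_inlOp (x : X) : (inlOp X Y x).fst = x := rfl

@[simp] lemma snd_inlOp (x : X) : (inlOp X Y x).snd = 0 := rfl

@[simp] lemma fst_inrOp (y : Y) : (inrOp X Y y).fst = 0 := rfl

@[simp] lemma snd_inrOp (y : Y) : (inrOp X Y y).snd = y := rfl

lemma norm_inlOp (x : X) : ‖inlOp X Y x‖ = ‖x‖ := by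
  refine (sq_eq_sq₀ (norm_nonneg _) (norm_nonneg _)).1 ?_
  simp [HilbSum.norm_sq]

end Block

/-! ### Defect operators -/

section Defect

variable {H K : Type*} [NormedAddCommGroup H] [InnerProductSpace ℂ H]
  [NormedAddCommGroup K] [InnerProductSpace ℂ K]

lemma norm_apply_le_of_norm_le_one {T : H →L[ℂ] K} (hT : ‖T‖ ≤ 1) (x : H) : ‖T x‖ ≤ ‖x‖ := by
  simpa using T.le_of_opNorm_le hT x

lemma norm_inner_self_eq (x : H) : ‖inner ℂ x x‖ = ‖x‖ * ‖x‖ := by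
  rw [inner_self_eq_norm_sq_to_K]
  simp [sq]

variable [CompleteSpace H] [CompleteSpace K]

lemma norm_adjoint_le_one {T : H →L[ℂ] K} (hT : ‖T‖ ≤ 1) : ‖T†‖ ≤ 1 := by
  rwa [LinearIsometryEquiv.norm_map]

lemma one_sub_adjoint_comp_nonneg {T : H →L[ℂ] K} (hT : ‖T‖ ≤ 1) :
    (0 : H →L[ℂ] H) ≤ 1 - T† ∘L T := by
  rw [ContinuousLinearMap.nonneg_iff_isPositive, ContinuousLinearMap.isPositive_iff_complex]
  intro x
  have h : inner ℂ ((1 - T† ∘L T) x) x = ((‖x‖ ^ 2 - ‖T x‖ ^ 2 : ℝ) : ℂ) := by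
    simp [ContinuousLinearMap.adjoint_inner_left]
  rw [h]
  have h2 := norm_apply_le_of_norm_le_one hT x
  refine ⟨by rw [RCLike.re_eq_complex_re, Complex.ofReal_re], ?_⟩
  rw [RCLike.re_eq_complex_re, Complex.ofReal_re]
  nlinarith [norm_nonneg (T x)]

lemma defect_nonneg (T : H →L[ℂ] K) : 0 ≤ defect T := CFC.sqrt_nonneg _

lemma defect_isPositive (T : H →L[ℂ] K) : (defect T).IsPositive :=
  (ContinuousLinearMap.nonneg_iff_isPositive _).1 (defect_nonneg T)

@[simp] lemma adjoint_defect (T : H →L[ℂ] K) : (defect T)† = defect T :=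
  (defect_isPositive T).isSelfAdjoint.adjoint_eq

lemma inner_defect_left (T : H →L[ℂ] K) (x y : H) :
    inner ℂ (defect T x) y = inner ℂ x (defect T y) := by
  conv_lhs => rw [← adjoint_defect, ContinuousLinearMap.adjoint_inner_left]

lemma defect_mul_self {T : H →L[ℂ] K} (hT : ‖T‖ ≤ 1) : defect T * defect T = 1 - T† ∘L T :=
  CFC.sqrt_mul_sqrt_self _ (one_sub_adjoint_comp_nonneg hT)

lemma defect_defect {T : H →L[ℂ] K} (hT : ‖T‖ ≤ 1) (x : H) :
    defect T (defect T x) = x - (T†) (T x) := by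
  simpa using DFunLike.congr_fun (defect_mul_self hT) x

lemma defect_adjoint_defect_adjoint {T : H →L[ℂ] K} (hT : ‖T‖ ≤ 1) (y : K) :
    defect (T†) (defect (T†) y) = y - T ((T†) y) := by
  simpa using defect_defect (norm_adjoint_le_one hT) y

lemma norm_defect_sq {T : H →L[ℂ] K} (hT : ‖T‖ ≤ 1) (x : H) :
    ‖defect T x‖ ^ 2 = ‖x‖ ^ 2 - ‖T x‖ ^ 2 := by
  have h : inner ℂ (defect T x) (defect T x) = inner ℂ x x - inner ℂ (T x) (T x) := by
    rw [inner_defect_left, defect_defect hT, inner_sub_right,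
      ContinuousLinearMap.adjoint_inner_right]
  rw [inner_self_eq_norm_sq_to_K, inner_self_eq_norm_sq_to_K, inner_self_eq_norm_sq_to_K] at h
  exact_mod_cast h

/-- The intertwining relation `T D_T = D_{*,T} T`. The self-adjoint operator
`[[0, T*], [T, 0]]` commutes with its own square, hence with `diag(D_T, D_{*,T})`, the positive
square root of one minus that square; the relation is an entry of this identity. -/
lemma apply_defect {T : H →L[ℂ] K} (hT : ‖T‖ ≤ 1) (x : H) :
    T (defect T x) = defect (T†) (T x) := by
  let S : HilbSum H K →L[ℂ] HilbSum H K := blockOp 0 (T†) T 0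
  let D : HilbSum H K →L[ℂ] HilbSum H K := diagOp (defect T) (defect (T†))
  have hD : 0 ≤ D := by
    rw [ContinuousLinearMap.nonneg_iff_isPositive, ContinuousLinearMap.isPositive_iff_complex]
    intro x
    have h₁ := (ContinuousLinearMap.isPositive_iff_complex _).1 (defect_isPositive T) x.fst
    have h₂ := (ContinuousLinearMap.isPositive_iff_complex _).1 (defect_isPositive (T†)) x.snd
    rw [HilbSum.inner_def]
    simp only [D, fst_diagOp, snd_diagOp]
    refine ⟨?_, ?_⟩
    · rw [map_add, Complex.ofReal_add, h₁.1, h₂.1]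
    · rw [map_add]
      exact add_nonneg h₁.2 h₂.2
  have hDS : D * D = 1 - S * S := by
    ext x
    · simp [S, D, defect_defect hT]
    · simp [S, D, defect_adjoint_defect_adjoint hT]
  have hsq : CFC.sqrt (1 - S * S) = D := CFC.sqrt_unique hDS hD
  have hcomm : Commute (CFC.sqrt (1 - S * S)) S :=
    Commute.cfcₙ_nnreal (((Commute.one_left S).sub_left
      ((Commute.refl S).mul_left (Commute.refl S)))) _
  rw [hsq] at hcomm
  have h := congrArg HilbSum.snd (DFunLike.congr_fun hcomm.eq (inlOp H K x))
  simpa [S, D] using h.symm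

lemma adjoint_apply_defect {T : H →L[ℂ] K} (hT : ‖T‖ ≤ 1) (y : K) :
    (T†) (defect (T†) y) = defect T ((T†) y) := by
  simpa using apply_defect (norm_adjoint_le_one hT) y

/-- The Julia–Halmos operator of a contraction preserves the norm. -/
lemma julia_norm_sq {T : H →L[ℂ] K} (hT : ‖T‖ ≤ 1) (y : K) (x : H) :
    ‖defect (T†) y + T x‖ ^ 2 + ‖defect T x - (T†) y‖ ^ 2 = ‖y‖ ^ 2 + ‖x‖ ^ 2 := by
  have h₁ := norm_defect_sq hT x
  have h₂ := norm_defect_sq (norm_adjoint_le_one hT) y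
  have h : inner ℂ (defect (T†) y) (T x) = inner ℂ ((T†) y) (defect T x) := by
    rw [inner_defect_left, ← apply_defect hT, ContinuousLinearMap.adjoint_inner_left]
  rw [@norm_add_sq ℂ, @norm_sub_sq ℂ, h, inner_re_symm (𝕜 := ℂ) (defect T x)]
  linarith

lemma julia_norm_sq' {T : H →L[ℂ] K} (hT : ‖T‖ ≤ 1) (y : K) (x : H) :
    ‖defect (T†) y - T x‖ ^ 2 + ‖defect T x + (T†) y‖ ^ 2 = ‖y‖ ^ 2 + ‖x‖ ^ 2 := by
  have h := julia_norm_sq hT y (-x)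
  rw [map_neg, map_neg, ← sub_eq_add_neg, norm_neg] at h
  rw [← h, ← norm_neg (defect T x + _)]
  congr 3
  abel

/-! ### Defect spaces -/

@[simp] lemma coe_toDefect (T : H →L[ℂ] K) (x : H) : (toDefect T x : H) = defect T x := rfl

lemma norm_toDefect_sq {T : H →L[ℂ] K} (hT : ‖T‖ ≤ 1) (x : H) :
    ‖toDefect T x‖ ^ 2 = ‖x‖ ^ 2 - ‖T x‖ ^ 2 :=
  norm_defect_sq hT x

lemma defect_mem_defectSpace (T : H →L[ℂ] K) (x : H) : defect T x ∈ defectSpace T :=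
  (toDefect T x).2

lemma denseRange_toDefect (T : H →L[ℂ] K) : DenseRange (toDefect T) := by
  intro y
  rw [closure_subtype]
  have h : (y : H) ∈ closure (Set.range (defect T)) := by
    have : (y : H) ∈ closure (LinearMap.range (defect T : H →ₗ[ℂ] H) : Set H) := y.2
    simpa using! this
  convert h
  ext z
  simp only [Set.mem_image, Set.mem_range, exists_exists_eq_and, coe_toDefect]

lemma adjoint_toDefect (T : H →L[ℂ] K) (x : defectSpace T) :
    ((toDefect T)†) x = defect T x := by
  refine ext_inner_left ℂ fun y => ?_
  rw [ContinuousLinearMap.adjoint_inner_right, Submodule.coe_inner, coe_toDefect,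
    inner_defect_left]

/-- A closed condition on a defect space holds as soon as it holds on the range of the defect
operator. -/
lemma defectSpace_induction {T : H →L[ℂ] K} {p : defectSpace T → Prop}
    (hp : IsClosed {x | p x}) (h : ∀ x, p (toDefect T x)) (x : defectSpace T) : p x :=
  (denseRange_toDefect T).induction_on x hp h

/-- A contraction `T` maps `𝓓_T` into `𝓓_{*,T}`. -/
lemma apply_mem_defectSpace {T : H →L[ℂ] K} (hT : ‖T‖ ≤ 1) (x : defectSpace T) :
    T x ∈ defectSpace (T†) := by
  refine defectSpace_induction (p := fun x => T x ∈ defectSpace (T†)) ?_ (fun x => ?_) x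
  · exact (Submodule.isClosed_topologicalClosure _).preimage
      (T.continuous.comp continuous_subtype_val)
  · rw [coe_toDefect, apply_defect hT]
    exact defect_mem_defectSpace _ _

/-- The adjoint of a contraction `T` maps `𝓓_{*,T}` into `𝓓_T`. -/
lemma adjoint_apply_mem_defectSpace {T : H →L[ℂ] K} (hT : ‖T‖ ≤ 1) (y : defectSpace (T†)) :
    (T†) y ∈ defectSpace T := by
  simpa using apply_mem_defectSpace (norm_adjoint_le_one hT) y

end Defect

/-! ### Operators prescribed on a dense range -/

section Extension

variable {H K H' K' : Type*} [NormedAddCommGroup H] [InnerProductSpace ℂ H]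
  [NormedAddCommGroup K] [InnerProductSpace ℂ K]
  [NormedAddCommGroup H'] [InnerProductSpace ℂ H']
  [NormedAddCommGroup K'] [InnerProductSpace ℂ K']

lemma ContinuousLinearMap.ext_of_denseRange {T : H →L[ℂ] H'} (hT : DenseRange T)
    {F G : H' →L[ℂ] K} (h : ∀ x, F (T x) = G (T x)) : F = G := by
  ext x
  refine hT.induction_on x (isClosed_eq F.continuous G.continuous) h

variable [CompleteSpace H']

lemma denseRange_of_inner_eq_zero {F : H →L[ℂ] H'}
    (h : ∀ y, (∀ x, inner ℂ (F x) y = 0) → y = 0) : DenseRange F := by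
  have h1 : (LinearMap.range F.toLinearMap)ᗮ = ⊥ := by
    refine (Submodule.eq_bot_iff _).2 fun y hy => h y fun x => ?_
    exact (Submodule.mem_orthogonal _ _).1 hy _ (LinearMap.mem_range_self _ x)
  have h2 := Submodule.dense_iff_topologicalClosure_eq_top.2
    ((Submodule.topologicalClosure_eq_top_iff).2 h1)
  simpa [DenseRange] using! h2

lemma existsUnique_unitary [CompleteSpace K'] {T : H →L[ℂ] H'} (hT : DenseRange T) {F : H →L[ℂ] K'}
    (hF : DenseRange F) (h : ∀ x, ‖F x‖ = ‖T x‖) :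
    ∃! σ : H' ≃ₗᵢ[ℂ] K', ∀ x, σ (T x) = F x := by
  refine ⟨(LinearEquiv.refl ℂ H).extendOfIsometry T.toLinearMap F.toLinearMap hT hF h,
    fun x => ?_, fun σ hσ => ?_⟩
  · exact LinearEquiv.extendOfIsometry_eq (.refl ℂ H) _ _ hT hF h x
  · ext x
    refine hT.induction_on x (isClosed_eq σ.continuous (LinearIsometryEquiv.continuous _))
      fun x => ?_
    rw [hσ]
    exact (LinearEquiv.extendOfIsometry_eq (.refl ℂ H) _ _ hT hF h x).symm

variable [CompleteSpace K]

/-- A Douglas-type factorization: a bounded sesquilinear form `⟪F p, k⟫` dominated by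
`‖S p‖ ‖T k‖` is given by a contraction between the closures of the ranges of `T` and `S`. -/
lemma exists_contraction_of_inner_le {S : H →L[ℂ] H'} (hS : DenseRange S) {T : K →L[ℂ] K'}
    (hT : DenseRange T) (F : H →L[ℂ] K)
    (h : ∀ p k, ‖inner ℂ (F p) k‖ ≤ ‖S p‖ * ‖T k‖) :
    ∃ γ : K' →L[ℂ] H', ‖γ‖ ≤ 1 ∧ ∀ p k, inner ℂ (S p) (γ (T k)) = inner ℂ (F p) k := by
  have hF : ∀ p, ‖F p‖ ≤ ‖T‖ * ‖S p‖ := by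
    intro p
    rcases eq_or_ne (F p) 0 with h0 | h0
    · rw [h0, norm_zero]
      positivity
    · have h1 := h p (F p)
      rw [norm_inner_self_eq] at h1
      have h2 : ‖S p‖ * ‖T (F p)‖ ≤ ‖S p‖ * (‖T‖ * ‖F p‖) :=
        mul_le_mul_of_nonneg_left (T.le_opNorm _) (norm_nonneg _)
      have h3 : 0 < ‖F p‖ := norm_pos_iff.2 h0
      nlinarith
  let G : H' →L[ℂ] K := F.toLinearMap.extendOfNorm S.toLinearMap
  have hG : ∀ p, G (S p) = F p := LinearMap.extendOfNorm_eq hS ⟨‖T‖, hF⟩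
  have hGn : ∀ k, ‖(G†) k‖ ≤ 1 * ‖T k‖ := by
    intro k
    rw [one_mul]
    have h1 : ∀ s : H', ‖inner ℂ s ((G†) k)‖ ≤ ‖s‖ * ‖T k‖ := by
      intro s
      refine hS.induction_on s (isClosed_le (continuous_id.inner continuous_const).norm
        (continuous_norm.mul continuous_const)) fun p => ?_
      rw [ContinuousLinearMap.adjoint_inner_right, hG]
      exact h p k
    rcases eq_or_ne ((G†) k) 0 with h0 | h0
    · rw [h0, norm_zero]
      positivity
    · have h2 := h1 ((G†) k)
      rw [norm_inner_self_eq] at h2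
      exact le_of_mul_le_mul_left h2 (norm_pos_iff.2 h0)
  refine ⟨(G†).toLinearMap.extendOfNorm T.toLinearMap,
    LinearMap.opNorm_extendOfNorm_le hT zero_le_one hGn, fun p k => ?_⟩
  rw [show (G†).toLinearMap.extendOfNorm T.toLinearMap (T k) = (G†) k from
    LinearMap.extendOfNorm_eq hT ⟨1, hGn⟩ k, ContinuousLinearMap.adjoint_inner_right, hG]

end Extension

/-! ### Row operators and powers of direct sums -/

section Rows

variable {d : ℕ} {H K : Type*} [NormedAddCommGroup H] [InnerProductSpace ℂ H]
  [NormedAddCommGroup K] [InnerProductSpace ℂ K]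

lemma rowOp_apply (S : Fin d → H →L[ℂ] K) (x : HilbPow d H) : rowOp S x = ∑ i, S i (x i) := by
  simp [rowOp]

/-- The projection `(H ⊕ K)^d → H^d` as an operator. -/
def powFstL (d : ℕ) (H K : Type*) [NormedAddCommGroup H] [InnerProductSpace ℂ H]
    [NormedAddCommGroup K] [InnerProductSpace ℂ K] : HilbPow d (HilbSum H K) →L[ℂ] HilbPow d H :=
  (PiLp.continuousLinearEquiv 2 ℂ (fun _ : Fin d => H)).symm.toContinuousLinearMap ∘L
    ContinuousLinearMap.pi fun i =>
      HilbSum.fstL H K ∘L PiLp.proj 2 (fun _ : Fin d => HilbSum H K) i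

/-- The projection `(H ⊕ K)^d → K^d` as an operator. -/
def powSndL (d : ℕ) (H K : Type*) [NormedAddCommGroup H] [InnerProductSpace ℂ H]
    [NormedAddCommGroup K] [InnerProductSpace ℂ K] : HilbPow d (HilbSum H K) →L[ℂ] HilbPow d K :=
  (PiLp.continuousLinearEquiv 2 ℂ (fun _ : Fin d => K)).symm.toContinuousLinearMap ∘L
    ContinuousLinearMap.pi fun i =>
      HilbSum.sndL H K ∘L PiLp.proj 2 (fun _ : Fin d => HilbSum H K) i

@[simp] lemma powFstL_apply (x : HilbPow d (HilbSum H K)) : powFstL d H K x = powFst x := rfl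

@[simp] lemma powSndL_apply (x : HilbPow d (HilbSum H K)) : powSndL d H K x = powSnd x := rfl

@[simp] lemma powFst_apply (x : HilbPow d (HilbSum H K)) (i : Fin d) :
    powFst x i = (x i).fst := rfl

@[simp] lemma powSnd_apply (x : HilbPow d (HilbSum H K)) (i : Fin d) :
    powSnd x i = (x i).snd := rfl

/-- The vector of `(H ⊕ K)^d` with components `p ∈ H^d` and `q ∈ K^d`. -/
def powMk (p : HilbPow d H) (q : HilbPow d K) : HilbPow d (HilbSum H K) :=
  WithLp.toLp 2 fun i => HilbSum.mk (p i) (q i)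

@[simp] lemma powFst_powMk (p : HilbPow d H) (q : HilbPow d K) : powFst (powMk p q) = p := rfl

@[simp] lemma powSnd_powMk (p : HilbPow d H) (q : HilbPow d K) : powSnd (powMk p q) = q := rfl

lemma HilbPow.norm_sq {H : Type*} [NormedAddCommGroup H] (x : HilbPow d H) :
    ‖x‖ ^ 2 = ∑ i, ‖x i‖ ^ 2 :=
  PiLp.norm_sq_eq_of_L2 _ x

lemma norm_sq_eq_powFst_add_powSnd (x : HilbPow d (HilbSum H K)) :
    ‖x‖ ^ 2 = ‖powFst x‖ ^ 2 + ‖powSnd x‖ ^ 2 := by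
  simp [HilbPow.norm_sq, HilbSum.norm_sq, Finset.sum_add_distrib]

lemma inner_eq_powFst_add_powSnd (x y : HilbPow d (HilbSum H K)) :
    inner ℂ x y = inner ℂ (powFst x) (powFst y) + inner ℂ (powSnd x) (powSnd y) := by
  simp [PiLp.inner_apply, HilbSum.inner_def, Finset.sum_add_distrib]

@[simp] lemma fst_rowOp_liftRow (C : Fin d → H →L[ℂ] H) (B : Fin d → H →L[ℂ] K)
    (A : Fin d → K →L[ℂ] K) (x : HilbPow d (HilbSum H K)) :
    (rowOp (liftRow C B A) x).fst = rowOp C (powFst x) := by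
  rw [rowOp_apply, rowOp_apply, ← HilbSum.fstL_apply, map_sum]
  simp [liftRow]

@[simp] lemma snd_rowOp_liftRow (C : Fin d → H →L[ℂ] H) (B : Fin d → H →L[ℂ] K)
    (A : Fin d → K →L[ℂ] K) (x : HilbPow d (HilbSum H K)) :
    (rowOp (liftRow C B A) x).snd = rowOp B (powFst x) + rowOp A (powSnd x) := by
  rw [rowOp_apply, rowOp_apply, rowOp_apply, ← HilbSum.sndL_apply, map_sum]
  simp [liftRow, Finset.sum_add_distrib]

lemma norm_rowOp_right_of_liftRow {C : Fin d → H →L[ℂ] H} {B : Fin d → H →L[ℂ] K}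
    {A : Fin d → K →L[ℂ] K} (hE : ‖rowOp (liftRow C B A)‖ ≤ 1) : ‖rowOp A‖ ≤ 1 := by
  refine ContinuousLinearMap.opNorm_le_bound _ zero_le_one fun q => ?_
  have h := norm_apply_le_of_norm_le_one hE (powMk 0 q)
  rw [← sq_le_sq₀ (norm_nonneg _) (norm_nonneg _), HilbSum.norm_sq,
    norm_sq_eq_powFst_add_powSnd] at h
  rw [one_mul, ← sq_le_sq₀ (norm_nonneg _) (norm_nonneg _)]
  simpa using h

variable [CompleteSpace H] [CompleteSpace K]

lemma adjoint_rowOp_apply (S : Fin d → H →L[ℂ] K) (y : K) (i : Fin d) :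
    ((rowOp S)†) y i = ((S i)†) y := by
  have h : ((rowOp S)†) y = WithLp.toLp 2 fun i => ((S i)†) y := by
    refine ext_inner_left ℂ fun x => ?_
    rw [ContinuousLinearMap.adjoint_inner_right, rowOp_apply, PiLp.inner_apply, sum_inner]
    simp [ContinuousLinearMap.adjoint_inner_right]
  rw [h]

lemma isRowContraction_iff (S : Fin d → H →L[ℂ] H) : IsRowContraction S ↔ ‖rowOp S‖ ≤ 1 := by
  have h : ∑ i, S i ∘L (S i)† = ((rowOp S)†)† ∘L (rowOp S)† := by
    ext y
    simp [rowOp_apply, adjoint_rowOp_apply]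
  rw [IsRowContraction, h]
  refine ⟨fun hS => ?_, fun hS => sub_nonneg.1
    (one_sub_adjoint_comp_nonneg (norm_adjoint_le_one hS))⟩
  rw [← LinearIsometryEquiv.norm_map ContinuousLinearMap.adjoint]
  refine ContinuousLinearMap.opNorm_le_bound _ zero_le_one fun y => ?_
  have h1 := ((ContinuousLinearMap.nonneg_iff_isPositive _).1
    (sub_nonneg.2 hS)).re_inner_nonneg_left y
  have h2 : inner ℂ ((1 - ((rowOp S)†)† ∘L (rowOp S)†) y) y
      = ((‖y‖ ^ 2 - ‖((rowOp S)†) y‖ ^ 2 : ℝ) : ℂ) := by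
    rw [sub_apply, inner_sub_left]
    simp only [ContinuousLinearMap.comp_apply, ContinuousLinearMap.adjoint_inner_left,
      one_apply_eq_self, inner_self_eq_norm_sq_to_K]
    simp
  rw [h2, RCLike.re_eq_complex_re, Complex.ofReal_re, sub_nonneg,
    sq_le_sq₀ (norm_nonneg _) (norm_nonneg _)] at h1
  rwa [one_mul]

end Rows

/-! ### The contraction of a contractive lifting -/

section LiftingContraction

variable {d : ℕ} {H K : Type*} [NormedAddCommGroup H] [InnerProductSpace ℂ H] [CompleteSpace H]
  [NormedAddCommGroup K] [InnerProductSpace ℂ K] [CompleteSpace K]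
  {C : Fin d → H →L[ℂ] H} {B : Fin d → H →L[ℂ] K} {A : Fin d → K →L[ℂ] K}

/-- The block operator `[[C, 0], [B, A]]` is tested on `(p, A* k)`, which almost maximizes
the norm of the second component among all `(p, q)`. -/
lemma two_mul_re_inner_offDiag_le (hC : ‖rowOp C‖ ≤ 1) (hE : ‖rowOp (liftRow C B A)‖ ≤ 1)
    (p : HilbPow d H) (k : K) :
    2 * (inner ℂ (rowOp B p) k).re
      ≤ ‖defect (rowOp C) p‖ ^ 2 + ‖defect ((rowOp A)†) k‖ ^ 2 := by
  have hA := norm_rowOp_right_of_liftRow hE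
  have h := norm_apply_le_of_norm_le_one hE (powMk p (((rowOp A)†) k))
  rw [← sq_le_sq₀ (norm_nonneg _) (norm_nonneg _), HilbSum.norm_sq,
    norm_sq_eq_powFst_add_powSnd] at h
  simp only [fst_rowOp_liftRow, snd_rowOp_liftRow, powFst_powMk, powSnd_powMk] at h
  have h1 := @norm_sub_sq ℂ _ _ _ _ (rowOp B p + rowOp A (((rowOp A)†) k)) k
  rw [inner_add_left, ← ContinuousLinearMap.adjoint_inner_right (rowOp A),
    inner_self_eq_norm_sq_to_K, map_add] at h1
  have h2 : RCLike.re ((‖((rowOp A)†) k‖ : ℂ) ^ 2) = ‖((rowOp A)†) k‖ ^ 2 := by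
    rw [← Complex.ofReal_pow]
    exact Complex.ofReal_re _
  rw [norm_defect_sq hC, norm_defect_sq (norm_adjoint_le_one hA)]
  have h3 := sq_nonneg ‖rowOp B p + rowOp A (((rowOp A)†) k) - k‖
  simp only [RCLike.re_eq_complex_re, Complex.coe_algebraMap] at h1 h2
  rw [h2] at h1
  linarith

lemma norm_inner_offDiag_le (hC : ‖rowOp C‖ ≤ 1) (hE : ‖rowOp (liftRow C B A)‖ ≤ 1)
    (p : HilbPow d H) (k : K) :
    ‖inner ℂ (rowOp B p) k‖ ≤ ‖toDefect (rowOp C) p‖ * ‖toDefect ((rowOp A)†) k‖ := by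
  set z : ℂ := inner ℂ (rowOp B p) k with hz
  change ‖z‖ ≤ ‖defect (rowOp C) p‖ * ‖defect ((rowOp A)†) k‖
  rcases eq_or_ne z 0 with h0 | h0
  · rw [h0, norm_zero]
    positivity
  -- replace `p` by `s (z / |z|) p` with `s` real, and take the discriminant in `s`
  have hq : ∀ s : ℝ, 0 ≤ ‖defect (rowOp C) p‖ ^ 2 * (s * s) + (-(2 * ‖z‖)) * s
      + ‖defect ((rowOp A)†) k‖ ^ 2 := by
    intro s
    have h := two_mul_re_inner_offDiag_le hC hE ((s * (z / ‖z‖) : ℂ) • p) k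
    have hn : ‖(s * (z / ‖z‖) : ℂ)‖ ^ 2 = s * s := by
      rw [norm_mul, norm_div, Complex.norm_real, Complex.norm_real, norm_norm,
        div_self (norm_ne_zero_iff.2 h0), mul_one, Real.norm_eq_abs, sq_abs, sq]
    have hr : inner ℂ (rowOp B ((s * (z / ‖z‖) : ℂ) • p)) k = ((s * ‖z‖ : ℝ) : ℂ) := by
      rw [map_smul, inner_smul_left, ← hz]
      have h1 : (‖z‖ : ℂ) ≠ 0 := by simpa using h0
      have h2 : (starRingEnd ℂ) z * z = (‖z‖ : ℂ) ^ 2 := Complex.conj_mul' z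
      simp only [map_mul, map_div₀, Complex.conj_ofReal, Complex.ofReal_mul]
      field_simp
      linear_combination (s : ℂ) * h2
    rw [hr, map_smul, norm_smul, mul_pow, hn, Complex.ofReal_re] at h
    linarith
  have h := discrim_le_zero hq
  rw [discrim] at h
  refine abs_le_of_sq_le_sq' ?_ (by positivity) |>.2
  linarith

lemma IsLiftingContraction.inner_eq {γ : rowCodefect A →L[ℂ] rowDefect C}
    (hγ : IsLiftingContraction C B A γ) (p : HilbPow d H) (k : K) :
    inner ℂ (toDefect (rowOp C) p) (γ (toDefect ((rowOp A)†) k)) = inner ℂ (rowOp B p) k := by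
  rw [← ContinuousLinearMap.adjoint_inner_right (rowOp B), hγ.2, Submodule.coe_inner, coe_toDefect,
    inner_defect_left]
  rfl

/-- The relation `B = D_{*,A} γ* D_C`, adjoint to the one defining `γ`. -/
lemma IsLiftingContraction.rowOp_eq {γ : rowCodefect A →L[ℂ] rowDefect C}
    (hγ : IsLiftingContraction C B A γ) (p : HilbPow d H) :
    rowOp B p = defect ((rowOp A)†) ((γ†) (toDefect (rowOp C) p)) := by
  refine ext_inner_right ℂ fun k => ?_
  rw [← hγ.inner_eq, inner_defect_left, ← ContinuousLinearMap.adjoint_inner_left,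
    Submodule.coe_inner, coe_toDefect]

lemma IsLiftingContraction.adjoint_rowOp_eq {γ : rowCodefect A →L[ℂ] rowDefect C}
    (hγ : IsLiftingContraction C B A γ) (k : K) :
    ((rowOp B)†) k = defect (rowOp C) (γ (toDefect ((rowOp A)†) k)) :=
  DFunLike.congr_fun hγ.2 k

theorem existsUnique_isLiftingContraction (hC : ‖rowOp C‖ ≤ 1)
    (hE : ‖rowOp (liftRow C B A)‖ ≤ 1) : ∃! γ, IsLiftingContraction C B A γ := by
  obtain ⟨γ, hγ, h⟩ := exists_contraction_of_inner_le (denseRange_toDefect (rowOp C))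
    (denseRange_toDefect ((rowOp A)†)) (rowOp B) (norm_inner_offDiag_le hC hE)
  refine ⟨γ, ⟨hγ, ?_⟩, fun γ' hγ' => ?_⟩
  · refine ContinuousLinearMap.ext fun k => ext_inner_left ℂ fun p => ?_
    rw [ContinuousLinearMap.adjoint_inner_right, ← h, Submodule.coe_inner, coe_toDefect,
      inner_defect_left]
    rfl
  · refine ContinuousLinearMap.ext_of_denseRange (denseRange_toDefect ((rowOp A)†)) fun k => ?_
    refine (denseRange_toDefect (rowOp C)).eq_of_inner_right ℂ fun p => ?_
    rw [h, hγ'.inner_eq]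

end LiftingContraction

/-! ### The unitaries of a contractive lifting -/

section Sigma

variable {d : ℕ} {H K : Type*} [NormedAddCommGroup H] [InnerProductSpace ℂ H] [CompleteSpace H]
  [NormedAddCommGroup K] [InnerProductSpace ℂ K] [CompleteSpace K]

/-- The restriction `𝓓_T → 𝓓_{*,T}` of a contraction `T`. -/
def defectRestrict (T : H →L[ℂ] K) (hT : ‖T‖ ≤ 1) : defectSpace T →L[ℂ] defectSpace (T†) :=
  (T ∘L (defectSpace T).subtypeL).codRestrict _ fun x => apply_mem_defectSpace hT x

/-- The restriction `𝓓_{*,T} → 𝓓_T` of the adjoint of a contraction `T`. -/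
def codefectRestrict (T : H →L[ℂ] K) (hT : ‖T‖ ≤ 1) : defectSpace (T†) →L[ℂ] defectSpace T :=
  (T† ∘L (defectSpace (T†)).subtypeL).codRestrict _ fun x => adjoint_apply_mem_defectSpace hT x

variable {C : Fin d → H →L[ℂ] H} {B : Fin d → H →L[ℂ] K} {A : Fin d → K →L[ℂ] K}

/-- The operator `[[D_{*,γ} D_C, 0], [-A* γ* D_C, D_A]]` on `H^d ⊕ K^d`. -/
def sigmaOp (C : Fin d → H →L[ℂ] H) (A : Fin d → K →L[ℂ] K) (hA : ‖rowOp A‖ ≤ 1)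
    (γ : rowCodefect A →L[ℂ] rowDefect C) :
    HilbPow d (HilbSum H K) →L[ℂ] HilbSum (defectSpace (γ†)) (rowDefect A) :=
  colBlock (toDefect (γ†) ∘L toDefect (rowOp C) ∘L powFstL d H K)
    (toDefect (rowOp A) ∘L powSndL d H K
      - codefectRestrict (rowOp A) hA ∘L γ† ∘L toDefect (rowOp C) ∘L powFstL d H K)

/-- The operator `[[D_{*,C}, -C γ D_{*,A}], [0, D_γ D_{*,A}]]` on `H ⊕ K`. -/
def sigmaOp' (C : Fin d → H →L[ℂ] H) (A : Fin d → K →L[ℂ] K) (hC : ‖rowOp C‖ ≤ 1)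
    (γ : rowCodefect A →L[ℂ] rowDefect C) :
    HilbSum H K →L[ℂ] HilbSum (rowCodefect C) (defectSpace γ) :=
  blockOp (toDefect ((rowOp C)†))
    (-(defectRestrict (rowOp C) hC ∘L γ ∘L toDefect ((rowOp A)†)))
    0 (toDefect γ ∘L toDefect ((rowOp A)†))

lemma fst_sigmaOp (hA : ‖rowOp A‖ ≤ 1) (γ : rowCodefect A →L[ℂ] rowDefect C)
    (x : HilbPow d (HilbSum H K)) :
    (sigmaOp C A hA γ x).fst = toDefect (γ†) (toDefect (rowOp C) (powFst x)) := rfl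

lemma coe_fst_sigmaOp (hA : ‖rowOp A‖ ≤ 1) (γ : rowCodefect A →L[ℂ] rowDefect C)
    (x : HilbPow d (HilbSum H K)) : ((sigmaOp C A hA γ x).fst : rowDefect C)
      = defect (γ†) (toDefect (rowOp C) (powFst x)) := rfl

lemma coe_snd_sigmaOp (hA : ‖rowOp A‖ ≤ 1) (γ : rowCodefect A →L[ℂ] rowDefect C)
    (x : HilbPow d (HilbSum H K)) : ((sigmaOp C A hA γ x).snd : HilbPow d K)
      = defect (rowOp A) (powSnd x)
        - ((rowOp A)†) ((γ†) (toDefect (rowOp C) (powFst x)) : rowCodefect A) := rfl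

lemma coe_fst_sigmaOp' (hC : ‖rowOp C‖ ≤ 1) (γ : rowCodefect A →L[ℂ] rowDefect C)
    (x : HilbSum H K) : ((sigmaOp' C A hC γ x).fst : H)
      = defect ((rowOp C)†) x.fst
        - rowOp C (γ (toDefect ((rowOp A)†) x.snd) : rowDefect C) :=
  (sub_eq_add_neg _ _).symm

lemma coe_snd_sigmaOp' (hC : ‖rowOp C‖ ≤ 1) (γ : rowCodefect A →L[ℂ] rowDefect C)
    (x : HilbSum H K) : ((sigmaOp' C A hC γ x).snd : rowCodefect A)
      = defect γ (toDefect ((rowOp A)†) x.snd) :=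
  zero_add _

lemma isSigma_iff (hA : ‖rowOp A‖ ≤ 1) {E : Fin d → HilbSum H K →L[ℂ] HilbSum H K}
    {γ : rowCodefect A →L[ℂ] rowDefect C}
    {σ : rowDefect E ≃ₗᵢ[ℂ] HilbSum (defectSpace (γ†)) (rowDefect A)} :
    IsSigma C A E γ σ ↔ ∀ x, σ (toDefect (rowOp E) x) = sigmaOp C A hA γ x := by
  rw [IsSigma]
  refine forall_congr' fun x => ?_
  have h₁ := coe_fst_sigmaOp hA γ x
  have h₂ := (coe_snd_sigmaOp hA γ x).trans (neg_add_eq_sub _ _).symm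
  constructor
  · intro h
    exact HilbSum.ext (Subtype.ext (h.1.trans h₁.symm)) (Subtype.ext (h.2.trans h₂.symm))
  · intro h
    rw [h]
    exact ⟨h₁, h₂⟩

lemma isSigma'_iff (hC : ‖rowOp C‖ ≤ 1) {E : Fin d → HilbSum H K →L[ℂ] HilbSum H K}
    {γ : rowCodefect A →L[ℂ] rowDefect C}
    {σ' : rowCodefect E ≃ₗᵢ[ℂ] HilbSum (rowCodefect C) (defectSpace γ)} :
    IsSigma' C A E γ σ' ↔ ∀ x, σ' (toDefect ((rowOp E)†) x) = sigmaOp' C A hC γ x := by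
  rw [IsSigma']
  refine forall_congr' fun x => ?_
  have h₁ := coe_fst_sigmaOp' hC γ x
  have h₂ := coe_snd_sigmaOp' hC γ x
  constructor
  · intro h
    exact HilbSum.ext (Subtype.ext (h.1.trans h₁.symm)) (Subtype.ext (h.2.trans h₂.symm))
  · intro h
    rw [h]
    exact ⟨h₁, h₂⟩

lemma norm_sigmaOp (hC : ‖rowOp C‖ ≤ 1) (hE : ‖rowOp (liftRow C B A)‖ ≤ 1)
    (hA : ‖rowOp A‖ ≤ 1) {γ : rowCodefect A →L[ℂ] rowDefect C}
    (hγ : IsLiftingContraction C B A γ) (x : HilbPow d (HilbSum H K)) :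
    ‖sigmaOp C A hA γ x‖ = ‖toDefect (rowOp (liftRow C B A)) x‖ := by
  set c := toDefect (rowOp C) (powFst x) with hc
  have h1 : _ + ‖(sigmaOp C A hA γ x).snd‖ ^ 2 = ‖(γ†) c‖ ^ 2 + _ :=
    julia_norm_sq hA ((γ†) c : K) (powSnd x)
  have h2 := norm_toDefect_sq (norm_adjoint_le_one hγ.1) c
  rw [hc, ← fst_sigmaOp hA γ x, ← hc] at h2
  have h3 := norm_toDefect_sq hC (powFst x)
  rw [← hc] at h3
  have h4 := norm_toDefect_sq hE x
  rw [HilbSum.norm_sq (rowOp _ x), norm_sq_eq_powFst_add_powSnd x, fst_rowOp_liftRow,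
    snd_rowOp_liftRow, hγ.rowOp_eq] at h4
  refine (sq_eq_sq₀ (norm_nonneg _) (norm_nonneg _)).1 ?_
  refine (HilbSum.norm_sq _).trans (Eq.trans ?_ h4.symm)
  linarith

lemma fst_adjoint_rowOp_liftRow (x : HilbSum H K) :
    powFst (((rowOp (liftRow C B A))†) x) = ((rowOp C)†) x.fst + ((rowOp B)†) x.snd := by
  refine ext_inner_left ℂ fun p => ?_
  have h := ContinuousLinearMap.adjoint_inner_right (rowOp (liftRow C B A)) (powMk p 0) x
  rw [inner_eq_powFst_add_powSnd, HilbSum.inner_def] at h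
  simpa [inner_add_right, ContinuousLinearMap.adjoint_inner_right] using h

lemma snd_adjoint_rowOp_liftRow (x : HilbSum H K) :
    powSnd (((rowOp (liftRow C B A))†) x) = ((rowOp A)†) x.snd := by
  refine ext_inner_left ℂ fun q => ?_
  have h := ContinuousLinearMap.adjoint_inner_right (rowOp (liftRow C B A)) (powMk 0 q) x
  rw [inner_eq_powFst_add_powSnd, HilbSum.inner_def] at h
  simpa [inner_add_right, ContinuousLinearMap.adjoint_inner_right] using h

lemma norm_sigmaOp' (hC : ‖rowOp C‖ ≤ 1) (hE : ‖rowOp (liftRow C B A)‖ ≤ 1)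
    {γ : rowCodefect A →L[ℂ] rowDefect C}
    (hγ : IsLiftingContraction C B A γ) (x : HilbSum H K) :
    ‖sigmaOp' C A hC γ x‖ = ‖toDefect ((rowOp (liftRow C B A))†) x‖ := by
  have hA := norm_rowOp_right_of_liftRow hE
  set c := toDefect ((rowOp A)†) x.snd with hc
  have h1 := julia_norm_sq' hC x.fst (γ c : HilbPow d H)
  rw [← coe_fst_sigmaOp' hC γ x, Submodule.norm_coe, Submodule.norm_coe,
    add_comm (defect _ _)] at h1
  have h2 := norm_defect_sq hγ.1 c
  rw [hc, ← coe_snd_sigmaOp' hC γ x, Submodule.norm_coe, ← hc] at h2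
  have h3 := norm_toDefect_sq (norm_adjoint_le_one hA) x.snd
  rw [← hc] at h3
  have h4 := norm_toDefect_sq (norm_adjoint_le_one hE) x
  rw [HilbSum.norm_sq x, norm_sq_eq_powFst_add_powSnd, fst_adjoint_rowOp_liftRow,
    snd_adjoint_rowOp_liftRow, hγ.adjoint_rowOp_eq] at h4
  refine (sq_eq_sq₀ (norm_nonneg _) (norm_nonneg _)).1 ?_
  refine (HilbSum.norm_sq _).trans (Eq.trans ?_ h4.symm)
  linarith

/-- Triangular operator matrices with dense ranges on the diagonal have dense range: here the
zero is in the upper right corner. -/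
lemma denseRange_sigmaOp (hA : ‖rowOp A‖ ≤ 1) (γ : rowCodefect A →L[ℂ] rowDefect C) :
    DenseRange (sigmaOp C A hA γ) := by
  refine denseRange_of_inner_eq_zero fun y hy => ?_
  have h2 : y.snd = 0 := by
    refine (denseRange_toDefect (rowOp A)).eq_zero_of_inner_right ℂ fun q => ?_
    have h := hy (powMk 0 q)
    rw [HilbSum.inner_def] at h
    simpa [sigmaOp] using h
  have h1 : y.fst = 0 := by
    refine ((denseRange_toDefect (γ†)).comp (denseRange_toDefect (rowOp C))
      (toDefect (γ†)).continuous).eq_zero_of_inner_right ℂ fun p => ?_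
    have h := hy (powMk p 0)
    rw [HilbSum.inner_def] at h
    simpa [sigmaOp, h2] using h
  exact HilbSum.ext h1 h2

lemma denseRange_sigmaOp' (hC : ‖rowOp C‖ ≤ 1) (γ : rowCodefect A →L[ℂ] rowDefect C) :
    DenseRange (sigmaOp' C A hC γ) := by
  refine denseRange_of_inner_eq_zero fun y hy => ?_
  have h1 : y.fst = 0 := by
    refine (denseRange_toDefect ((rowOp C)†)).eq_zero_of_inner_right ℂ fun h => ?_
    have h := hy (HilbSum.mk h 0)
    rw [HilbSum.inner_def] at h
    simpa [sigmaOp'] using h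
  have h2 : y.snd = 0 := by
    refine ((denseRange_toDefect γ).comp (denseRange_toDefect ((rowOp A)†))
      (toDefect γ).continuous).eq_zero_of_inner_right ℂ fun k => ?_
    have h := hy (HilbSum.mk 0 k)
    rw [HilbSum.inner_def] at h
    simpa [sigmaOp', h1] using h
  exact HilbSum.ext h1 h2

theorem existsUnique_isSigma (hC : ‖rowOp C‖ ≤ 1) (hE : ‖rowOp (liftRow C B A)‖ ≤ 1)
    {γ : rowCodefect A →L[ℂ] rowDefect C} (hγ : IsLiftingContraction C B A γ) :
    ∃! σ, IsSigma C A (liftRow C B A) γ σ := by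
  have hA := norm_rowOp_right_of_liftRow hE
  obtain ⟨σ, hσ, hu⟩ := existsUnique_unitary (denseRange_toDefect (rowOp (liftRow C B A)))
    (denseRange_sigmaOp hA γ) (norm_sigmaOp hC hE hA hγ)
  exact ⟨σ, (isSigma_iff hA).2 hσ, fun τ hτ => hu τ ((isSigma_iff hA).1 hτ)⟩

theorem existsUnique_isSigma' (hC : ‖rowOp C‖ ≤ 1) (hE : ‖rowOp (liftRow C B A)‖ ≤ 1)
    {γ : rowCodefect A →L[ℂ] rowDefect C} (hγ : IsLiftingContraction C B A γ) :
    ∃! σ', IsSigma' C A (liftRow C B A) γ σ' := by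
  obtain ⟨σ, hσ, hu⟩ := existsUnique_unitary (denseRange_toDefect ((rowOp (liftRow C B A))†))
    (denseRange_sigmaOp' hC γ) (norm_sigmaOp' hC hE hγ)
  exact ⟨σ, (isSigma'_iff hC).2 hσ, fun τ hτ => hu τ ((isSigma'_iff hC).1 hτ)⟩

end Sigma

/-! ### Coefficients of vectors of `Γ ⊗ H` -/

namespace Fock

variable {d : ℕ} {H K X Y X' Y' : Type*}
  [NormedAddCommGroup H] [InnerProductSpace ℂ H] [NormedAddCommGroup K] [InnerProductSpace ℂ K]
  [NormedAddCommGroup X] [InnerProductSpace ℂ X] [NormedAddCommGroup Y] [InnerProductSpace ℂ Y]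
  [NormedAddCommGroup X'] [InnerProductSpace ℂ X'] [NormedAddCommGroup Y'] [InnerProductSpace ℂ Y']

/-- The coefficient in `H` of a vector of `Γ ⊗ H` at the basis vector `e_α`. -/
def coeff (α : List (Fin d)) : Fock d H →L[ℂ] H :=
  lp.evalCLM ℂ (fun _ : List (Fin d) => H) 2 α

/-- The vector `e_α ⊗ h`. -/
def single (α : List (Fin d)) : H →L[ℂ] Fock d H :=
  lp.singleContinuousLinearMap ℂ (fun _ : List (Fin d) => H) 2 α

@[ext] lemma ext {x y : Fock d H} (h : ∀ α, coeff α x = coeff α y) : x = y :=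
  lp.ext (funext h)

lemma hasSum_norm_sq (x : Fock d H) : HasSum (fun α => ‖coeff α x‖ ^ 2) (‖x‖ ^ 2) := by
  have h := lp.hasSum_norm (p := 2) (by norm_num) (E := fun _ : List (Fin d) => H) x
  simpa using! h

lemma sum_norm_sq_le (x : Fock d H) (s : Finset (List (Fin d))) :
    ∑ α ∈ s, ‖coeff α x‖ ^ 2 ≤ ‖x‖ ^ 2 :=
  sum_le_hasSum s (fun _ _ => sq_nonneg _) (hasSum_norm_sq x)

/-- A family of vectors with bounded partial sums of squared norms, as a vector of `Γ ⊗ H`. -/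
def ofFamily (g : List (Fin d) → H) (c : ℝ) (h : ∀ s : Finset (List (Fin d)),
    ∑ α ∈ s, ‖g α‖ ^ 2 ≤ c ^ 2) : Fock d H :=
  (⟨g, memℓp_gen' (C := c ^ 2) fun s => by simpa using h s⟩ : lp (fun _ : List (Fin d) => H) 2)

lemma norm_le_of_forall_sum_le {x : Fock d H} {c : ℝ} (hc : 0 ≤ c)
    (h : ∀ s : Finset (List (Fin d)), ∑ α ∈ s, ‖coeff α x‖ ^ 2 ≤ c ^ 2) : ‖x‖ ≤ c := by
  rw [← sq_le_sq₀ (norm_nonneg _) hc]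
  exact hasSum_le_of_sum_le (hasSum_norm_sq x) h

@[simp] lemma coeff_amp (T : H →L[ℂ] K) (x : Fock d H) (α : List (Fin d)) :
    coeff α (amp T x) = T (coeff α x) := rfl

@[simp] lemma coeff_single_self (α : List (Fin d)) (h : H) : coeff α (single α h) = h :=
  lp.single_apply_self (E := fun _ : List (Fin d) => H) 2 α h

lemma coeff_single_of_ne {α β : List (Fin d)} (hβ : β ≠ α) (h : H) :
    coeff β (single α h) = 0 :=
  lp.single_apply_ne (E := fun _ : List (Fin d) => H) 2 α h hβ

lemma hasSum_single (x : Fock d H) : HasSum (fun α => single α (coeff α x)) x :=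
  lp.hasSum_single (E := fun _ : List (Fin d) => H) (p := 2) (by norm_num) x

@[simp] lemma coeff_nil_vacuum (h : H) : coeff (d := d) [] (vacuum h) = h :=
  coeff_single_self [] h

@[simp] lemma coeff_cons_vacuum (i : Fin d) (α : List (Fin d)) (h : H) :
    coeff (i :: α) (vacuum h) = 0 :=
  coeff_single_of_ne (by simp) h

lemma coeff_pushWord {f : List (Fin d) → List (Fin d)} (hf : f.Injective) (x : Fock d H)
    (α : List (Fin d)) : coeff (f α) (pushWord f hf x) = coeff α x :=
  hf.extend_apply _ _ _

lemma coeff_pushWord_of_notMem {f : List (Fin d) → List (Fin d)} (hf : f.Injective)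
    (x : Fock d H) {β : List (Fin d)} (hβ : ∀ α, f α ≠ β) : coeff β (pushWord f hf x) = 0 :=
  Function.extend_apply' _ _ _ (by simpa using hβ)

@[simp] lemma coeff_nil_leftCreation (j : Fin d) (x : Fock d H) :
    coeff [] (leftCreation j x) = 0 :=
  coeff_pushWord_of_notMem _ _ (by simp)

lemma coeff_cons_leftCreation (i j : Fin d) (x : Fock d H) (α : List (Fin d)) :
    coeff (i :: α) (leftCreation j x) = if i = j then coeff α x else 0 := by
  split_ifs with h
  · subst h
    exact coeff_pushWord List.cons_injective x α
  · exact coeff_pushWord_of_notMem _ _ fun β hβ => h (List.cons.inj hβ).1.symm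

lemma leftCreation_single (j : Fin d) (α : List (Fin d)) (h : H) :
    leftCreation j (single α h) = single (j :: α) h := by
  ext β
  cases β with
  | nil => rw [coeff_nil_leftCreation, coeff_single_of_ne (by simp)]
  | cons i β =>
    rw [coeff_cons_leftCreation]
    split_ifs with hi
    · subst hi
      by_cases hβ : β = α
      · subst hβ
        simp
      · rw [coeff_single_of_ne hβ, coeff_single_of_ne (by simpa using hβ)]
    · rw [coeff_single_of_ne (by simp [hi])]

lemma coeff_append_rightCreation (i j : Fin d) (x : Fock d H) (α : List (Fin d)) :
    coeff (α ++ [i]) (rightCreation j x) = if i = j then coeff α x else 0 := by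
  split_ifs with h
  · subst h
    exact coeff_pushWord (List.append_left_injective [i]) x α
  · refine coeff_pushWord_of_notMem _ _ fun β hβ => h ?_
    simpa using (List.append_inj_right' hβ rfl).symm

lemma coeff_nil_rightCreation (j : Fin d) (x : Fock d H) : coeff [] (rightCreation j x) = 0 :=
  coeff_pushWord_of_notMem (List.append_left_injective [j]) x (by simp)

@[simp] lemma coeff_nil_rightRow (x : Fock d (HilbPow d H)) : coeff [] (rightRow x) = 0 := by
  rw [rightRow, sum_apply, map_sum]
  exact Finset.sum_eq_zero fun j _ => coeff_nil_rightCreation j _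

@[simp] lemma coeff_append_rightRow (x : Fock d (HilbPow d H)) (α : List (Fin d)) (i : Fin d) :
    coeff (α ++ [i]) (rightRow x) = coeff α x i := by
  rw [rightRow, sum_apply, map_sum, Finset.sum_eq_single i]
  · exact (coeff_append_rightCreation i i _ α).trans (if_pos rfl)
  · intro j _ hj
    exact (coeff_append_rightCreation i j _ α).trans (if_neg hj.symm)
  · simp

@[simp] lemma coeff_fockDiag (S : Fock d X →L[ℂ] Fock d X') (T : Fock d Y →L[ℂ] Fock d Y')
    (x : Fock d (HilbSum X Y)) (α : List (Fin d)) : coeff α (fockDiag S T x)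
      = HilbSum.mk (coeff α (S (amp (HilbSum.fstL X Y) x)))
        (coeff α (T (amp (HilbSum.sndL X Y) x))) := by
  rw [fockDiag, add_apply, map_add]
  simp only [ContinuousLinearMap.comp_apply, coeff_amp]
  ext <;> simp

/-! ### Summation over words of bounded length -/

/-- The words of length less than `n`. -/
def wordsLT (d : ℕ) : ℕ → Finset (List (Fin d))
  | 0 => ∅
  | n + 1 => insert [] ((wordsLT d n ×ˢ Finset.univ).image fun p => p.1 ++ [p.2])

lemma mem_wordsLT {n : ℕ} {α : List (Fin d)} : α ∈ wordsLT d n ↔ α.length < n := by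
  induction n generalizing α with
  | zero => simp [wordsLT]
  | succ n ih =>
    induction α using List.reverseRecOn with
    | nil => simp [wordsLT]
    | append_singleton α i _ =>
      simp [wordsLT, ih]

lemma subset_wordsLT (s : Finset (List (Fin d))) : ∃ n, s ⊆ wordsLT d n :=
  ⟨s.sup List.length + 1, fun _ hα => mem_wordsLT.2 (Nat.lt_succ_of_le (Finset.le_sup hα))⟩

lemma sum_wordsLT_succ (n : ℕ) (g : List (Fin d) → ℝ) :
    ∑ α ∈ wordsLT d (n + 1), g α = g [] + ∑ α ∈ wordsLT d n, ∑ i, g (α ++ [i]) := by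
  rw [wordsLT, Finset.sum_insert (by simp), Finset.sum_image, Finset.sum_product]
  rintro ⟨α, i⟩ _ ⟨β, j⟩ _ h
  simpa using h

/-- The row `(R_1, …, R_d)` of right creation operators is an isometry. -/
lemma norm_rightRow (x : Fock d (HilbPow d H)) : ‖rightRow x‖ = ‖x‖ := by
  have key : ∀ n, ∑ α ∈ wordsLT d (n + 1), ‖coeff α (rightRow x)‖ ^ 2
      = ∑ α ∈ wordsLT d n, ‖coeff α x‖ ^ 2 := by
    intro n
    rw [sum_wordsLT_succ]
    simp [HilbPow.norm_sq]
  refine le_antisymm (norm_le_of_forall_sum_le (norm_nonneg _) fun s => ?_)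
    (norm_le_of_forall_sum_le (norm_nonneg _) fun s => ?_)
  · obtain ⟨n, hn⟩ := subset_wordsLT s
    have hn' : s ⊆ wordsLT d (n + 1) := fun α hα =>
      mem_wordsLT.2 ((mem_wordsLT.1 (hn hα)).trans n.lt_succ_self)
    exact (Finset.sum_le_sum_of_subset_of_nonneg hn' fun _ _ _ => sq_nonneg _).trans
      ((key n).le.trans (sum_norm_sq_le x _))
  · obtain ⟨n, hn⟩ := subset_wordsLT s
    exact (Finset.sum_le_sum_of_subset_of_nonneg hn fun _ _ _ => sq_nonneg _).trans
      ((key n).ge.trans (sum_norm_sq_le (rightRow x) _))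

lemma norm_amp_le {T : H →L[ℂ] K} (hT : ‖T‖ ≤ 1) (x : Fock d H) : ‖amp T x‖ ≤ ‖x‖ := by
  refine norm_le_of_forall_sum_le (norm_nonneg _) fun s => ?_
  refine (Finset.sum_le_sum fun α _ => ?_).trans (sum_norm_sq_le x s)
  rw [coeff_amp, sq_le_sq₀ (norm_nonneg _) (norm_nonneg _)]
  exact norm_apply_le_of_norm_le_one hT _

lemma norm_amp_eq {T : H →L[ℂ] K} (hT : ∀ h, ‖T h‖ = ‖h‖) (x : Fock d H) :
    ‖amp T x‖ = ‖x‖ := by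
  refine (sq_eq_sq₀ (norm_nonneg _) (norm_nonneg _)).1 ((hasSum_norm_sq _).unique ?_)
  simpa [hT] using hasSum_norm_sq x

end Fock

/-! ### The linear system of a row contraction -/

section System

variable {d : ℕ} {K : Type*} [NormedAddCommGroup K] [InnerProductSpace ℂ K] [CompleteSpace K]

/-- The states of the linear system of a row contraction, indexed by reversed words. -/
def stateRev (A : Fin d → K →L[ℂ] K) (h : K) (x : List (Fin d) → HilbPow d K) :
    List (Fin d) → K
  | [] => h
  | i :: β => (((rowOp A)†) (stateRev A h x β) + defect (rowOp A) (x β.reverse)) i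

/-- The states `f` of the linear system of a row contraction `A` with initial state `h` and input
`x`: `f(∅) = h` and `f(α i) = (A* f(α) + D_A x(α))_i`, for words `α` and letters `i`. -/
def state (A : Fin d → K →L[ℂ] K) (h : K) (x : List (Fin d) → HilbPow d K)
    (α : List (Fin d)) : K :=
  stateRev A h x α.reverse

variable (A : Fin d → K →L[ℂ] K)

@[simp] lemma state_nil (h : K) (x : List (Fin d) → HilbPow d K) : state A h x [] = h := rfl

lemma state_append (h : K) (x : List (Fin d) → HilbPow d K) (α : List (Fin d)) (i : Fin d) :
    state A h x (α ++ [i]) = (((rowOp A)†) (state A h x α) + defect (rowOp A) (x α)) i := by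
  simp [state, stateRev]

variable {A}

lemma eq_state {h : K} {x : List (Fin d) → HilbPow d K} {f : List (Fin d) → K} (h₀ : f [] = h)
    (h₁ : ∀ α i, f (α ++ [i]) = (((rowOp A)†) (f α) + defect (rowOp A) (x α)) i)
    (α : List (Fin d)) : f α = state A h x α := by
  induction α using List.reverseRecOn with
  | nil => exact h₀
  | append_singleton α i ih => rw [h₁, state_append, ih]

lemma state_add (h h' : K) (x x' : List (Fin d) → HilbPow d K) (α : List (Fin d)) :
    state A (h + h') (fun α => x α + x' α) α = state A h x α + state A h' x' α := by
  refine (eq_state (f := fun α => state A h x α + state A h' x' α) rfl (fun α i => ?_) α).symm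
  simp only [state_append, map_add, PiLp.add_apply]
  abel

lemma state_smul (c : ℂ) (h : K) (x : List (Fin d) → HilbPow d K) (α : List (Fin d)) :
    state A (c • h) (fun α => c • x α) α = c • state A h x α := by
  refine (eq_state (f := fun α => c • state A h x α) rfl (fun α i => ?_) α).symm
  simp only [state_append, map_smul, PiLp.add_apply, PiLp.smul_apply, smul_add]

/-- After the letter `i` the system goes on from the state it has reached. -/
lemma state_cons (h : K) (x : List (Fin d) → HilbPow d K) (i : Fin d) (α : List (Fin d)) :
    state A h x (i :: α)
      = state A ((((rowOp A)†) h + defect (rowOp A) (x [])) i) (fun β => x (i :: β)) α := by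
  refine eq_state (f := fun α => state A h x (i :: α)) ?_ (fun α j => ?_) α
  · simpa using state_append A h x [] i
  · simpa using state_append A h x (i :: α) j

lemma sum_norm_state_append_sq (h : K) (x : List (Fin d) → HilbPow d K) (α : List (Fin d)) :
    ∑ i, ‖state A h x (α ++ [i])‖ ^ 2
      = ‖defect (rowOp A) (x α) + ((rowOp A)†) (state A h x α)‖ ^ 2 := by
  simp only [HilbPow.norm_sq, state_append, add_comm (defect _ _)]

/-- The energy balance of the system: the Julia–Halmos operator of `A` preserves norms, so the
outputs have at most the energy of the initial state and of the inputs. -/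
lemma sum_norm_output_sq_le (hA : ‖rowOp A‖ ≤ 1) (h : K) (x : List (Fin d) → HilbPow d K)
    (n : ℕ) :
    ∑ α ∈ Fock.wordsLT d n, ‖defect ((rowOp A)†) (state A h x α) - rowOp A (x α)‖ ^ 2
      ≤ ‖h‖ ^ 2 + ∑ α ∈ Fock.wordsLT d n, ‖x α‖ ^ 2 := by
  have h₁ := Finset.sum_congr (rfl : Fock.wordsLT d n = _) fun α _ =>
    julia_norm_sq' hA (state A h x α) (x α)
  rw [Finset.sum_add_distrib, Finset.sum_add_distrib] at h₁
  have h₂ := Fock.sum_wordsLT_succ n fun α => ‖state A h x α‖ ^ 2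
  simp only [sum_norm_state_append_sq, state_nil] at h₂
  have h₃ : ∑ α ∈ Fock.wordsLT d n, ‖state A h x α‖ ^ 2
      ≤ ∑ α ∈ Fock.wordsLT d (n + 1), ‖state A h x α‖ ^ 2 :=
    Finset.sum_le_sum_of_subset_of_nonneg
      (fun α hα => Fock.mem_wordsLT.2 ((Fock.mem_wordsLT.1 hα).trans n.lt_succ_self))
      fun _ _ _ => sq_nonneg _
  linarith

/-- The output at `α` of the system of `A` with initial state `p.fst` and input `p.snd`. -/
def output (A : Fin d → K →L[ℂ] K) (hA : ‖rowOp A‖ ≤ 1)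
    (p : HilbSum K (Fock d (rowDefect A))) (α : List (Fin d)) : rowCodefect A :=
  toDefect ((rowOp A)†)
      (state A p.fst (fun β => ((Fock.coeff β p.snd : rowDefect A) : HilbPow d K)) α)
    - defectRestrict (rowOp A) hA (Fock.coeff α p.snd)

lemma sum_norm_output_le (hA : ‖rowOp A‖ ≤ 1) (p : HilbSum K (Fock d (rowDefect A)))
    (s : Finset (List (Fin d))) : ∑ α ∈ s, ‖output A hA p α‖ ^ 2 ≤ ‖p‖ ^ 2 := by
  obtain ⟨n, hn⟩ := Fock.subset_wordsLT s
  refine (Finset.sum_le_sum_of_subset_of_nonneg hn fun _ _ _ => sq_nonneg _).trans ?_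
  refine (sum_norm_output_sq_le hA p.fst
    (fun β => ((Fock.coeff β p.snd : rowDefect A) : HilbPow d K)) n).trans ?_
  rw [HilbSum.norm_sq]
  exact add_le_add_right (Fock.sum_norm_sq_le p.snd _) _

lemma output_add (hA : ‖rowOp A‖ ≤ 1) (p q : HilbSum K (Fock d (rowDefect A)))
    (α : List (Fin d)) : output A hA (p + q) α = output A hA p α + output A hA q α := by
  have h := state_add (A := A) p.fst q.fst
    (fun β => ((Fock.coeff β p.snd : rowDefect A) : HilbPow d K))
    (fun β => ((Fock.coeff β q.snd : rowDefect A) : HilbPow d K)) α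
  simp only [output, HilbSum.fst_add, HilbSum.snd_add, map_add, Submodule.coe_add]
  rw [h, map_add, add_sub_add_comm]

lemma output_smul (hA : ‖rowOp A‖ ≤ 1) (c : ℂ) (p : HilbSum K (Fock d (rowDefect A)))
    (α : List (Fin d)) : output A hA (c • p) α = c • output A hA p α := by
  have h := state_smul (A := A) c p.fst
    (fun β => ((Fock.coeff β p.snd : rowDefect A) : HilbPow d K)) α
  simp only [output, HilbSum.fst_smul, HilbSum.snd_smul, map_smul, Submodule.coe_smul]
  rw [h, map_smul, smul_sub]

/-- The linear map underlying `systemOp`. -/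
def systemLin (A : Fin d → K →L[ℂ] K) (hA : ‖rowOp A‖ ≤ 1) :
    HilbSum K (Fock d (rowDefect A)) →ₗ[ℂ] Fock d (rowCodefect A) where
  toFun p := Fock.ofFamily (output A hA p) ‖p‖ (sum_norm_output_le hA p)
  map_add' p q := Fock.ext (output_add hA p q)
  map_smul' c p := Fock.ext (output_smul hA c p)

lemma norm_systemLin_le (hA : ‖rowOp A‖ ≤ 1) (p : HilbSum K (Fock d (rowDefect A))) :
    ‖systemLin A hA p‖ ≤ ‖p‖ :=
  Fock.norm_le_of_forall_sum_le (norm_nonneg _) (sum_norm_output_le hA p)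

/-- The contraction sending an initial state and an input in `Γ ⊗ 𝓓_A` to the output in
`Γ ⊗ 𝓓_{*,A}`. -/
def systemOp (A : Fin d → K →L[ℂ] K) (hA : ‖rowOp A‖ ≤ 1) :
    HilbSum K (Fock d (rowDefect A)) →L[ℂ] Fock d (rowCodefect A) :=
  (systemLin A hA).mkContinuous 1 fun p => (norm_systemLin_le hA p).trans (one_mul _).ge

lemma norm_systemOp_le (hA : ‖rowOp A‖ ≤ 1) (p : HilbSum K (Fock d (rowDefect A))) :
    ‖systemOp A hA p‖ ≤ ‖p‖ :=
  norm_systemLin_le hA p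

/-! ### The characteristic function of a row contraction -/

/-- The characteristic function `M_A`: the transfer operator of the system of `A`. -/
def rowCharFun (A : Fin d → K →L[ℂ] K) (hA : ‖rowOp A‖ ≤ 1) :
    Fock d (rowDefect A) →L[ℂ] Fock d (rowCodefect A) :=
  systemOp A hA ∘L inrOp K (Fock d (rowDefect A))

lemma norm_rowCharFun_le (hA : ‖rowOp A‖ ≤ 1) (x : Fock d (rowDefect A)) :
    ‖rowCharFun A hA x‖ ≤ ‖x‖ := by
  have h := norm_systemOp_le hA (inrOp K (Fock d (rowDefect A)) x)
  rwa [← sq_le_sq₀ (norm_nonneg _) (norm_nonneg _), HilbSum.norm_sq, fst_inrOp, snd_inrOp,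
    norm_zero, zero_pow two_ne_zero, zero_add, sq_le_sq₀ (norm_nonneg _) (norm_nonneg _)] at h

lemma coe_coeff_rowCharFun (hA : ‖rowOp A‖ ≤ 1) (x : Fock d (rowDefect A)) (α : List (Fin d)) :
    ((Fock.coeff α (rowCharFun A hA x) : rowCodefect A) : K)
      = defect ((rowOp A)†) (state A 0 (fun β => ((Fock.coeff β x : rowDefect A) : HilbPow d K)) α)
        - rowOp A (Fock.coeff α x : rowDefect A) := rfl

/-- The resolvent vector in `M_A(rR) x`: the states of the system damped by the factor `r` in
every step. -/
def dampedState (A : Fin d → K →L[ℂ] K) (r : ℝ) (x : Fock d (HilbPow d K)) : Fock d K :=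
  Ring.inverse (1 - (r : ℂ) • (rightRow ∘L amp ((rowOp A)†)))
    ((r : ℂ) • rightRow (amp (defect (rowOp A)) x))

lemma charApprox_apply (r : ℝ) (x : Fock d (HilbPow d K)) :
    charApprox A r x = amp (defect ((rowOp A)†)) (dampedState A r x) - amp (rowOp A) x :=
  neg_add_eq_sub (amp (rowOp A) x) _

lemma dampedState_eq (hA : ‖rowOp A‖ ≤ 1) {r : ℝ} (hr₀ : 0 ≤ r) (hr₁ : r < 1)
    (x : Fock d (HilbPow d K)) :
    dampedState A r x = (r : ℂ) • rightRow
      (amp ((rowOp A)†) (dampedState A r x) + amp (defect (rowOp A)) x) := by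
  set T : Fock d K →L[ℂ] Fock d K := (r : ℂ) • (rightRow ∘L amp ((rowOp A)†)) with hT
  have hT1 : ‖T‖ < 1 := by
    refine lt_of_le_of_lt (ContinuousLinearMap.opNorm_le_bound _ hr₀ fun y => ?_) hr₁
    rw [hT, smul_apply, norm_smul, Complex.norm_real, Real.norm_of_nonneg hr₀,
      ContinuousLinearMap.comp_apply, Fock.norm_rightRow]
    exact mul_le_mul_of_nonneg_left (Fock.norm_amp_le (norm_adjoint_le_one hA) y) hr₀
  have hu : IsUnit (1 - T) := (Units.oneSub T hT1).isUnit
  have h := DFunLike.congr_fun (Ring.mul_inverse_cancel _ hu)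
    ((r : ℂ) • rightRow (amp (defect (rowOp A)) x))
  change dampedState A r x - T (dampedState A r x) = _ at h
  rw [sub_eq_iff_eq_add] at h
  rw [map_add, smul_add, add_comm]
  exact h

/-- `M_A(rR)` is a contraction: damping lets energy disappear in every step of the system. -/
lemma norm_charApprox_le (hA : ‖rowOp A‖ ≤ 1) {r : ℝ} (hr₀ : 0 ≤ r) (hr₁ : r < 1)
    (x : Fock d (HilbPow d K)) : ‖charApprox A r x‖ ≤ ‖x‖ := by
  set f := dampedState A r x with hf
  set g := amp ((rowOp A)†) f + amp (defect (rowOp A)) x with hg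
  have h₁ : ‖f‖ ≤ ‖g‖ := by
    rw [hf, dampedState_eq hA hr₀ hr₁, ← hf, ← hg, norm_smul, Complex.norm_real,
      Real.norm_of_nonneg hr₀, Fock.norm_rightRow]
    exact mul_le_of_le_one_left (norm_nonneg _) hr₁.le
  have h₂ : ‖charApprox A r x‖ ^ 2 + ‖g‖ ^ 2 = ‖f‖ ^ 2 + ‖x‖ ^ 2 := by
    have h : ∀ α, ‖Fock.coeff α (charApprox A r x)‖ ^ 2 + ‖Fock.coeff α g‖ ^ 2
        = ‖Fock.coeff α f‖ ^ 2 + ‖Fock.coeff α x‖ ^ 2 := by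
      intro α
      rw [← julia_norm_sq' hA (Fock.coeff α f), charApprox_apply, ← hf, hg, map_sub, map_add,
        add_comm (Fock.coeff α (amp ((rowOp A)†) f))]
      rfl
    refine ((Fock.hasSum_norm_sq _).add (Fock.hasSum_norm_sq _)).unique ?_
    simp only [h]
    exact (Fock.hasSum_norm_sq f).add (Fock.hasSum_norm_sq x)
  rw [← sq_le_sq₀ (norm_nonneg _) (norm_nonneg _)]
  have h₃ := pow_le_pow_left₀ (norm_nonneg _) h₁ 2
  linarith

/-- On `e_β ⊗ h` the damping amounts to the factor `r ^ (|α| - |β|)` at the word `α`; this form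
avoids the subtraction of lengths. -/
lemma pow_mul_charApprox_single (hA : ‖rowOp A‖ ≤ 1) {r : ℝ} (hr₀ : 0 ≤ r) (hr₁ : r < 1)
    (β : List (Fin d)) (c : rowDefect A) (α : List (Fin d)) :
    (r : ℂ) ^ β.length • Fock.coeff α
        (charApprox A r (amp (rowDefect A).subtypeL (Fock.single β c)))
      = (r : ℂ) ^ α.length •
        ((Fock.coeff α (rowCharFun A hA (Fock.single β c)) : rowCodefect A) : K) := by
  set x := amp (rowDefect A).subtypeL (Fock.single β c) with hx
  set f := dampedState A r x with hf
  have hx' : ∀ α, (r : ℂ) ^ β.length • Fock.coeff α x = (r : ℂ) ^ α.length • Fock.coeff α x := by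
    intro α
    by_cases hα : α = β
    · rw [hα]
    · rw [hx, Fock.coeff_amp, Fock.coeff_single_of_ne hα, map_zero, smul_zero, smul_zero]
  have hstate : ∀ α, (r : ℂ) ^ β.length • Fock.coeff α f
      = (r : ℂ) ^ α.length • state A 0 (fun β => Fock.coeff β x) α := by
    intro α
    induction α using List.reverseRecOn with
    | nil =>
      rw [hf, dampedState_eq hA hr₀ hr₁]
      simp
    | append_singleton α i ih =>
      have h₁ : Fock.coeff (α ++ [i]) f = (r : ℂ) • (((rowOp A)†) (Fock.coeff α f)
          + defect (rowOp A) (Fock.coeff α x)) i := by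
        conv_lhs => rw [hf, dampedState_eq hA hr₀ hr₁, ← hf]
        rw [map_smul, Fock.coeff_append_rightRow]
        rfl
      have h₂ : (r : ℂ) ^ β.length • (((rowOp A)†) (Fock.coeff α f)
          + defect (rowOp A) (Fock.coeff α x)) = (r : ℂ) ^ α.length •
            (((rowOp A)†) (state A 0 (fun β => Fock.coeff β x) α)
              + defect (rowOp A) (Fock.coeff α x)) := by
        rw [smul_add, smul_add, ← map_smul ((rowOp A)†), ← map_smul (defect (rowOp A)), ih, hx',
          map_smul, map_smul]
      rw [h₁, state_append, List.length_append, List.length_singleton, pow_succ', mul_smul,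
        smul_comm, ← PiLp.smul_apply, h₂, PiLp.smul_apply]
  have h₃ := coe_coeff_rowCharFun hA (Fock.single β c) α
  rw [h₃, charApprox_apply, ← hf, map_sub, Fock.coeff_amp, Fock.coeff_amp, smul_sub, smul_sub,
    ← map_smul, hstate, map_smul, ← map_smul (rowOp A), hx', map_smul (rowOp A)]
  rfl

end System

/-- Damping the coefficient at `α` by `r ^ |α|` is strongly continuous as `r` increases to `1`. -/
lemma Fock.tendsto_of_coeff_eq_pow_smul {d : ℕ} {H : Type*} [NormedAddCommGroup H]
    [InnerProductSpace ℂ H] {F : ℝ → Fock d H} {y : Fock d H}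
    (h : ∀ᶠ r in 𝓝[<] (1 : ℝ), ∀ α, coeff α (F r) = (r : ℂ) ^ α.length • coeff α y) :
    Tendsto F (𝓝[<] 1) (𝓝 y) := by
  rw [tendsto_iff_norm_sub_tendsto_zero]
  have hI : ∀ᶠ r in 𝓝[<] (1 : ℝ), r ∈ Set.Ioo (0 : ℝ) 1 := Ioo_mem_nhdsLT zero_lt_one
  have hsq : Tendsto (fun r => ‖F r - y‖ ^ 2) (𝓝[<] 1) (𝓝 0) := by
    have key : Tendsto (fun r : ℝ => ∑' α : List (Fin d), (1 - r ^ α.length) ^ 2 * ‖coeff α y‖ ^ 2)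
        (𝓝[<] 1) (𝓝 (∑' _ : List (Fin d), (0 : ℝ))) := by
      refine tendsto_tsum_of_dominated_convergence (hasSum_norm_sq y).summable (fun α => ?_) ?_
      · have hc : Continuous fun r : ℝ => (1 - r ^ α.length) ^ 2 * ‖coeff α y‖ ^ 2 :=
          ((continuous_const.sub (continuous_pow _)).pow 2).mul continuous_const
        have := (hc.tendsto 1).mono_left (nhdsWithin_le_nhds (s := Set.Iio 1))
        simpa using this
      · filter_upwards [hI] with r hr α
        have h1 : r ^ α.length ≤ 1 := pow_le_one₀ hr.1.le hr.2.le
        have h0 : 0 ≤ r ^ α.length := pow_nonneg hr.1.le _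
        rw [Real.norm_of_nonneg (by positivity)]
        exact mul_le_of_le_one_left (sq_nonneg _) (by nlinarith)
    rw [tsum_zero] at key
    refine key.congr' ?_
    filter_upwards [h] with r hr
    refine ((hasSum_norm_sq (F r - y)).tsum_eq.symm.trans (tsum_congr fun α => ?_)).symm
    have h1 : coeff α (F r - y) = (((r ^ α.length - 1 : ℝ) : ℂ)) • coeff α y := by
      rw [map_sub, hr]
      push_cast
      rw [sub_smul, one_smul]
    rw [h1, norm_smul, mul_pow, Complex.norm_real, Real.norm_eq_abs, sq_abs]
    ring
  have := hsq.sqrt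
  simpa using this

/-- Pointwise convergence of contractions to a contraction holds on a closed set. -/
lemma tendsto_of_mem_closure_of_norm_le {ι E F : Type*} [NormedAddCommGroup E] [NormedSpace ℂ E]
    [NormedAddCommGroup F] [NormedSpace ℂ F] {l : Filter ι} {Φ : ι → E →L[ℂ] F} {M : E →L[ℂ] F}
    (hΦ : ∀ᶠ i in l, ∀ x, ‖Φ i x‖ ≤ ‖x‖) (hM : ∀ x, ‖M x‖ ≤ ‖x‖) {x : E}
    (hx : x ∈ closure {x | Tendsto (fun i => Φ i x) l (𝓝 (M x))}) :
    Tendsto (fun i => Φ i x) l (𝓝 (M x)) := by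
  rw [Metric.tendsto_nhds]
  intro ε hε
  obtain ⟨y, hy, hxy⟩ := Metric.mem_closure_iff.1 hx (ε / 3) (by positivity)
  rw [dist_eq_norm] at hxy
  filter_upwards [hΦ, (Metric.tendsto_nhds.1 hy) (ε / 3) (by positivity)] with i h₁ h₂
  rw [dist_eq_norm] at h₂ ⊢
  have h₃ := h₁ (x - y)
  have h₄ := hM (x - y)
  rw [map_sub] at h₃ h₄
  calc ‖Φ i x - M x‖ = ‖(Φ i x - Φ i y) + (Φ i y - M y) - (M x - M y)‖ := by congr 1; abel
    _ ≤ ‖Φ i x - Φ i y‖ + ‖Φ i y - M y‖ + ‖M x - M y‖ :=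
      (norm_sub_le _ _).trans (add_le_add_left (norm_add_le _ _) _)
    _ < ε := by linarith

section RowCharFun

variable {d : ℕ} {K : Type*} [NormedAddCommGroup K] [InnerProductSpace ℂ K] [CompleteSpace K]
  {A : Fin d → K →L[ℂ] K}

lemma norm_amp_subtypeL {d : ℕ} {H : Type*} [NormedAddCommGroup H] [InnerProductSpace ℂ H]
    (S : Submodule ℂ H) (x : Fock d S) : ‖amp S.subtypeL x‖ = ‖x‖ :=
  Fock.norm_amp_eq (fun _ => rfl) x

/-- The operators `M_A(rR)` are contractions, so their strong convergence has to be checked only on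
the vectors `e_β ⊗ h`, where they differ from `M_A` by powers of `r` in the coefficients. -/
lemma isRowCharFun_rowCharFun (hA : ‖rowOp A‖ ≤ 1) : IsRowCharFun A (rowCharFun A hA) := by
  intro x
  have hI : ∀ᶠ r in 𝓝[<] (1 : ℝ), r ∈ Set.Ioo (0 : ℝ) 1 := Ioo_mem_nhdsLT zero_lt_one
  refine tendsto_of_mem_closure_of_norm_le
    (Φ := fun r => charApprox A r ∘L amp (rowDefect A).subtypeL)
    (M := amp (rowCodefect A).subtypeL ∘L rowCharFun A hA) ?_ ?_ ?_
  · filter_upwards [hI] with r hr x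
    exact (norm_charApprox_le hA hr.1.le hr.2 _).trans (norm_amp_subtypeL _ x).le
  · intro x
    exact (norm_amp_subtypeL _ _).le.trans (norm_rowCharFun_le hA x)
  · refine mem_closure_of_tendsto (Fock.hasSum_single x) (Eventually.of_forall fun s => ?_)
    simp only [Set.mem_ofPred_eq, map_sum]
    refine tendsto_finsetSum _ fun β _ => ?_
    have h₁ : Tendsto (fun r : ℝ => (r : ℂ) ^ β.length • charApprox A r
        (amp (rowDefect A).subtypeL (Fock.single β (Fock.coeff β x)))) (𝓝[<] 1)
        (𝓝 (amp (rowCodefect A).subtypeL (rowCharFun A hA (Fock.single β (Fock.coeff β x))))) := by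
      refine Fock.tendsto_of_coeff_eq_pow_smul ?_
      filter_upwards [hI] with r hr α
      rw [map_smul]
      exact pow_mul_charApprox_single hA hr.1.le hr.2 β _ α
    have h₂ : Tendsto (fun r : ℝ => ((r : ℂ) ^ β.length)⁻¹) (𝓝[<] 1) (𝓝 1) := by
      have hc : ContinuousAt (fun r : ℝ => ((r : ℂ) ^ β.length)⁻¹) 1 := by
        refine (Complex.continuous_ofReal.pow _).continuousAt.inv₀ (by simp)
      simpa using hc.tendsto.mono_left (nhdsWithin_le_nhds (s := Set.Iio 1))
    have h₃ := h₂.smul h₁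
    rw [one_smul] at h₃
    refine h₃.congr' ?_
    filter_upwards [hI] with r hr
    have hr' : (r : ℂ) ^ β.length ≠ 0 := pow_ne_zero _ (Complex.ofReal_ne_zero.2 hr.1.ne')
    rw [inv_smul_smul₀ hr']
    rfl

theorem isRowCharFun_iff (hA : ‖rowOp A‖ ≤ 1)
    (M : Fock d (rowDefect A) →L[ℂ] Fock d (rowCodefect A)) :
    IsRowCharFun A M ↔ M = rowCharFun A hA := by
  refine ⟨fun h => ?_, fun h => h ▸ isRowCharFun_rowCharFun hA⟩
  ext x : 1
  have h₁ := tendsto_nhds_unique (h x) (isRowCharFun_rowCharFun hA x)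
  rw [← sub_eq_zero, ← norm_eq_zero, ← norm_amp_subtypeL, map_sub, h₁, sub_self, norm_zero]

theorem existsUnique_isRowCharFun (hA : ‖rowOp A‖ ≤ 1) : ∃! M, IsRowCharFun A M :=
  ⟨rowCharFun A hA, isRowCharFun_rowCharFun hA, fun M hM => (isRowCharFun_iff hA M).1 hM⟩

end RowCharFun

/-! ### Contractions intertwining isometries -/

section Intertwining

variable {ι H X Y : Type*} [NormedAddCommGroup X] [InnerProductSpace ℂ X] [CompleteSpace X]
  [NormedAddCommGroup Y] [InnerProductSpace ℂ Y] [CompleteSpace Y]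

/-- A contraction `N` is isometric only on vectors fixed by `N* N`. -/
lemma adjoint_apply_apply_of_norm_eq {N : X →L[ℂ] Y} (hN : ‖N‖ ≤ 1) {x : X}
    (hx : ‖N x‖ = ‖x‖) : (N†) (N x) = x := by
  have h₁ := @norm_sub_sq ℂ _ _ _ _ ((N†) (N x)) x
  have h₂ := norm_apply_le_of_norm_le_one (norm_adjoint_le_one hN) (N x)
  have h₃ : RCLike.re (inner ℂ ((N†) (N x)) x) = ‖N x‖ ^ 2 := by
    rw [ContinuousLinearMap.adjoint_inner_left, inner_self_eq_norm_sq]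
  have h₄ := pow_le_pow_left₀ (norm_nonneg _) h₂ 2
  rw [h₃] at h₁
  rw [hx] at h₁ h₄
  have h₅ : ‖(N†) (N x) - x‖ ^ 2 = 0 := le_antisymm (by linarith) (sq_nonneg _)
  exact sub_eq_zero.1 (norm_eq_zero.1 (pow_eq_zero_iff two_ne_zero |>.1 h₅))

/-- The operators `U` on `Y` are generated by the vectors `j h`: every closed subspace of `Y`
containing these and invariant under all `U i` is the whole space. -/
def IsGenerating (j : H → Y) (U : ι → Y →L[ℂ] Y) : Prop :=
  ∀ S : Submodule ℂ Y, IsClosed (S : Set Y) → (∀ h, j h ∈ S) → (∀ i, ∀ y ∈ S, U i y ∈ S) →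
    ∀ y, y ∈ S

variable {N : X →L[ℂ] Y} {V : ι → X →L[ℂ] X} {U : ι → Y →L[ℂ] Y} {k : H → X} {j : H → Y}

/-- Let the contraction `N` intertwine the isometries `V` and `U`, and let `N k = j` with `k`
and `j` isometric. If `j` generates, then `N` is a coisometry and `N*` intertwines `U` and `V`:
these properties hold on the vectors `j h` and are inherited along `U`. -/
lemma adjoint_intertwining (hN : ‖N‖ ≤ 1) (hNV : ∀ i x, N (V i x) = U i (N x))
    (hV : ∀ i x, ‖V i x‖ = ‖x‖) (hU : ∀ i y, ‖U i y‖ = ‖y‖) (hNk : ∀ h, N (k h) = j h)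
    (hkj : ∀ h, ‖k h‖ = ‖j h‖) (hgen : IsGenerating j U) :
    (∀ h, (N†) (j h) = k h) ∧ (∀ i y, (N†) (U i y) = V i ((N†) y)) ∧ ∀ y, N ((N†) y) = y := by
  have hj : ∀ h, (N†) (j h) = k h := fun h => by
    rw [← hNk, adjoint_apply_apply_of_norm_eq hN (by rw [hNk, hkj])]
  have hstep : ∀ i y, N ((N†) y) = y → (N†) (U i y) = V i ((N†) y) := by
    intro i y hy
    have h₁ : ‖(N†) y‖ = ‖y‖ := by
      refine le_antisymm (norm_apply_le_of_norm_le_one (norm_adjoint_le_one hN) y) ?_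
      conv_lhs => rw [← hy]
      exact norm_apply_le_of_norm_le_one hN _
    have h₂ : N (V i ((N†) y)) = U i y := by rw [hNV, hy]
    rw [← h₂, adjoint_apply_apply_of_norm_eq hN (by rw [h₂, hU, hV, h₁])]
  have hid : ∀ y, N ((N†) y) = y := by
    refine hgen (LinearMap.eqLocus (N ∘L N†).toLinearMap LinearMap.id) ?_ (fun h => ?_)
      fun i y hy => ?_
    · exact isClosed_eq (N ∘L N†).continuous continuous_id
    · change N ((N†) (j h)) = j h
      rw [hj, hNk]
    · change N ((N†) (U i y)) = U i y
      rw [hstep i y hy, hNV]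
      exact congrArg (U i) hy
  exact ⟨hj, fun i y => hstep i y (hid y), hid⟩

/-- Under the identity `N N* = 1`, the linear isomorphism `x ↦ N x ⊕ P_{ker N} x`. -/
def coisometryEquiv (N : X →L[ℂ] Y) (hN : ∀ y, N ((N†) y) = y) :
    X ≃ₗ[ℂ] HilbSum Y (LinearMap.ker N.toLinearMap) where
  toFun x := HilbSum.mk (N x) ⟨x - (N†) (N x), by simp [hN]⟩
  map_add' x y := by
    refine HilbSum.ext (map_add N x y) (Subtype.ext ?_)
    simp only [HilbSum.snd_mk, HilbSum.snd_add, map_add, Submodule.coe_add]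
    abel
  map_smul' c x := by
    refine HilbSum.ext (map_smul N c x) (Subtype.ext ?_)
    simp [smul_sub]
  invFun p := (N†) p.fst + p.snd
  left_inv x := by simp
  right_inv p := by
    have h : N (p.snd : X) = 0 := p.snd.2
    refine HilbSum.ext ?_ (Subtype.ext ?_)
    · simp [hN, h]
    · simp [hN, h]

lemma norm_coisometryEquiv (hN : ∀ y, N ((N†) y) = y) (x : X) :
    ‖coisometryEquiv N hN x‖ = ‖x‖ := by
  have h : inner ℂ ((N†) (N x)) (x - (N†) (N x)) = 0 := by
    rw [ContinuousLinearMap.adjoint_inner_left, map_sub, hN, sub_self, inner_zero_right]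
  have h₁ := norm_add_sq_eq_norm_sq_add_norm_sq_of_inner_eq_zero _ _ h
  rw [add_sub_cancel, ← sq, ← sq, ← sq] at h₁
  have h₂ : ‖(N†) (N x)‖ ^ 2 = ‖N x‖ ^ 2 := by
    rw [← @inner_self_eq_norm_sq ℂ, ← @inner_self_eq_norm_sq ℂ,
      ContinuousLinearMap.adjoint_inner_left, hN]
  have h₃ : ‖coisometryEquiv N hN x‖ ^ 2 = ‖N x‖ ^ 2 + ‖x - (N†) (N x)‖ ^ 2 :=
    HilbSum.norm_sq _
  refine (sq_eq_sq₀ (norm_nonneg _) (norm_nonneg _)).1 ?_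
  rw [h₃, h₁, h₂]

/-- Under the identity `N N* = 1`, the unitary `x ↦ N x ⊕ P_{ker N} x`. -/
def coisometryUnitary (N : X →L[ℂ] Y) (hN : ∀ y, N ((N†) y) = y) :
    X ≃ₗᵢ[ℂ] HilbSum Y (LinearMap.ker N.toLinearMap) where
  __ := coisometryEquiv N hN
  norm_map' := norm_coisometryEquiv hN

@[simp] lemma fst_coisometryUnitary (hN : ∀ y, N ((N†) y) = y) (x : X) :
    (coisometryUnitary N hN x).fst = N x := rfl

@[simp] lemma coe_snd_coisometryUnitary (hN : ∀ y, N ((N†) y) = y) (x : X) :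
    ((coisometryUnitary N hN x).snd : X) = x - (N†) (N x) := rfl

lemma coisometryUnitary_symm_inlOp (hN : ∀ y, N ((N†) y) = y) (y : Y) :
    (coisometryUnitary N hN).symm (inlOp _ _ y) = (N†) y := by
  rw [LinearIsometryEquiv.symm_apply_eq]
  refine HilbSum.ext ?_ (Subtype.ext ?_)
  · simp [hN]
  · simp [hN]

/-- A unitary intertwining `V` with `U ⊕ R` and carrying `k` to `j ⊕ 0` has first component `N`,
as its inverse agrees with `N*` on the vectors `j h`, hence on the space they generate. -/
lemma fst_unitary_eq {L : Type*} [NormedAddCommGroup L] [InnerProductSpace ℂ L]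
    {R : ι → L →L[ℂ] L} {W : X ≃ₗᵢ[ℂ] HilbSum Y L}
    (hW : ∀ h, W (k h) = inlOp Y L (j h)) (hWV : ∀ i x, W (V i x) = diagOp (U i) (R i) (W x))
    (hj : ∀ h, (N†) (j h) = k h) (hU : ∀ i y, (N†) (U i y) = V i ((N†) y))
    (hgen : IsGenerating j U) (x : X) : (W x).fst = N x := by
  have key : ∀ y, W ((N†) y) = inlOp Y L y := by
    refine hgen (LinearMap.eqLocus (W.toLinearIsometry.toContinuousLinearMap ∘L N†).toLinearMap
      (inlOp Y L).toLinearMap) ?_ (fun h => ?_) fun i y hy => ?_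
    · exact isClosed_eq (W.toLinearIsometry.toContinuousLinearMap ∘L N†).continuous
        (inlOp Y L).continuous
    · change W ((N†) (j h)) = _
      rw [hj, hW]
      rfl
    · change W ((N†) y) = inlOp Y L y at hy
      change W ((N†) (U i y)) = inlOp Y L (U i y)
      rw [hU, hWV, hy]
      ext <;> simp
  refine ext_inner_left ℂ fun y => ?_
  rw [← ContinuousLinearMap.adjoint_inner_left, ← W.inner_map_map, key, HilbSum.inner_def]
  simp

lemma exists_intertwining_unitary (hN : ‖N‖ ≤ 1) (hNV : ∀ i x, N (V i x) = U i (N x))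
    (hV : ∀ i x, ‖V i x‖ = ‖x‖) (hU : ∀ i y, ‖U i y‖ = ‖y‖) (hNk : ∀ h, N (k h) = j h)
    (hkj : ∀ h, ‖k h‖ = ‖j h‖) (hgen : IsGenerating j U) :
    ∃ (L : Submodule ℂ X) (R : ι → L →L[ℂ] L) (W : X ≃ₗᵢ[ℂ] HilbSum Y L),
      (∀ x, x ∈ L ↔ ∀ y, inner ℂ (W.symm (inlOp _ _ y)) x = 0) ∧
      (∀ i x, (R i x : X) = V i x) ∧ (∀ h, W (k h) = inlOp _ _ (j h)) ∧
      (∀ i x, W (V i x) = diagOp (U i) (R i) (W x)) ∧ ∀ x, (W x).fst = N x := by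
  obtain ⟨h₁, h₂, h₃⟩ := adjoint_intertwining hN hNV hV hU hNk hkj hgen
  have hker : ∀ i x, N x = 0 → N (V i x) = 0 := fun i x hx => by rw [hNV, hx, map_zero]
  refine ⟨LinearMap.ker N.toLinearMap, fun i =>
    (V i ∘L Submodule.subtypeL _).codRestrict _ fun x => hker i x x.2,
    coisometryUnitary N h₃, fun x => ⟨fun hx y => ?_, fun hx => ?_⟩, fun i x => rfl, fun h => ?_,
    fun i x => ?_, fun x => rfl⟩
  · rw [coisometryUnitary_symm_inlOp, ContinuousLinearMap.adjoint_inner_left,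
      show N x = 0 from hx, inner_zero_right]
  · refine LinearMap.mem_ker.2 (ext_inner_left ℂ fun y => ?_)
    have h := hx y
    rw [coisometryUnitary_symm_inlOp, ContinuousLinearMap.adjoint_inner_left] at h
    rw [inner_zero_right]
    exact h
  · rw [← LinearIsometryEquiv.eq_symm_apply, coisometryUnitary_symm_inlOp, h₁]
  · refine HilbSum.ext ?_ (Subtype.ext ?_)
    · rw [fst_diagOp, fst_coisometryUnitary, fst_coisometryUnitary, hNV]
    · rw [snd_diagOp, coe_snd_coisometryUnitary, hNV, h₂, ← map_sub]
      rfl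

end Intertwining

/-! ### The minimal isometric dilation -/

section Dilation

variable {d : ℕ} {H : Type*} [NormedAddCommGroup H] [InnerProductSpace ℂ H]

/-- The embedding of `H` as the `j`-th summand of `H^d`. -/
def powSingle (j : Fin d) : H →L[ℂ] HilbPow d H :=
  (PiLp.continuousLinearEquiv 2 ℂ (fun _ : Fin d => H)).symm.toContinuousLinearMap ∘L
    ContinuousLinearMap.single ℂ (fun _ : Fin d => H) j

lemma powSingle_apply (i j : Fin d) (h : H) : powSingle j h i = if i = j then h else 0 := by
  simp [powSingle]

lemma sum_powSingle (x : HilbPow d H) : ∑ j, powSingle j (x j) = x := by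
  ext i
  simp [powSingle_apply]

@[simp] lemma norm_powSingle (j : Fin d) (h : H) : ‖powSingle j h‖ = ‖h‖ := by
  refine (sq_eq_sq₀ (norm_nonneg _) (norm_nonneg _)).1 ?_
  rw [HilbPow.norm_sq, Finset.sum_eq_single j]
  · simp [powSingle_apply]
  · intro i _ hi
    simp [powSingle_apply, hi]
  · simp

@[simp] lemma rowOp_powSingle {K : Type*} [NormedAddCommGroup K] [InnerProductSpace ℂ K]
    (S : Fin d → H →L[ℂ] K) (j : Fin d) (h : H) : rowOp S (powSingle j h) = S j h := by
  rw [rowOp_apply, Finset.sum_eq_single j]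
  · simp [powSingle_apply]
  · intro i _ hi
    simp [powSingle_apply, hi]
  · simp

lemma norm_vacuum_add_leftCreation_sq (c : H) (j : Fin d) (x : Fock d H) :
    ‖vacuum c + leftCreation j x‖ ^ 2 = ‖c‖ ^ 2 + ‖x‖ ^ 2 := by
  have h : inner ℂ (vacuum c) (leftCreation j x) = 0 := by
    refine (lp.inner_single_left (𝕜 := ℂ) (G := fun _ : List (Fin d) => H) [] c
      (leftCreation j x)).trans ?_
    exact (congrArg (inner ℂ c) (Fock.coeff_nil_leftCreation j x)).trans (inner_zero_right c)
  have hv : ‖(vacuum c : Fock d H)‖ = ‖c‖ :=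
    lp.norm_single (E := fun _ : List (Fin d) => H) (p := 2) (by norm_num) [] c
  rw [sq, norm_add_sq_eq_norm_sq_add_norm_sq_of_inner_eq_zero _ _ h, hv,
    LinearIsometry.norm_map, ← sq, ← sq]

variable [CompleteSpace H] (S : Fin d → H →L[ℂ] H)

@[simp] lemma fst_dilation (j : Fin d) (x : DilSpace S) :
    (dilation S j x).fst = S j x.fst := by
  simp [dilation]

@[simp] lemma snd_dilation (j : Fin d) (x : DilSpace S) :
    (dilation S j x).snd
      = vacuum (toDefect (rowOp S) (powSingle j x.fst)) + leftCreation j x.snd := rfl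

variable {S}

lemma norm_dilation (hS : ‖rowOp S‖ ≤ 1) (j : Fin d) (x : DilSpace S) :
    ‖dilation S j x‖ = ‖x‖ := by
  have h := norm_toDefect_sq hS (powSingle j x.fst)
  rw [norm_powSingle, rowOp_powSingle] at h
  refine (sq_eq_sq₀ (norm_nonneg _) (norm_nonneg _)).1 ((HilbSum.norm_sq _).trans ?_)
  rw [fst_dilation, snd_dilation, norm_vacuum_add_leftCreation_sq, h, HilbSum.norm_sq x]
  ring

/-- The space of the minimal isometric dilation is generated by `H`: the differences
`V_j h - S_j h` give the vacuum vectors `e_0 ⊗ D_S k`, and `V_j` is `L_j ⊗ I` on `Γ ⊗ 𝓓_S`. -/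
lemma isGenerating_dilation : IsGenerating (inlOp H (Fock d (rowDefect S))) (dilation S) := by
  intro T hT hH hV
  have h₀ : ∀ k, inrOp H (Fock d (rowDefect S)) (vacuum (toDefect (rowOp S) k)) ∈ T := by
    intro k
    rw [← sum_powSingle k, map_sum, map_sum, map_sum]
    refine T.sum_mem fun j _ => ?_
    have h : inrOp H (Fock d (rowDefect S)) (vacuum (toDefect (rowOp S) (powSingle j (k j))))
        = dilation S j (inlOp _ _ (k j)) - inlOp _ _ (S j (k j)) := by
      refine HilbSum.ext ?_ ?_
      · simp
      · simp
    rw [h]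
    exact T.sub_mem (hV j _ (hH _)) (hH _)
  have h₁ : ∀ c, inrOp H (Fock d (rowDefect S)) (vacuum c) ∈ T :=
    defectSpace_induction (hT.preimage ((inrOp H (Fock d (rowDefect S))).continuous.comp
      vacuum.continuous)) h₀
  have h₂ : ∀ (α : List (Fin d)) c, inrOp H (Fock d (rowDefect S)) (Fock.single α c) ∈ T := by
    intro α
    induction α with
    | nil => exact h₁
    | cons j α ih =>
      intro c
      have h : inrOp H (Fock d (rowDefect S)) (Fock.single (j :: α) c)
          = dilation S j (inrOp _ _ (Fock.single α c)) := by
        refine HilbSum.ext ?_ ?_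
        · simp
        · simp [Fock.leftCreation_single]
      rw [h]
      exact hV j _ (ih c)
  intro x
  have h₃ : inrOp H (Fock d (rowDefect S)) x.snd ∈ T := by
    refine hT.mem_of_tendsto ((inrOp H (Fock d (rowDefect S))).hasSum (Fock.hasSum_single x.snd))
      (Eventually.of_forall fun s => T.sum_mem fun α _ => h₂ α _)
  have h₄ : x = inlOp H (Fock d (rowDefect S)) x.fst + inrOp H (Fock d (rowDefect S)) x.snd := by
    refine HilbSum.ext ?_ ?_
    · simp
    · simp
  rw [h₄]
  exact T.add_mem (hH _) h₃

end Dilation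

/-! ### Outputs of the system driven through a unitary -/

section DrivenSystem

variable {d : ℕ} {K U X Z : Type*} [NormedAddCommGroup K] [InnerProductSpace ℂ K] [CompleteSpace K]
  [NormedAddCommGroup U] [InnerProductSpace ℂ U] [NormedAddCommGroup X] [InnerProductSpace ℂ X]
  [NormedAddCommGroup Z] [InnerProductSpace ℂ Z] {A : Fin d → K →L[ℂ] K}

@[simp] lemma output_nil (hA : ‖rowOp A‖ ≤ 1) (p : HilbSum K (Fock d (rowDefect A))) :
    output A hA p []
      = toDefect ((rowOp A)†) p.fst - defectRestrict (rowOp A) hA (Fock.coeff [] p.snd) :=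
  rfl

lemma output_cons (hA : ‖rowOp A‖ ≤ 1) {p q : HilbSum K (Fock d (rowDefect A))} {i : Fin d}
    (h₀ : q.fst = (((rowOp A)†) p.fst
      + defect (rowOp A) ((Fock.coeff [] p.snd : rowDefect A) : HilbPow d K)) i)
    (h₁ : ∀ α, Fock.coeff α q.snd = Fock.coeff (i :: α) p.snd) (α : List (Fin d)) :
    output A hA p (i :: α) = output A hA q α := by
  rw [output, output, state_cons, ← h₀, ← h₁]
  simp only [h₁]

lemma output_zero (hA : ‖rowOp A‖ ≤ 1) (α : List (Fin d)) : output A hA 0 α = 0 := by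
  have h := output_smul hA 0 0 α
  rwa [zero_smul, zero_smul] at h

/-- The second component of the unitary `τ` as an operator. -/
def sndUnitary (τ : X ≃ₗᵢ[ℂ] HilbSum U (rowDefect A)) : X →L[ℂ] rowDefect A :=
  HilbSum.sndL U (rowDefect A) ∘L τ.toLinearIsometry.toContinuousLinearMap

/-- The first component of the unitary `τ` as an operator. -/
def fstUnitary (τ : X ≃ₗᵢ[ℂ] HilbSum U (rowDefect A)) : X →L[ℂ] U :=
  HilbSum.fstL U (rowDefect A) ∘L τ.toLinearIsometry.toContinuousLinearMap

lemma norm_unitary_sq (τ : X ≃ₗᵢ[ℂ] HilbSum U (rowDefect A)) (x : X) :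
    ‖fstUnitary τ x‖ ^ 2 + ‖sndUnitary τ x‖ ^ 2 = ‖x‖ ^ 2 :=
  (HilbSum.norm_sq (τ x)).symm.trans (congrArg (· ^ 2) (τ.norm_map x))

/-- The initial state and input of the system of `A` which belong to a vector of `K ⊕ (Γ ⊗ X)`
when `𝓓_A` is a summand of `X`. -/
def systemInput (τ : X ≃ₗᵢ[ℂ] HilbSum U (rowDefect A)) :
    HilbSum K (Fock d X) →L[ℂ] HilbSum K (Fock d (rowDefect A)) :=
  diagOp (.id ℂ K) (amp (sndUnitary τ))

@[simp] lemma fst_systemInput (τ : X ≃ₗᵢ[ℂ] HilbSum U (rowDefect A)) (p : HilbSum K (Fock d X)) :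
    (systemInput τ p).fst = p.fst := by
  rw [systemInput, fst_diagOp]
  rfl

@[simp] lemma coeff_snd_systemInput (τ : X ≃ₗᵢ[ℂ] HilbSum U (rowDefect A))
    (p : HilbSum K (Fock d X)) (α : List (Fin d)) :
    Fock.coeff α (systemInput τ p).snd = sndUnitary τ (Fock.coeff α p.snd) := by
  rw [systemInput, snd_diagOp]
  rfl

/-- For an operator `[R₁, R₂]` on `U ⊕ 𝓓_{*,A}` and a unitary `τ` of `X` onto `U ⊕ 𝓓_A`, the
operator `[R₁, R₂ M_A] τ` on `Γ ⊗ X`, extended to `K ⊕ (Γ ⊗ X)` by letting a vector of `K` act as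
the initial state of the system of `A`. -/
def drivenOutput (hA : ‖rowOp A‖ ≤ 1) (R : HilbSum U (rowCodefect A) →L[ℂ] Z)
    (τ : X ≃ₗᵢ[ℂ] HilbSum U (rowDefect A)) : HilbSum K (Fock d X) →L[ℂ] Fock d Z :=
  amp (R ∘L inlOp U (rowCodefect A)) ∘L amp (fstUnitary τ) ∘L HilbSum.sndL K (Fock d X)
    + amp (R ∘L inrOp U (rowCodefect A)) ∘L systemOp A hA ∘L systemInput τ

lemma mk_eq_inlOp_add_inrOp (u : U) (z : Z) : HilbSum.mk u z = inlOp U Z u + inrOp U Z z := by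
  refine HilbSum.ext ?_ ?_
  · rw [HilbSum.fst_add, fst_inlOp, fst_inrOp, add_zero, HilbSum.fst_mk]
  · rw [HilbSum.snd_add, snd_inlOp, snd_inrOp, zero_add, HilbSum.snd_mk]

lemma coeff_drivenOutput (hA : ‖rowOp A‖ ≤ 1) (R : HilbSum U (rowCodefect A) →L[ℂ] Z)
    (τ : X ≃ₗᵢ[ℂ] HilbSum U (rowDefect A)) (p : HilbSum K (Fock d X)) (α : List (Fin d)) :
    Fock.coeff α (drivenOutput hA R τ p) = R (HilbSum.mk (fstUnitary τ (Fock.coeff α p.snd))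
      (output A hA (systemInput τ p) α)) := by
  rw [mk_eq_inlOp_add_inrOp, map_add]
  rfl

lemma norm_drivenOutput_sq_le (hA : ‖rowOp A‖ ≤ 1) {R : HilbSum U (rowCodefect A) →L[ℂ] Z}
    (hR : ‖R‖ ≤ 1) (τ : X ≃ₗᵢ[ℂ] HilbSum U (rowDefect A)) (p : HilbSum K (Fock d X)) :
    ‖drivenOutput hA R τ p‖ ^ 2 ≤ ‖p.fst‖ ^ 2 + ‖p.snd‖ ^ 2 := by
  have h₁ : ∀ α, ‖Fock.coeff α (drivenOutput hA R τ p)‖ ^ 2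
      ≤ ‖fstUnitary τ (Fock.coeff α p.snd)‖ ^ 2
        + ‖Fock.coeff α (systemOp A hA (systemInput τ p))‖ ^ 2 := by
    intro α
    rw [coeff_drivenOutput]
    refine (pow_le_pow_left₀ (norm_nonneg _) (norm_apply_le_of_norm_le_one hR _) 2).trans_eq ?_
    exact HilbSum.norm_sq _
  have hu := Fock.hasSum_norm_sq (amp (fstUnitary τ) p.snd)
  have hle := hasSum_le h₁ (Fock.hasSum_norm_sq (drivenOutput hA R τ p))
    (hu.add (Fock.hasSum_norm_sq (systemOp A hA (systemInput τ p))))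
  have h₂ := hu.add (Fock.hasSum_norm_sq (systemInput τ p).snd)
  simp only [coeff_snd_systemInput, Fock.coeff_amp, norm_unitary_sq] at h₂
  have h₃ := h₂.unique (Fock.hasSum_norm_sq p.snd)
  have h₄ := pow_le_pow_left₀ (norm_nonneg _) (norm_systemOp_le hA (systemInput τ p)) 2
  rw [HilbSum.norm_sq (systemInput τ p), fst_systemInput] at h₄
  linarith

lemma output_step (hA : ‖rowOp A‖ ≤ 1) (g : rowCodefect A) (s : HilbPow d K) :
    defect ((rowOp A)†) (defect ((rowOp A)†) g + rowOp A s)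
      - rowOp A (defect (rowOp A) s - ((rowOp A)†) g) = g := by
  rw [map_add, map_sub, defect_adjoint_defect_adjoint hA, apply_defect hA]
  abel

lemma state_step (hA : ‖rowOp A‖ ≤ 1) (g : rowCodefect A) (s : HilbPow d K) :
    ((rowOp A)†) (defect ((rowOp A)†) g + rowOp A s)
      + defect (rowOp A) (defect (rowOp A) s - ((rowOp A)†) g) = s := by
  rw [map_add, map_sub, defect_defect hA, adjoint_apply_defect hA]
  abel

/-- If the Julia–Halmos operator of `A` takes an initial state and the input at the empty word
to the output `g` and to a next state `k` in the `i`-th place only, then `drivenOutput` of these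
data is the output at the empty word followed by the outputs for the initial state `k`. -/
lemma drivenOutput_vacuum_add_leftCreation (hA : ‖rowOp A‖ ≤ 1)
    (R : HilbSum U (rowCodefect A) →L[ℂ] Z) (τ : X ≃ₗᵢ[ℂ] HilbSum U (rowDefect A))
    {i : Fin d} {h₀ k : K} {e : X} {g : rowCodefect A} (x : Fock d X)
    (hh₀ : h₀ = defect ((rowOp A)†) (g : K) + rowOp A (powSingle i k))
    (he : (sndUnitary τ e : HilbPow d K)
      = defect (rowOp A) (powSingle i k) - ((rowOp A)†) (g : K)) :
    drivenOutput hA R τ (HilbSum.mk h₀ (vacuum e + leftCreation i x))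
      = vacuum (R (HilbSum.mk (fstUnitary τ e) g))
        + leftCreation i (drivenOutput hA R τ (HilbSum.mk k x)) := by
  set p : HilbSum K (Fock d X) := HilbSum.mk h₀ (vacuum e + leftCreation i x) with hp
  have hp₀ : p.fst = h₀ := rfl
  have hp₁ : Fock.coeff [] p.snd = e := by
    rw [hp, HilbSum.snd_mk, map_add, Fock.coeff_nil_vacuum, Fock.coeff_nil_leftCreation, add_zero]
  have hp₂ : ∀ j α, Fock.coeff (j :: α) p.snd = if j = i then Fock.coeff α x else 0 := by
    intro j α
    rw [hp, HilbSum.snd_mk, map_add, Fock.coeff_cons_vacuum, Fock.coeff_cons_leftCreation,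
      zero_add]
  refine Fock.ext fun α => ?_
  rw [coeff_drivenOutput, map_add]
  cases α with
  | nil =>
    have hout : output A hA (systemInput τ p) [] = g := by
      rw [output_nil, fst_systemInput, coeff_snd_systemInput, hp₀, hp₁]
      refine Subtype.ext (Eq.trans ?_ (output_step hA g (powSingle i k)))
      rw [← hh₀, ← he]
      rfl
    rw [Fock.coeff_nil_vacuum, Fock.coeff_nil_leftCreation, add_zero, hp₁, hout]
  | cons j α =>
    have hst : (((rowOp A)†) (systemInput τ p).fst + defect (rowOp A)
        ((Fock.coeff [] (systemInput τ p).snd : rowDefect A) : HilbPow d K)) j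
          = if j = i then k else 0 := by
      rw [← powSingle_apply, ← state_step hA g (powSingle i k), fst_systemInput,
        coeff_snd_systemInput, hp₀, hp₁, hh₀, he]
    rw [Fock.coeff_cons_vacuum, zero_add, Fock.coeff_cons_leftCreation]
    split_ifs with hj
    · have hout := output_cons hA (p := systemInput τ p) (q := systemInput τ (HilbSum.mk k x))
        (i := j) (by rw [hst, if_pos hj, fst_systemInput, HilbSum.fst_mk])
        (fun β => by
          rw [coeff_snd_systemInput, coeff_snd_systemInput, hp₂, if_pos hj, HilbSum.snd_mk]) α
      rw [hout, hp₂, if_pos hj, coeff_drivenOutput, HilbSum.snd_mk]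
    · have hout := output_cons hA (p := systemInput τ p) (q := 0)
        (i := j) (by rw [hst, if_neg hj, HilbSum.fst_zero])
        (fun β => by
          rw [coeff_snd_systemInput, hp₂, if_neg hj, map_zero, HilbSum.snd_zero, map_zero]) α
      rw [hout, hp₂, if_neg hj, map_zero, output_zero]
      exact map_zero R

end DrivenSystem

/-! ### The characteristic function of a contractive lifting -/

section Lifting

variable {d : ℕ} {H K : Type*} [NormedAddCommGroup H] [InnerProductSpace ℂ H]
  [NormedAddCommGroup K] [InnerProductSpace ℂ K]

lemma powFst_powSingle (j : Fin d) (x : HilbSum H K) :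
    powFst (powSingle j x) = powSingle j x.fst := by
  ext i
  rw [powFst_apply, powSingle_apply, powSingle_apply]
  split_ifs <;> rfl

lemma powSnd_powSingle (j : Fin d) (x : HilbSum H K) :
    powSnd (powSingle j x) = powSingle j x.snd := by
  ext i
  rw [powSnd_apply, powSingle_apply, powSingle_apply]
  split_ifs <;> rfl

lemma norm_le_of_fst_eq_fst_fst {F G : Type*} [NormedAddCommGroup F] [InnerProductSpace ℂ F]
    [NormedAddCommGroup G] [InnerProductSpace ℂ G] {x : HilbSum (HilbSum H K) F} {y : HilbSum H G}
    (h₁ : y.fst = x.fst.fst) (h₂ : ‖y.snd‖ ^ 2 ≤ ‖x.fst.snd‖ ^ 2 + ‖x.snd‖ ^ 2) : ‖y‖ ≤ ‖x‖ := by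
  rw [← sq_le_sq₀ (norm_nonneg _) (norm_nonneg _), HilbSum.norm_sq, HilbSum.norm_sq x,
    HilbSum.norm_sq x.fst, h₁]
  linarith

variable [CompleteSpace H] [CompleteSpace K]
  {C : Fin d → H →L[ℂ] H} {B : Fin d → H →L[ℂ] K} {A : Fin d → K →L[ℂ] K}
  {γ : rowCodefect A →L[ℂ] rowDefect C}

/-- The operator `[D_{*,γ}, γ]` on `𝓓_{*,γ} ⊕ 𝓓_{*,A}`. -/
def defectRow (γ : rowCodefect A →L[ℂ] rowDefect C) :
    HilbSum (defectSpace (γ†)) (rowCodefect A) →L[ℂ] rowDefect C :=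
  rowBlock (defect (γ†) ∘L (defectSpace (γ†)).subtypeL) γ

lemma norm_defectRow_le (hγ : ‖γ‖ ≤ 1) : ‖defectRow γ‖ ≤ 1 := by
  refine ContinuousLinearMap.opNorm_le_bound _ zero_le_one fun x => ?_
  have h := julia_norm_sq hγ (x.fst : rowDefect C) x.snd
  rw [Submodule.norm_coe] at h
  have h' := sq_nonneg ‖defect γ x.snd - (γ†) (x.fst : rowDefect C)‖
  have h'' := HilbSum.norm_sq x
  rw [one_mul, ← sq_le_sq₀ (norm_nonneg _) (norm_nonneg _)]
  change ‖defect (γ†) (x.fst : rowDefect C) + γ x.snd‖ ^ 2 ≤ _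
  linarith

variable {E : Fin d → HilbSum H K →L[ℂ] HilbSum H K}

/-- The operator `[D_{*,γ}, γ M_A] σ_E` on `Γ ⊗ 𝓓_E`, extended to `H_A ⊕ (Γ ⊗ 𝓓_E)` by letting
a vector of `H_A` act as the initial state of the system of `A`. -/
def liftingOutput (hA : ‖rowOp A‖ ≤ 1) (γ : rowCodefect A →L[ℂ] rowDefect C)
    (σ : rowDefect E ≃ₗᵢ[ℂ] HilbSum (defectSpace (γ†)) (rowDefect A)) :
    HilbSum K (Fock d (rowDefect E)) →L[ℂ] Fock d (rowDefect C) :=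
  drivenOutput hA (defectRow γ) σ

variable {σ : rowDefect E ≃ₗᵢ[ℂ] HilbSum (defectSpace (γ†)) (rowDefect A)}

lemma liftingOutput_dilation (hA : ‖rowOp A‖ ≤ 1) (hE : E = liftRow C B A)
    (hγ : IsLiftingContraction C B A γ)
    (hσ : ∀ x, σ (toDefect (rowOp E) x) = sigmaOp C A hA γ x) (i : Fin d) (h : HilbSum H K)
    (x : Fock d (rowDefect E)) :
    liftingOutput hA γ σ (HilbSum.mk (E i h).snd
        (vacuum (toDefect (rowOp E) (powSingle i h)) + leftCreation i x))
      = vacuum (toDefect (rowOp C) (powSingle i h.fst))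
        + leftCreation i (liftingOutput hA γ σ (HilbSum.mk h.snd x)) := by
  have hs := hσ (powSingle i h)
  have hu : fstUnitary σ (toDefect (rowOp E) (powSingle i h))
      = toDefect (γ†) (toDefect (rowOp C) (powSingle i h.fst)) := by
    rw [← powFst_powSingle]
    exact (congrArg HilbSum.fst hs).trans (fst_sigmaOp hA γ (powSingle i h))
  have hv : (sndUnitary σ (toDefect (rowOp E) (powSingle i h)) : HilbPow d K)
      = defect (rowOp A) (powSingle i h.snd)
        - ((rowOp A)†) ((γ†) (toDefect (rowOp C) (powSingle i h.fst)) : rowCodefect A) := by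
    rw [← powSnd_powSingle i h, ← powFst_powSingle i h]
    exact (congrArg (fun y : HilbSum (defectSpace (γ†)) (rowDefect A) =>
      ((y.snd : rowDefect A) : HilbPow d K)) hs).trans
      (coe_snd_sigmaOp hA γ (powSingle i h))
  have h₀ : (E i h).snd = defect ((rowOp A)†) ((γ†) (toDefect (rowOp C) (powSingle i h.fst)))
      + rowOp A (powSingle i h.snd) := by
    rw [← hγ.rowOp_eq, hE, rowOp_powSingle, rowOp_powSingle]
    rfl
  refine (drivenOutput_vacuum_add_leftCreation hA (defectRow γ) σ x h₀ hv).trans ?_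
  have h₁ : defectRow γ (HilbSum.mk (toDefect (γ†) (toDefect (rowOp C) (powSingle i h.fst)))
      ((γ†) (toDefect (rowOp C) (powSingle i h.fst))))
        = toDefect (rowOp C) (powSingle i h.fst) :=
    (congrArg (· + γ ((γ†) (toDefect (rowOp C) (powSingle i h.fst))))
      (defect_adjoint_defect_adjoint hγ.1 (toDefect (rowOp C) (powSingle i h.fst)))).trans
      (sub_add_cancel _ _)
  have h₂ := (congrArg (fun u => defectRow γ (HilbSum.mk u
    ((γ†) (toDefect (rowOp C) (powSingle i h.fst))))) hu).trans h₁
  exact congrArg (fun c => vacuum c + leftCreation i (liftingOutput hA γ σ (HilbSum.mk h.snd x))) h₂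

/-- The operator from the dilation space of the lifting `E` onto the dilation space of `C` whose
adjoint is the embedding `W⁻¹` of the dilation space of `C`. -/
def dilationProj (hA : ‖rowOp A‖ ≤ 1) (γ : rowCodefect A →L[ℂ] rowDefect C)
    (σ : rowDefect E ≃ₗᵢ[ℂ] HilbSum (defectSpace (γ†)) (rowDefect A)) :
    DilSpace E →L[ℂ] DilSpace C :=
  colBlock (HilbSum.fstL H K ∘L HilbSum.fstL (HilbSum H K) (Fock d (rowDefect E)))
    (liftingOutput hA γ σ ∘L colBlock
      (HilbSum.sndL H K ∘L HilbSum.fstL (HilbSum H K) (Fock d (rowDefect E)))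
      (HilbSum.sndL (HilbSum H K) (Fock d (rowDefect E))))

lemma fst_dilationProj (hA : ‖rowOp A‖ ≤ 1) (x : DilSpace E) :
    (dilationProj hA γ σ x).fst = x.fst.fst := rfl

lemma snd_dilationProj (hA : ‖rowOp A‖ ≤ 1) (x : DilSpace E) :
    (dilationProj hA γ σ x).snd = liftingOutput hA γ σ (HilbSum.mk x.fst.snd x.snd) := rfl

lemma norm_dilationProj_le (hA : ‖rowOp A‖ ≤ 1) (hγ : ‖γ‖ ≤ 1) :
    ‖dilationProj hA γ σ‖ ≤ 1 := by
  refine ContinuousLinearMap.opNorm_le_bound _ zero_le_one fun x => ?_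
  rw [one_mul]
  exact norm_le_of_fst_eq_fst_fst rfl
    (norm_drivenOutput_sq_le hA (norm_defectRow_le hγ) σ (HilbSum.mk x.fst.snd x.snd))

lemma dilationProj_dilation (hA : ‖rowOp A‖ ≤ 1) (hE : E = liftRow C B A)
    (hγ : IsLiftingContraction C B A γ)
    (hσ : ∀ x, σ (toDefect (rowOp E) x) = sigmaOp C A hA γ x) (i : Fin d) (x : DilSpace E) :
    dilationProj hA γ σ (dilation E i x) = dilation C i (dilationProj hA γ σ x) := by
  have hE' : ∀ h, (E i h).fst = C i h.fst := fun h => by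
    rw [hE, liftRow, fst_blockOp, zero_apply, add_zero]
  refine HilbSum.ext ?_ ?_
  · rw [fst_dilationProj, fst_dilation, fst_dilation, fst_dilationProj, hE']
  · rw [snd_dilationProj, fst_dilation, snd_dilation, snd_dilation, fst_dilationProj,
      snd_dilationProj]
    exact liftingOutput_dilation hA hE hγ hσ i x.fst x.snd

lemma dilationProj_inlOp (hA : ‖rowOp A‖ ≤ 1) (h : H) :
    dilationProj hA γ σ (inlOp (HilbSum H K) (Fock d (rowDefect E)) (inlOp H K h))
      = inlOp H (Fock d (rowDefect C)) h :=
  HilbSum.ext rfl (map_zero (liftingOutput hA γ σ))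

/-- The characteristic function of the lifting `E` is `[D_{*,γ}, γ M_A] σ_E`. -/
theorem isLiftingCharFun_iff (hC : ‖rowOp C‖ ≤ 1) (hA : ‖rowOp A‖ ≤ 1) (hE : E = liftRow C B A)
    (hE₁ : ‖rowOp E‖ ≤ 1) (hγ : IsLiftingContraction C B A γ)
    (hσ : ∀ x, σ (toDefect (rowOp E) x) = sigmaOp C A hA γ x)
    (M : Fock d (rowDefect E) →L[ℂ] Fock d (rowDefect C)) :
    IsLiftingCharFun C E M ↔ ∀ x, M x = liftingOutput hA γ σ (HilbSum.mk 0 x) := by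
  have hN := norm_dilationProj_le (σ := σ) hA hγ.1
  have hNV := dilationProj_dilation hA hE hγ hσ
  have hkj : ∀ h : H, ‖inlOp (HilbSum H K) (Fock d (rowDefect E)) (inlOp H K h)‖
      = ‖inlOp H (Fock d (rowDefect C)) h‖ := fun h => by
    rw [norm_inlOp, norm_inlOp, norm_inlOp]
  constructor
  · rintro ⟨L, Y, W, hW, hMW⟩ x
    obtain ⟨h₁, h₂, -⟩ := adjoint_intertwining hN hNV (norm_dilation hE₁) (norm_dilation hC)
      (dilationProj_inlOp hA) hkj isGenerating_dilation
    exact (hMW x).trans (congrArg HilbSum.snd (fst_unitary_eq hW.map_base hW.intertwines h₁ h₂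
      isGenerating_dilation (inrOp _ _ x)))
  · intro hM
    obtain ⟨L, Y, W, h₁, h₂, h₃, h₄, h₅⟩ := exists_intertwining_unitary hN hNV
      (norm_dilation hE₁) (norm_dilation hC) (dilationProj_inlOp hA) hkj isGenerating_dilation
    exact ⟨L, Y, W, ⟨h₁, h₂, h₃, h₄⟩, fun x => (hM x).trans
      (congrArg HilbSum.snd (h₅ (inrOp _ _ x)).symm)⟩

theorem existsUnique_isLiftingCharFun (hC : ‖rowOp C‖ ≤ 1)
    (hE : ‖rowOp (liftRow C B A)‖ ≤ 1) : ∃! M, IsLiftingCharFun C (liftRow C B A) M := by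
  have hA := norm_rowOp_right_of_liftRow hE
  obtain ⟨γ, hγ, -⟩ := existsUnique_isLiftingContraction hC hE
  obtain ⟨σ, hσ, -⟩ := existsUnique_isSigma hC hE hγ
  have h := isLiftingCharFun_iff hC hA rfl hE hγ ((isSigma_iff hA).1 hσ)
  refine ⟨liftingOutput hA γ σ ∘L inrOp _ _, (h _).2 fun x => rfl, fun M hM => ?_⟩
  exact ContinuousLinearMap.ext fun x => (h M).1 hM x

end Lifting

/-! ### Restrictions of a contraction to its defect spaces -/

section DefectIdentities

variable {X Y : Type*} [NormedAddCommGroup X] [InnerProductSpace ℂ X] [CompleteSpace X]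
  [NormedAddCommGroup Y] [InnerProductSpace ℂ Y] [CompleteSpace Y] {T : X →L[ℂ] Y}

lemma codefectRestrict_toDefect (hT : ‖T‖ ≤ 1) (y : Y) :
    codefectRestrict T hT (toDefect (T†) y) = toDefect T ((T†) y) :=
  Subtype.ext (adjoint_apply_defect hT y)

lemma defectRestrict_toDefect (hT : ‖T‖ ≤ 1) (x : X) :
    defectRestrict T hT (toDefect T x) = toDefect (T†) (T x) :=
  Subtype.ext (apply_defect hT x)

lemma adjoint_codefectRestrict (hT : ‖T‖ ≤ 1) (x : defectSpace T) :
    ((codefectRestrict T hT)†) x = defectRestrict T hT x := by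
  refine ext_inner_left ℂ fun y => ?_
  refine (ContinuousLinearMap.adjoint_inner_right (codefectRestrict T hT) y x).trans ?_
  rw [Submodule.coe_inner, Submodule.coe_inner]
  exact ContinuousLinearMap.adjoint_inner_left T (x : X) (y : Y)

lemma defect_toDefect_sub (hT : ‖T‖ ≤ 1) (x : X) (y : Y) :
    defect (T†) (toDefect (T†) y : Y) - T (x - (T†) y) = y - T x := by
  rw [coe_toDefect, defect_adjoint_defect_adjoint hT, map_sub]
  abel

lemma toDefect_sub_add (hT : ‖T‖ ≤ 1) (x : X) (y : Y) :
    toDefect T (x - (T†) y) + codefectRestrict T hT (toDefect (T†) y) = toDefect T x := by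
  rw [codefectRestrict_toDefect hT, ← map_add, sub_add_cancel]

lemma defectRestrict_toDefect_sub (hT : ‖T‖ ≤ 1) (g : defectSpace (T†)) (x : X) :
    defectRestrict T hT (toDefect T x - codefectRestrict T hT g)
      = toDefect (T†) (defect (T†) g + T x) - g := by
  refine Subtype.ext ?_
  change T (defect T x - (T†) g) = defect (T†) (defect (T†) g + T x) - g
  rw [map_add, map_sub, defect_adjoint_defect_adjoint hT, apply_defect hT]
  abel

/-- The adjoint of a triangular operator matrix, evaluated at a vector. -/
lemma eq_adjoint_apply_of_inner_eq {P Q U V W : Type*}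
    [NormedAddCommGroup P] [InnerProductSpace ℂ P] [CompleteSpace P]
    [NormedAddCommGroup Q] [InnerProductSpace ℂ Q] [CompleteSpace Q]
    [NormedAddCommGroup U] [InnerProductSpace ℂ U] [CompleteSpace U]
    [NormedAddCommGroup V] [InnerProductSpace ℂ V] [CompleteSpace V]
    [NormedAddCommGroup W] [InnerProductSpace ℂ W] [CompleteSpace W]
    {D : P →L[ℂ] X} {S : X →L[ℂ] U} {R : Q →L[ℂ] V} {G : X →L[ℂ] W} {F : W →L[ℂ] V}
    {a : P} {b : Q} {u : U} {v : V}
    (h : ∀ p q, inner ℂ p a + inner ℂ q b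
      = inner ℂ (S (D p)) u + inner ℂ (R q - F (G (D p))) v) :
    a = (D†) ((S†) u - (G†) ((F†) v)) ∧ b = (R†) v := by
  constructor
  · refine ext_inner_left ℂ fun p => ?_
    have h₁ := h p 0
    rw [inner_zero_left, add_zero, map_zero, zero_sub, inner_neg_left] at h₁
    rw [h₁]
    simp only [ContinuousLinearMap.adjoint_inner_right, inner_sub_right]
    exact (sub_eq_add_neg _ _).symm
  · refine ext_inner_left ℂ fun q => ?_
    have h₁ := h 0 q
    rw [inner_zero_left, zero_add] at h₁
    simp only [map_zero, inner_zero_left, zero_add, sub_zero] at h₁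
    rw [h₁, ContinuousLinearMap.adjoint_inner_right]

end DefectIdentities

/-! ### The characteristic function of the lifted row itself -/

section Cascade

variable {d : ℕ} {H K : Type*} [NormedAddCommGroup H] [InnerProductSpace ℂ H] [CompleteSpace H]
  [NormedAddCommGroup K] [InnerProductSpace ℂ K] [CompleteSpace K]
  {C : Fin d → H →L[ℂ] H} {B : Fin d → H →L[ℂ] K} {A : Fin d → K →L[ℂ] K}
  {E : Fin d → HilbSum H K →L[ℂ] HilbSum H K}
  {γ : rowCodefect A →L[ℂ] rowDefect C}
  {σ : rowDefect E ≃ₗᵢ[ℂ] HilbSum (defectSpace (γ†)) (rowDefect A)}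
  {σ' : rowCodefect E ≃ₗᵢ[ℂ] HilbSum (rowCodefect C) (defectSpace γ)}

/-- The operator `D_E` on `𝓓_E` is the adjoint of `D_E : (H ⊕ K)^d → 𝓓_E`, so that in the
coordinates given by `σ_E` it is the adjoint of the operator matrix defining `σ_E`. -/
lemma inner_defect_eq_inner_sigmaOp (hA : ‖rowOp A‖ ≤ 1)
    (hσ : ∀ x, σ (toDefect (rowOp E) x) = sigmaOp C A hA γ x)
    (x : HilbPow d (HilbSum H K)) (e : rowDefect E) :
    inner ℂ x (defect (rowOp E) e) = inner ℂ (sigmaOp C A hA γ x) (σ e) :=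
  (inner_defect_left (rowOp E) x e).symm.trans
    ((σ.inner_map_map (toDefect (rowOp E) x) e).symm.trans
      (congrArg (fun y => inner ℂ y (σ e)) (hσ x)))

lemma powFst_defect_and_powSnd_defect (hA : ‖rowOp A‖ ≤ 1)
    (hσ : ∀ x, σ (toDefect (rowOp E) x) = sigmaOp C A hA γ x) (e : rowDefect E) :
    powFst (defect (rowOp E) e) = ((toDefect (rowOp C))†)
        (((toDefect (γ†))†) (fstUnitary σ e)
          - ((γ†)†) (((codefectRestrict (rowOp A) hA)†) (sndUnitary σ e)))
      ∧ powSnd (defect (rowOp E) e) = ((toDefect (rowOp A))†) (sndUnitary σ e) := by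
  refine eq_adjoint_apply_of_inner_eq fun p q => ?_
  exact (inner_eq_powFst_add_powSnd (powMk p q) _).symm.trans
    ((inner_defect_eq_inner_sigmaOp hA hσ (powMk p q) e).trans (HilbSum.inner_def _ _))

lemma powSnd_defect (hA : ‖rowOp A‖ ≤ 1)
    (hσ : ∀ x, σ (toDefect (rowOp E) x) = sigmaOp C A hA γ x) (e : rowDefect E) :
    powSnd (defect (rowOp E) e) = defect (rowOp A) (sndUnitary σ e : rowDefect A) :=
  (powFst_defect_and_powSnd_defect hA hσ e).2.trans
    (adjoint_toDefect (rowOp A) (sndUnitary σ e))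

lemma powFst_defect (hA : ‖rowOp A‖ ≤ 1)
    (hσ : ∀ x, σ (toDefect (rowOp E) x) = sigmaOp C A hA γ x) (e : rowDefect E) :
    powFst (defect (rowOp E) e) = defect (rowOp C) ((defect (γ†) (fstUnitary σ e : rowDefect C)
      - γ (defectRestrict (rowOp A) hA (sndUnitary σ e)) : rowDefect C) : HilbPow d H) := by
  have h₁ := adjoint_toDefect (γ†) (fstUnitary σ e)
  have h₂ := adjoint_codefectRestrict hA (sndUnitary σ e)
  have h₃ : ((γ†)†) (((codefectRestrict (rowOp A) hA)†) (sndUnitary σ e))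
      = γ (defectRestrict (rowOp A) hA (sndUnitary σ e)) :=
    (DFunLike.congr_fun (ContinuousLinearMap.adjoint_adjoint γ) _).trans (congrArg γ h₂)
  exact (powFst_defect_and_powSnd_defect hA hσ e).1.trans
    ((congrArg ((toDefect (rowOp C))†) (congrArg₂ (· - ·) h₁ h₃)).trans
      (adjoint_toDefect (rowOp C) _))

/-- The operator `(u, k) ↦ (C (D_{*,γ} u - γ k), D_γ k + γ* u)`, by which the restriction of the
row `E` to `𝓓_E` acts in the coordinates given by `σ_E` and `σ'_E`. -/
def restrictInCoordinates (hC : ‖rowOp C‖ ≤ 1) (hγ : ‖γ‖ ≤ 1) :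
    HilbSum (defectSpace (γ†)) (rowCodefect A) →L[ℂ] HilbSum (rowCodefect C) (defectSpace γ) :=
  colBlock
    (defectRestrict (rowOp C) hC ∘L
      rowBlock (defect (γ†) ∘L (defectSpace (γ†)).subtypeL) (-γ))
    (rowBlock (codefectRestrict γ hγ) (toDefect γ))

lemma restrictInCoordinates_mk (hC : ‖rowOp C‖ ≤ 1) (hγ : ‖γ‖ ≤ 1) (u : defectSpace (γ†))
    (k : rowCodefect A) : restrictInCoordinates hC hγ (HilbSum.mk u k)
      = HilbSum.mk (defectRestrict (rowOp C) hC (defect (γ†) (u : rowDefect C) - γ k))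
        (toDefect γ k + codefectRestrict γ hγ u) :=
  HilbSum.ext (congrArg (defectRestrict (rowOp C) hC) (sub_eq_add_neg _ _).symm)
    (add_comm _ _)

/-- The restriction of the row `E` to `𝓓_E`, in the coordinates given by `σ_E` and `σ'_E`. -/
lemma sigma'_defectRestrict (hC : ‖rowOp C‖ ≤ 1) (hA : ‖rowOp A‖ ≤ 1) (hE : E = liftRow C B A)
    (hE₁ : ‖rowOp E‖ ≤ 1) (hγ : IsLiftingContraction C B A γ)
    (hσ : ∀ x, σ (toDefect (rowOp E) x) = sigmaOp C A hA γ x)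
    (hσ' : ∀ x, σ' (toDefect ((rowOp E)†) x) = sigmaOp' C A hC γ x) (e : rowDefect E) :
    σ' (defectRestrict (rowOp E) hE₁ e) = restrictInCoordinates hC hγ.1
      (HilbSum.mk (fstUnitary σ e) (defectRestrict (rowOp A) hA (sndUnitary σ e))) := by
  let F : rowDefect E →L[ℂ] HilbSum (rowCodefect C) (defectSpace γ) :=
    restrictInCoordinates hC hγ.1 ∘L
      colBlock (fstUnitary σ) (defectRestrict (rowOp A) hA ∘L sndUnitary σ)
  let G : rowDefect E →L[ℂ] HilbSum (rowCodefect C) (defectSpace γ) :=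
    σ'.toLinearIsometry.toContinuousLinearMap ∘L defectRestrict (rowOp E) hE₁
  have key : G = F := by
    refine ContinuousLinearMap.ext_of_denseRange (denseRange_toDefect (rowOp E)) fun p => ?_
    have hu : fstUnitary σ (toDefect (rowOp E) p) = toDefect (γ†) (toDefect (rowOp C) (powFst p)) :=
      (congrArg HilbSum.fst (hσ p)).trans (fst_sigmaOp hA γ p)
    have hv : sndUnitary σ (toDefect (rowOp E) p) = toDefect (rowOp A) (powSnd p)
        - codefectRestrict (rowOp A) hA ((γ†) (toDefect (rowOp C) (powFst p))) :=
      congrArg HilbSum.snd (hσ p)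
    have hsnd : defect ((rowOp A)†) ((γ†) (toDefect (rowOp C) (powFst p)) : rowCodefect A)
        + rowOp A (powSnd p) = (rowOp E p).snd := by
      rw [← hγ.rowOp_eq, hE, snd_rowOp_liftRow]
    have hfst : rowOp C (powFst p) = (rowOp E p).fst := by
      rw [hE, fst_rowOp_liftRow]
    have hAv : defectRestrict (rowOp A) hA (sndUnitary σ (toDefect (rowOp E) p))
        = toDefect ((rowOp A)†) (rowOp E p).snd - (γ†) (toDefect (rowOp C) (powFst p)) :=
      (congrArg (defectRestrict (rowOp A) hA) hv).trans
        ((defectRestrict_toDefect_sub hA _ _).trans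
          (congrArg (fun k => toDefect ((rowOp A)†) k
            - (γ†) (toDefect (rowOp C) (powFst p))) hsnd))
    have hG : G (toDefect (rowOp E) p) = sigmaOp' C A hC γ (rowOp E p) :=
      (congrArg σ' (defectRestrict_toDefect hE₁ p)).trans (hσ' _)
    have hF : F (toDefect (rowOp E) p) = restrictInCoordinates hC hγ.1
        (HilbSum.mk (toDefect (γ†) (toDefect (rowOp C) (powFst p)))
          (toDefect ((rowOp A)†) (rowOp E p).snd - (γ†) (toDefect (rowOp C) (powFst p)))) :=
      congrArg (restrictInCoordinates hC hγ.1) (congrArg₂ HilbSum.mk hu hAv)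
    refine hG.trans (Eq.trans ?_ (hF.trans (restrictInCoordinates_mk hC hγ.1 _ _)).symm)
    have h₁ : defectRestrict (rowOp C) hC (toDefect (rowOp C) (powFst p)
          - γ (toDefect ((rowOp A)†) (rowOp E p).snd))
        = toDefect ((rowOp C)†) (rowOp E p).fst
          - defectRestrict (rowOp C) hC (γ (toDefect ((rowOp A)†) (rowOp E p).snd)) :=
      (map_sub (defectRestrict (rowOp C) hC) _ _).trans (congrArg (fun k => k
          - defectRestrict (rowOp C) hC (γ (toDefect ((rowOp A)†) (rowOp E p).snd)))
        ((defectRestrict_toDefect hC (powFst p)).trans (congrArg (toDefect ((rowOp C)†)) hfst)))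
    refine HilbSum.ext ?_ ?_
    · exact (sub_eq_add_neg _ _).symm.trans (h₁.symm.trans
        (congrArg (defectRestrict (rowOp C) hC) (defect_toDefect_sub hγ.1 _ _).symm))
    · exact (zero_add _).trans (toDefect_sub_add hγ.1 _ _).symm
  exact DFunLike.congr_fun key e

lemma coeff_rowCharFun (hA : ‖rowOp A‖ ≤ 1) (x : Fock d (rowDefect A)) (α : List (Fin d)) :
    Fock.coeff α (rowCharFun A hA x) = toDefect ((rowOp A)†)
        (state A 0 (fun β => ((Fock.coeff β x : rowDefect A) : HilbPow d K)) α)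
      - defectRestrict (rowOp A) hA (Fock.coeff α x) := rfl

lemma coeff_drivenOutput_mk_zero {U X Z : Type*} [NormedAddCommGroup U] [InnerProductSpace ℂ U]
    [NormedAddCommGroup X] [InnerProductSpace ℂ X] [NormedAddCommGroup Z] [InnerProductSpace ℂ Z]
    (hA : ‖rowOp A‖ ≤ 1) (R : HilbSum U (rowCodefect A) →L[ℂ] Z)
    (τ : X ≃ₗᵢ[ℂ] HilbSum U (rowDefect A)) (x : Fock d X) (α : List (Fin d)) :
    Fock.coeff α (drivenOutput hA R τ (HilbSum.mk 0 x)) = R (HilbSum.mk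
      (fstUnitary τ (Fock.coeff α x)) (Fock.coeff α (rowCharFun A hA (amp (sndUnitary τ) x)))) := by
  have h : systemInput τ (HilbSum.mk (0 : K) x) = inrOp _ _ (amp (sndUnitary τ) x) := by
    rw [systemInput]
    refine HilbSum.ext ?_ ?_
    · rw [fst_diagOp, fst_inrOp, HilbSum.fst_mk, map_zero]
    · rw [snd_diagOp, snd_inrOp, HilbSum.snd_mk]
  rw [coeff_drivenOutput, h]
  rfl

lemma liftingOutput_mk_zero_coeff (hA : ‖rowOp A‖ ≤ 1) (x : Fock d (rowDefect E))
    (α : List (Fin d)) : Fock.coeff α (liftingOutput hA γ σ (HilbSum.mk 0 x))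
      = defect (γ†) (fstUnitary σ (Fock.coeff α x) : rowDefect C)
        + γ (Fock.coeff α (rowCharFun A hA (amp (sndUnitary σ) x))) :=
  coeff_drivenOutput_mk_zero hA (defectRow γ) σ x α

lemma add_map_sub {X Y : Type*} [NormedAddCommGroup X] [InnerProductSpace ℂ X]
    [NormedAddCommGroup Y] [InnerProductSpace ℂ Y] (T : X →L[ℂ] Y) (y : Y) (a b : X) :
    y + T (a - b) = T a + (y - T b) := by
  rw [map_sub]
  abel

/-- The states of the system of the lifting `E` form a cascade: the second components are the
states of the system of `A`, and the output of this system, fed through `[D_{*,γ}, γ]`, drives the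
system of `C`, whose states are the first components. -/
lemma state_liftRow (hA : ‖rowOp A‖ ≤ 1) (hE : E = liftRow C B A)
    (hγ : IsLiftingContraction C B A γ)
    (hσ : ∀ x, σ (toDefect (rowOp E) x) = sigmaOp C A hA γ x)
    (x : Fock d (rowDefect E)) (α : List (Fin d)) :
    state E 0 (fun β => ((Fock.coeff β x : rowDefect E) : HilbPow d (HilbSum H K))) α
      = HilbSum.mk
        (state C 0 (fun β => ((Fock.coeff β (liftingOutput hA γ σ (HilbSum.mk 0 x)) :
          rowDefect C) : HilbPow d H)) α)
        (state A 0 (fun β => ((Fock.coeff β (amp (sndUnitary σ) x) : rowDefect A) :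
          HilbPow d K)) α) := by
  have hx : ∀ α, Fock.coeff α (liftingOutput hA γ σ (HilbSum.mk 0 x))
      = γ (toDefect ((rowOp A)†) (state A 0 (fun β =>
          ((Fock.coeff β (amp (sndUnitary σ) x) : rowDefect A) : HilbPow d K)) α))
        + (defect (γ†) (fstUnitary σ (Fock.coeff α x) : rowDefect C)
          - γ (defectRestrict (rowOp A) hA (sndUnitary σ (Fock.coeff α x)))) := fun α =>
    (liftingOutput_mk_zero_coeff hA x α).trans (add_map_sub γ _ _ _)
  have hsnd : ∀ α, (state E 0 (fun β => ((Fock.coeff β x : rowDefect E) :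
      HilbPow d (HilbSum H K))) α).snd = state A 0 (fun β =>
        ((Fock.coeff β (amp (sndUnitary σ) x) : rowDefect A) : HilbPow d K)) α := by
    refine eq_state rfl fun α i => ?_
    generalize hf : state E 0 (fun β => ((Fock.coeff β x : rowDefect E) :
      HilbPow d (HilbSum H K))) = f
    have h₁ := snd_adjoint_rowOp_liftRow (C := C) (B := B) (A := A) (f α)
    rw [← hE] at h₁
    have h₂ : f (α ++ [i]) = (((rowOp E)†) (f α)
        + defect (rowOp E) ((Fock.coeff α x : rowDefect E) : HilbPow d (HilbSum H K))) i := by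
      rw [← hf]
      exact state_append _ _ _ _ _
    exact (congrArg HilbSum.snd h₂).trans (congrArg (fun q : HilbPow d K => q i)
      (congrArg₂ (· + ·) h₁ (powSnd_defect hA hσ (Fock.coeff α x))))
  refine HilbSum.ext (eq_state (f := fun α => (state E 0 (fun β =>
    ((Fock.coeff β x : rowDefect E) : HilbPow d (HilbSum H K))) α).fst) rfl
    (fun α i => ?_) α) (hsnd α)
  have h₂ := state_append E 0 (fun β => ((Fock.coeff β x : rowDefect E) :
    HilbPow d (HilbSum H K))) α i
  have h₃ := hsnd α
  generalize state E 0 (fun β => ((Fock.coeff β x : rowDefect E) : HilbPow d (HilbSum H K))) = f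
    at h₂ h₃ ⊢
  have h₁ := fst_adjoint_rowOp_liftRow (C := C) (B := B) (A := A) (f α)
  rw [← hE, hγ.adjoint_rowOp_eq, h₃] at h₁
  have h₅ := (congrArg (fun c : rowDefect C => defect (rowOp C) (c : HilbPow d H)) (hx α)).trans
    (map_add (defect (rowOp C)) _ _)
  refine (congrArg HilbSum.fst h₂).trans (congrArg (fun q : HilbPow d H => q i)
    (a₁ := powFst (((rowOp E)†) (f α)) + powFst (defect (rowOp E) ((Fock.coeff α x : rowDefect E) :
      HilbPow d (HilbSum H K)))) ?_)
  exact (congrArg₂ (· + ·) h₁ (powFst_defect hA hσ (Fock.coeff α x))).trans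
    ((add_assoc _ _ _).trans (congrArg (fun q : HilbPow d H => ((rowOp C)†) (f α).fst + q)
      h₅.symm))

lemma first_component_eq {X Y Z : Type*} [NormedAddCommGroup X] [InnerProductSpace ℂ X]
    [NormedAddCommGroup Y] [InnerProductSpace ℂ Y] [NormedAddCommGroup Z] [InnerProductSpace ℂ Z]
    (T : Y →L[ℂ] Z) (S : X →L[ℂ] Y) (z : Z) (y : Y) (a b : X) :
    z + -T (S a) - T (y - S b) = z - T (y + S (a - b)) := by
  simp only [map_add, map_sub]
  abel

lemma second_component_eq {X Y : Type*} [NormedAddCommGroup X] [InnerProductSpace ℂ X]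
    [NormedAddCommGroup Y] [InnerProductSpace ℂ Y] (T : X →L[ℂ] Y) (y : Y) (a b : X) :
    0 + T a - (T b + y) = T (a - b) - y := by
  rw [map_sub]
  abel

/-- The characteristic function of the lifting `E`, regarded as a row contraction, is in the
coordinates given by `σ_E` and `σ'_E` the product of `diag(M_C, I)`, the Julia–Halmos operator of
`γ` and `diag(I, M_A)`. -/
theorem sigma'_rowCharFun (hC : ‖rowOp C‖ ≤ 1) (hA : ‖rowOp A‖ ≤ 1) (hE : E = liftRow C B A)
    (hE₁ : ‖rowOp E‖ ≤ 1) (hγ : IsLiftingContraction C B A γ)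
    (hσ : ∀ x, σ (toDefect (rowOp E) x) = sigmaOp C A hA γ x)
    (hσ' : ∀ x, σ' (toDefect ((rowOp E)†) x) = sigmaOp' C A hC γ x)
    (x : Fock d (rowDefect E)) (α : List (Fin d)) :
    σ' (Fock.coeff α (rowCharFun E hE₁ x)) = HilbSum.mk
      (Fock.coeff α (rowCharFun C hC (liftingOutput hA γ σ (HilbSum.mk 0 x))))
      (toDefect γ (Fock.coeff α (rowCharFun A hA (amp (sndUnitary σ) x)))
        - codefectRestrict γ hγ.1 (fstUnitary σ (Fock.coeff α x))) := by
  have h₀ : σ' (Fock.coeff α (rowCharFun E hE₁ x))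
      = σ' (toDefect ((rowOp E)†) (state E 0 (fun β => ((Fock.coeff β x : rowDefect E) :
          HilbPow d (HilbSum H K))) α)) - σ' (defectRestrict (rowOp E) hE₁ (Fock.coeff α x)) :=
    map_sub σ' _ _
  have h₁ := (hσ' _).trans (congrArg (sigmaOp' C A hC γ) (state_liftRow hA hE hγ hσ x α))
  have h₂ := (sigma'_defectRestrict hC hA hE hE₁ hγ hσ hσ' (Fock.coeff α x)).trans
    (restrictInCoordinates_mk hC hγ.1 _ _)
  have h₃ := h₀.trans (congrArg₂ (· - ·) h₁ h₂)
  have h₄ := liftingOutput_mk_zero_coeff (γ := γ) (σ := σ) hA x α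
  have h₅ := coeff_rowCharFun hC (liftingOutput hA γ σ (HilbSum.mk 0 x)) α
  refine h₃.trans (HilbSum.ext ?_ ?_)
  · exact (first_component_eq (defectRestrict (rowOp C) hC) γ _ _ _ _).trans
      ((congrArg (fun z => _ - defectRestrict (rowOp C) hC z) h₄.symm).trans h₅.symm)
  · exact second_component_eq (toDefect γ) _ _ _

end Cascade

/-! ### Operator matrices on the Fock space -/

section FockMatrices

variable {d : ℕ} {U V W X Y Z U' V' U'' V'' : Type*}
  [NormedAddCommGroup U] [InnerProductSpace ℂ U] [NormedAddCommGroup V] [InnerProductSpace ℂ V]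
  [NormedAddCommGroup W] [InnerProductSpace ℂ W] [NormedAddCommGroup X] [InnerProductSpace ℂ X]
  [NormedAddCommGroup Y] [InnerProductSpace ℂ Y] [NormedAddCommGroup Z] [InnerProductSpace ℂ Z]
  [NormedAddCommGroup U'] [InnerProductSpace ℂ U'] [NormedAddCommGroup V'] [InnerProductSpace ℂ V']
  [NormedAddCommGroup U''] [InnerProductSpace ℂ U'']
  [NormedAddCommGroup V''] [InnerProductSpace ℂ V'']

lemma amp_diagOp (S : U →L[ℂ] U') (T : V →L[ℂ] V') :
    amp (d := d) (diagOp S T) = fockDiag (amp S) (amp T) := by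
  refine ContinuousLinearMap.ext fun x => Fock.ext fun α => ?_
  rw [Fock.coeff_fockDiag, Fock.coeff_amp]
  exact HilbSum.ext (fst_diagOp _ _ _) (snd_diagOp _ _ _)

lemma amp_fstL_fockDiag (S : Fock d U →L[ℂ] Fock d U') (T : Fock d V →L[ℂ] Fock d V')
    (x : Fock d (HilbSum U V)) :
    amp (HilbSum.fstL U' V') (fockDiag S T x) = S (amp (HilbSum.fstL U V) x) := by
  refine Fock.ext fun α => ?_
  rw [Fock.coeff_amp, Fock.coeff_fockDiag]
  rfl

lemma amp_sndL_fockDiag (S : Fock d U →L[ℂ] Fock d U') (T : Fock d V →L[ℂ] Fock d V')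
    (x : Fock d (HilbSum U V)) :
    amp (HilbSum.sndL U' V') (fockDiag S T x) = T (amp (HilbSum.sndL U V) x) := by
  refine Fock.ext fun α => ?_
  rw [Fock.coeff_amp, Fock.coeff_fockDiag]
  rfl

lemma fockDiag_comp_fockDiag (S' : Fock d U' →L[ℂ] Fock d U'') (T' : Fock d V' →L[ℂ] Fock d V'')
    (S : Fock d U →L[ℂ] Fock d U') (T : Fock d V →L[ℂ] Fock d V') :
    fockDiag S' T' ∘L fockDiag S T = fockDiag (S' ∘L S) (T' ∘L T) := by
  refine ContinuousLinearMap.ext fun x => Fock.ext fun α => ?_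
  rw [ContinuousLinearMap.comp_apply, Fock.coeff_fockDiag, Fock.coeff_fockDiag, amp_fstL_fockDiag,
    amp_sndL_fockDiag]
  rfl

/-- A factorization in the second component gives a factorization of the diagonal operators. -/
lemma fockDiag_factorization {U₁ V₁ V₂ V₃ V₄ V₅ : Type*}
    [NormedAddCommGroup U₁] [InnerProductSpace ℂ U₁]
    [NormedAddCommGroup V₁] [InnerProductSpace ℂ V₁]
    [NormedAddCommGroup V₂] [InnerProductSpace ℂ V₂]
    [NormedAddCommGroup V₃] [InnerProductSpace ℂ V₃]
    [NormedAddCommGroup V₄] [InnerProductSpace ℂ V₄]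
    [NormedAddCommGroup V₅] [InnerProductSpace ℂ V₅]
    {s : U →L[ℂ] U₁} {a : V₅ →L[ℂ] V₄} {N : Fock d V →L[ℂ] Fock d V₅}
    {F : Fock d V₃ →L[ℂ] Fock d V₄} {b : V₂ →L[ℂ] V₃} {G : Fock d V₁ →L[ℂ] Fock d V₂}
    {c : V →L[ℂ] V₁} (h : amp a ∘L N = F ∘L amp b ∘L G ∘L amp c)
    (T : Fock d X →L[ℂ] Fock d (HilbSum U V)) :
    amp (diagOp (.id ℂ U₁) a) ∘L fockDiag (amp s) N ∘L T
      = fockDiag (.id ℂ (Fock d U₁)) F ∘L amp (diagOp (.id ℂ U₁) b)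
        ∘L fockDiag (.id ℂ (Fock d U₁)) G ∘L amp (diagOp s c) ∘L T := by
  have h₁ : amp (diagOp (.id ℂ U₁) a) ∘L fockDiag (amp s) N
      = fockDiag (.id ℂ (Fock d U₁)) F ∘L amp (diagOp (.id ℂ U₁) b)
        ∘L fockDiag (.id ℂ (Fock d U₁)) G ∘L amp (diagOp s c) := by
    simp only [amp_diagOp, fockDiag_comp_fockDiag, h]
    rfl
  simp only [← ContinuousLinearMap.comp_assoc] at h₁ ⊢
  rw [h₁]

/-- The coefficients of `[D, g] diag(I, e⁻¹) diag(s, e N) τ`, where the unitary `e` cancels. -/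
lemma coeff_amp_rowBlock_fockDiag (D : Y →L[ℂ] Z) (g : W →L[ℂ] Z) (s : U →L[ℂ] Y)
    (N : Fock d V →L[ℂ] Fock d W) (e : W ≃ₗᵢ[ℂ] V') (τ : X →L[ℂ] HilbSum U V)
    (x : Fock d X) (α : List (Fin d)) :
    Fock.coeff α (amp (rowBlock D g) (amp (diagOp (.id ℂ Y)
        e.symm.toLinearIsometry.toContinuousLinearMap)
      (fockDiag (amp s) (amp e.toLinearIsometry.toContinuousLinearMap ∘L N) (amp τ x))))
      = D (s (τ (Fock.coeff α x)).fst)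
        + g (Fock.coeff α (N (amp (HilbSum.sndL U V ∘L τ) x))) := by
  rw [Fock.coeff_amp, Fock.coeff_amp, Fock.coeff_fockDiag, rowBlock_apply, fst_diagOp, snd_diagOp]
  exact congrArg (fun w => D (s (τ (Fock.coeff α x)).fst) + g w) (e.symm_apply_apply _)

variable [CompleteSpace W] [CompleteSpace Y]

/-- The coefficients of `diag(M, I) J_γ diag(I, N) diag(s, I) τ`, where `J_γ` is the Julia–Halmos
operator of `γ`, and `y` is the vector to which `M` is applied. -/
lemma coeff_fockDiag_julia (γ : W →L[ℂ] Y) (M : Fock d Y →L[ℂ] Fock d Z)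
    (N : Fock d V →L[ℂ] Fock d W) (s : U →L[ℂ] Y) (τ : X →L[ℂ] HilbSum U V)
    {x : Fock d X} {y : Fock d Y}
    (hy : ∀ α, Fock.coeff α y = defect (γ†) (s (τ (Fock.coeff α x)).fst)
      + γ (Fock.coeff α (N (amp (HilbSum.sndL U V ∘L τ) x)))) (α : List (Fin d)) :
    Fock.coeff α (fockDiag M (.id ℂ (Fock d W)) (amp (julia γ)
        (fockDiag (.id ℂ (Fock d Y)) N (amp (diagOp s (.id ℂ V) ∘L τ) x))))
      = HilbSum.mk (Fock.coeff α (M y))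
        (defect γ (Fock.coeff α (N (amp (HilbSum.sndL U V ∘L τ) x)))
          - (γ†) (s (τ (Fock.coeff α x)).fst)) := by
  have h : ∀ β, Fock.coeff β (fockDiag (.id ℂ (Fock d Y)) N (amp (diagOp s (.id ℂ V) ∘L τ) x))
      = HilbSum.mk (s (τ (Fock.coeff β x)).fst)
        (Fock.coeff β (N (amp (HilbSum.sndL U V ∘L τ) x))) := by
    intro β
    have h₁ : amp (HilbSum.sndL Y V) (amp (diagOp s (.id ℂ V) ∘L τ) x)
        = amp (HilbSum.sndL U V ∘L τ) x :=
      Fock.ext fun β => snd_diagOp s (.id ℂ V) _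
    rw [Fock.coeff_fockDiag, h₁]
    exact congrArg (fun z => HilbSum.mk z _) (fst_diagOp s (.id ℂ V) _)
  have h₁ : amp (HilbSum.fstL Y W) (amp (julia γ)
      (fockDiag (.id ℂ (Fock d Y)) N (amp (diagOp s (.id ℂ V) ∘L τ) x))) = y := by
    refine Fock.ext fun β => ?_
    rw [Fock.coeff_amp, Fock.coeff_amp, h, hy]
    rfl
  have h₂ : Fock.coeff α (amp (HilbSum.sndL Y W) (amp (julia γ)
      (fockDiag (.id ℂ (Fock d Y)) N (amp (diagOp s (.id ℂ V) ∘L τ) x))))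
        = defect γ (Fock.coeff α (N (amp (HilbSum.sndL U V ∘L τ) x)))
          - (γ†) (s (τ (Fock.coeff α x)).fst) := by
    rw [Fock.coeff_amp, Fock.coeff_amp, h, julia, HilbSum.sndL_apply, snd_blockOp]
    exact neg_add_eq_sub _ _
  rw [Fock.coeff_fockDiag, h₁, ContinuousLinearMap.id_apply, h₂]

end FockMatrices

/-! ### Factorization for two-step liftings -/

section Factorization

variable {d : ℕ} {H K : Type*} [NormedAddCommGroup H] [InnerProductSpace ℂ H] [CompleteSpace H]
  [NormedAddCommGroup K] [InnerProductSpace ℂ K] [CompleteSpace K]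
  {C : Fin d → H →L[ℂ] H} {B : Fin d → H →L[ℂ] K} {A : Fin d → K →L[ℂ] K}
  {E : Fin d → HilbSum H K →L[ℂ] HilbSum H K}
  {γ : rowCodefect A →L[ℂ] rowDefect C}
  {σ : rowDefect E ≃ₗᵢ[ℂ] HilbSum (defectSpace (γ†)) (rowDefect A)}
  {σ' : rowCodefect E ≃ₗᵢ[ℂ] HilbSum (rowCodefect C) (defectSpace γ)}

/-- The factorization `σ'_E M_E = diag(M_C, I) J_γ diag(I, M_A) σ_E` of the characteristic
function of a contractive lifting `E` of `C` by `A`, where `J_γ` is the Julia–Halmos operator. -/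
theorem amp_sigma'_comp_rowCharFun (hC : ‖rowOp C‖ ≤ 1) (hA : ‖rowOp A‖ ≤ 1)
    (hE : E = liftRow C B A) (hE₁ : ‖rowOp E‖ ≤ 1) (hγ : IsLiftingContraction C B A γ)
    (hσ : ∀ x, σ (toDefect (rowOp E) x) = sigmaOp C A hA γ x)
    (hσ' : ∀ x, σ' (toDefect ((rowOp E)†) x) = sigmaOp' C A hC γ x)
    {MC : Fock d (rowDefect C) →L[ℂ] Fock d (rowCodefect C)} (hMC : IsRowCharFun C MC)
    {MA : Fock d (rowDefect A) →L[ℂ] Fock d (rowCodefect A)} (hMA : IsRowCharFun A MA) :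
    amp (diagOp (.id ℂ (rowCodefect C)) (defectSpace γ).subtypeL)
        ∘L amp σ'.toLinearIsometry.toContinuousLinearMap ∘L rowCharFun E hE₁
      = fockDiag MC (.id ℂ (Fock d (rowCodefect A))) ∘L amp (julia γ)
        ∘L fockDiag (.id ℂ (Fock d (rowDefect C))) MA
        ∘L amp ((diagOp (defectSpace (γ†)).subtypeL (.id ℂ (rowDefect A)) :
            HilbSum (defectSpace (γ†)) (rowDefect A) →L[ℂ] HilbSum (rowDefect C) (rowDefect A))
          ∘L σ.toLinearIsometry.toContinuousLinearMap) := by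
  rw [(isRowCharFun_iff hC MC).1 hMC, (isRowCharFun_iff hA MA).1 hMA]
  refine ContinuousLinearMap.ext fun x => Fock.ext fun α => ?_
  refine Eq.trans ?_ (coeff_fockDiag_julia γ (rowCharFun C hC) (rowCharFun A hA)
    (defectSpace (γ†)).subtypeL σ.toLinearIsometry.toContinuousLinearMap
    (liftingOutput_mk_zero_coeff hA x) α).symm
  refine (congrArg (diagOp (.id ℂ (rowCodefect C)) (defectSpace γ).subtypeL)
    (sigma'_rowCharFun hC hA hE hE₁ hγ hσ hσ' x α)).trans (HilbSum.ext ?_ ?_)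
  · exact fst_diagOp _ _ _
  · exact snd_diagOp _ _ _

end Factorization

/-! ### The associativity of liftings -/

section Associativity

variable {d : ℕ} {H K L : Type*} [NormedAddCommGroup H] [InnerProductSpace ℂ H]
  [NormedAddCommGroup K] [InnerProductSpace ℂ K] [NormedAddCommGroup L] [InnerProductSpace ℂ L]

/-- The identification `(H ⊕ K) ⊕ L = H ⊕ (K ⊕ L)` as an operator. -/
def assocL (H K L : Type*) [NormedAddCommGroup H] [InnerProductSpace ℂ H]
    [NormedAddCommGroup K] [InnerProductSpace ℂ K] [NormedAddCommGroup L] [InnerProductSpace ℂ L] :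
    HilbSum (HilbSum H K) L →L[ℂ] HilbSum H (HilbSum K L) :=
  colBlock (HilbSum.fstL H K ∘L HilbSum.fstL (HilbSum H K) L)
    (colBlock (HilbSum.sndL H K ∘L HilbSum.fstL (HilbSum H K) L) (HilbSum.sndL (HilbSum H K) L))

lemma assocL_apply (x : HilbSum (HilbSum H K) L) : assocL H K L x = x.assoc := rfl

lemma norm_assoc (x : HilbSum (HilbSum H K) L) : ‖x.assoc‖ = ‖x‖ := by
  rw [← sq_eq_sq₀ (norm_nonneg _) (norm_nonneg _), HilbSum.norm_sq, HilbSum.norm_sq x.assoc.snd,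
    HilbSum.norm_sq x, HilbSum.norm_sq x.fst]
  exact (add_assoc _ _ _).symm

lemma liftRow_hatB_assoc (C : Fin d → H →L[ℂ] H) (B : Fin d → H →L[ℂ] K) (A : Fin d → K →L[ℂ] K)
    (B' : Fin d → HilbSum H K →L[ℂ] L) (A' : Fin d → L →L[ℂ] L) (i : Fin d)
    (x : HilbSum (HilbSum H K) L) :
    liftRow C (hatB B B') (liftRow A (sndPart B') A') i x.assoc
      = (liftRow (liftRow C B A) B' A' i x).assoc := by
  have h : B' i x.fst = B' i (inlOp H K x.fst.fst) + B' i (inrOp H K x.fst.snd) := by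
    rw [← map_add, ← mk_eq_inlOp_add_inrOp]
    rfl
  refine HilbSum.ext ?_ (HilbSum.ext ?_ ?_)
  · simp [liftRow, HilbSum.assoc]
  · simp [liftRow, HilbSum.assoc, hatB]
  · simp [liftRow, HilbSum.assoc, hatB, fstPart, sndPart, h, add_assoc]

lemma norm_rowOp_liftRow_hatB {C : Fin d → H →L[ℂ] H} {B : Fin d → H →L[ℂ] K}
    {A : Fin d → K →L[ℂ] K} {B' : Fin d → HilbSum H K →L[ℂ] L} {A' : Fin d → L →L[ℂ] L}
    (h : ‖rowOp (liftRow (liftRow C B A) B' A')‖ ≤ 1) :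
    ‖rowOp (liftRow C (hatB B B') (liftRow A (sndPart B') A'))‖ ≤ 1 := by
  refine ContinuousLinearMap.opNorm_le_bound _ zero_le_one fun y => ?_
  let z : HilbPow d (HilbSum (HilbSum H K) L) := WithLp.toLp 2 fun i =>
    HilbSum.mk (HilbSum.mk (y i).fst (y i).snd.fst) (y i).snd.snd
  have hz : ∀ i, y i = (z i).assoc := fun i => rfl
  have h₁ : rowOp (liftRow C (hatB B B') (liftRow A (sndPart B') A')) y
      = (rowOp (liftRow (liftRow C B A) B' A') z).assoc := by
    rw [rowOp_apply, rowOp_apply, ← assocL_apply, map_sum]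
    exact Finset.sum_congr rfl fun i _ => liftRow_hatB_assoc C B A B' A' i (z i)
  have h₂ : ‖z‖ = ‖y‖ := by
    rw [← sq_eq_sq₀ (norm_nonneg _) (norm_nonneg _), HilbPow.norm_sq, HilbPow.norm_sq]
    simp only [hz, norm_assoc]
  rw [h₁, norm_assoc, one_mul, ← h₂]
  exact norm_apply_le_of_norm_le_one h z

end Associativity

end

theorem theorem3p5 {d : ℕ} {HC HA HA' : Type*}
    [NormedAddCommGroup HC] [InnerProductSpace ℂ HC] [CompleteSpace HC]
    [NormedAddCommGroup HA] [InnerProductSpace ℂ HA] [CompleteSpace HA]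
    [NormedAddCommGroup HA'] [InnerProductSpace ℂ HA'] [CompleteSpace HA']
    (C : Fin d → HC →L[ℂ] HC) (B : Fin d → HC →L[ℂ] HA) (A : Fin d → HA →L[ℂ] HA)
    (B' : Fin d → HilbSum HC HA →L[ℂ] HA') (A' : Fin d → HA' →L[ℂ] HA')
    (hC : IsRowContraction C)
    -- `E` is a minimal contractive lifting of `C` by `A`
    (E : Fin d → HilbSum HC HA →L[ℂ] HilbSum HC HA) (hE : E = liftRow C B A)
    (hEmin : IsMinimalContractive E)
    -- the lifting of `E` by `A'` is minimal and contractive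
    (hE'min : IsMinimalContractive (liftRow E B' A'))
    (Ahat : Fin d → HilbSum HA HA' →L[ℂ] HilbSum HA HA') (hAhat : Ahat = liftRow A (sndPart B') A')
    -- `E'` is the lifting of `E` by `A'`, regarded as a lifting of `C` by `Ahat`
    (E' : Fin d → HilbSum HC (HilbSum HA HA') →L[ℂ] HilbSum HC (HilbSum HA HA'))
    (hE' : E' = liftRow C (hatB B B') Ahat) :
    (∀ i x, E' i (HilbSum.assoc x) = HilbSum.assoc (liftRow E B' A' i x)) ∧
    IsRowContraction E' ∧ IsRowContraction Ahat ∧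
    -- the objects in the factorization exist and are unique
    (∃! M, IsLiftingCharFun C E' M) ∧
    (∃! MA, IsRowCharFun A MA) ∧
    (∃! MA', IsRowCharFun A' MA') ∧
    (∃! γ, IsLiftingContraction C (hatB B B') Ahat γ) ∧
    (∃! δ, IsLiftingContraction A (sndPart B') A' δ) ∧
    ∀ γ, IsLiftingContraction C (hatB B B') Ahat γ →
    ∀ δ, IsLiftingContraction A (sndPart B') A' δ →
      (∃! σ, IsSigma A A' Ahat δ σ) ∧
      (∃! σ', IsSigma' A A' Ahat δ σ') ∧
      (∃! σE', IsSigma C Ahat E' γ σE') ∧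
      ∀ M, IsLiftingCharFun C E' M →
      ∀ MA, IsRowCharFun A MA →
      ∀ MA', IsRowCharFun A' MA' →
      ∀ σ, IsSigma A A' Ahat δ σ →
      ∀ σ', IsSigma' A A' Ahat δ σ' →
      ∀ σE', IsSigma C Ahat E' γ σE' →
        -- `T` is the product of the factors to the right of `σ'⁻¹`; its values lie in
        -- `Γ ⊗ (𝓓_C ⊕ 𝓓_{*,A} ⊕ 𝓓_δ)`, where `I ⊗ diag(I, σ'⁻¹)` is defined
        ∃ T : Fock d (HilbPow d (HilbSum HC (HilbSum HA HA'))) →L[ℂ]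
            Fock d (HilbSum (rowDefect C) (HilbSum (rowCodefect A) (defectSpace δ))),
          amp (diagOp (.id ℂ (rowDefect C))
                (diagOp (.id ℂ (rowCodefect A)) (defectSpace δ).subtypeL)) ∘L T
            = fockDiag (.id ℂ (Fock d (rowDefect C)))
                  (fockDiag MA (.id ℂ (Fock d (rowCodefect A'))))
              ∘L amp (diagOp (.id ℂ (rowDefect C)) (julia δ))
              ∘L fockDiag (.id ℂ (Fock d (rowDefect C)))
                  (fockDiag (.id ℂ (Fock d (rowDefect A))) MA')
              ∘L amp (diagOp (defectSpace (γ†)).subtypeL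
                  ((diagOp (defectSpace (δ†)).subtypeL (.id ℂ (rowDefect A')) :
                      HilbSum (defectSpace (δ†)) (rowDefect A') →L[ℂ]
                        HilbSum (rowDefect A) (rowDefect A'))
                    ∘L σ.toLinearIsometry.toContinuousLinearMap))
              ∘L amp (σE'.toLinearIsometry.toContinuousLinearMap ∘L toDefect (rowOp E')) ∧
          M ∘L amp (toDefect (rowOp E'))
            = amp (rowBlock (defect (γ†)) γ)
              ∘L amp (diagOp (.id ℂ (rowDefect C)) σ'.symm.toLinearIsometry.toContinuousLinearMap)
              ∘L T := by
  have hC₁ := (isRowContraction_iff C).1 hC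
  have hE₁ := (isRowContraction_iff _).1 hEmin.1
  have hA₁ : ‖rowOp A‖ ≤ 1 := norm_rowOp_right_of_liftRow (hE ▸ hE₁)
  have hE'₁ := (isRowContraction_iff _).1 hE'min.1
  have hE'₂ : ‖rowOp (liftRow C (hatB B B') (liftRow A (sndPart B') A'))‖ ≤ 1 :=
    norm_rowOp_liftRow_hatB (hE ▸ hE'₁)
  have hAhat₂ := norm_rowOp_right_of_liftRow hE'₂
  have hA'₁ := norm_rowOp_right_of_liftRow hAhat₂
  have hAhat₁ : ‖rowOp Ahat‖ ≤ 1 := hAhat.symm ▸ hAhat₂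
  have hE'₃ : ‖rowOp (liftRow C (hatB B B') Ahat)‖ ≤ 1 := hAhat.symm ▸ hE'₂
  have hE'₄ : ‖rowOp E'‖ ≤ 1 := hE'.symm ▸ hE'₃
  refine ⟨?_, (isRowContraction_iff E').2 hE'₄, (isRowContraction_iff Ahat).2 hAhat₁, ?_,
    existsUnique_isRowCharFun hA₁, existsUnique_isRowCharFun hA'₁,
    existsUnique_isLiftingContraction hC₁ hE'₃, existsUnique_isLiftingContraction hA₁ hAhat₂, ?_⟩
  · subst hE hE' hAhat
    exact liftRow_hatB_assoc C B A B' A'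
  · subst hE'
    exact existsUnique_isLiftingCharFun hC₁ hE'₃
  intro γ hγ δ hδ
  refine ⟨?_, ?_, ?_, ?_⟩
  · subst hAhat
    exact existsUnique_isSigma hA₁ hAhat₂ hδ
  · subst hAhat
    exact existsUnique_isSigma' hA₁ hAhat₂ hδ
  · subst hE'
    exact existsUnique_isSigma hC₁ hE'₃ hγ
  intro M hM MA hMA MA' hMA' σ hσ σ' hσ' σE' hσE'
  have hσ₁ := (isSigma_iff hA'₁).1 hσ
  have hσ'₁ := (isSigma'_iff hA₁).1 hσ'
  have hσE'₁ := (isSigma_iff hAhat₁).1 hσE'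
  have hM₁ := (isLiftingCharFun_iff hC₁ hAhat₁ hE' hE'₄ hγ hσE'₁ M).1 hM
  -- the coordinate in `𝓓_{*,γ}` is left alone, and on the other one acts `σ' M_Â`
  refine ⟨fockDiag (amp (defectSpace (γ†)).subtypeL)
      (amp σ'.toLinearIsometry.toContinuousLinearMap ∘L rowCharFun Ahat hAhat₁)
    ∘L amp (σE'.toLinearIsometry.toContinuousLinearMap ∘L toDefect (rowOp E')), ?_, ?_⟩
  · have h := amp_sigma'_comp_rowCharFun hA₁ hA'₁ hAhat hAhat₁ hδ hσ₁ hσ'₁ hMA hMA'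
    exact fockDiag_factorization (s := (defectSpace (γ†)).subtypeL) h _
  · refine ContinuousLinearMap.ext fun y => Fock.ext fun α => ?_
    refine (congrArg (Fock.coeff α) (hM₁ (amp (toDefect (rowOp E')) y))).trans ?_
    refine (liftingOutput_mk_zero_coeff hAhat₁ (amp (toDefect (rowOp E')) y) α).trans ?_
    exact (coeff_amp_rowBlock_fockDiag (defect (γ†)) γ (defectSpace (γ†)).subtypeL
      (rowCharFun Ahat hAhat₁) σ' σE'.toLinearIsometry.toContinuousLinearMap
      (amp (toDefect (rowOp E')) y) α).symm
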